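/- Let $\Lambda$ be a left artinian ring and let $E\subseteq \Lambda$ be a semisimple subring such that $\Lambda$ is finitely generated as a left $E$-module. Let $\Lambda\text{-mod}$ be the category of finitely generated left $\Lambda$-modules, and let $\Omega_{\rm nc}=(\Lambda/E)\otimes_E\Lambda$ be the $\Lambda$-$\Lambda$-bimodule of $E$-relative noncommutative differential $1$-forms, with left action $b(\overline a\otimes x)=\overline{ba}\otimes x-\overline b\otimes ax$ and right action $(\overline a\otimes x)b=\overline a\otimes xb$. For an additive category $\mathcal C$ with an additive endofunctor $\Omega$, the stabilization $\mathcal S(\mathcal C,\Omega)$ has as objects the pairs $(X,n)$ with $X\in\mathcal C$ and $n\in\mathbb Z$, and as morphisms $(X,n)\to(Y,m)$ the elements of $\varinjlim_{p\ge \max\{n,m\}}\mathcal C(\Omega^{p-n}X,\Omega^{p-m}Y)$, with transition maps induced by $\Omega$; the class of $f\in \mathcal C(\Omega^{p-n}X,\Omega^{p-m}Y)$ is written $[f;p]$, and composition is induced by that of $\mathcal C$. Let $$\mathcal S=\mathcal S(\Lambda\text{-mod},\,\Omega_{\rm nc}\otimes_\Lambda-).$$ 1. The category $\mathcal S$ is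 Frobenius abelian, that is, it is abelian, has enough projective objects and enough injective objects, and an object of $\mathcal S$ is projective if and only if it is injective. 2. An object of $\mathcal S$ is projective (equivalently, injective) if and only if it belongs to ${\rm add}\{(\Lambda,n)\mid n\in\mathbb Z\}$, that is, if and only if it is a direct summand of a finite direct sum of objects of the form $(\Lambda,n)$. 3. Let $\underline{\mathcal S}$ be the stable category of $\mathcal S$, the factor category modulo the morphisms that factor through projective objects, with its canonical triangulated structure (the suspension of $X$ is the cokernel of a monomorphism from $X$ into an injective object, and the distinguished triangles are, up to isomorphism, the standard triangles obtained from pushouts along such monomorphisms). Let $\Lambda\text{-}\underline{\rm mod}$ be the factor category of $\Lambda\text{-mod}$ modulo the morphisms that factor through projective modules; the functor $\Omega_{\rm nc}\otimes_\Lambda-$ preserves projective modules and induces an endofunctor of $\Lambda\text{-}\underline{\rm mod}$. There is a triangle equivalence $$\underline{\mathcal S}\;\simeq\;\mathcal S(\Lambda\text{-}\underline{\rm mod},\,\Omega_{\rm nc}\otimes_\Lambda-).$$ Here the suspension of the right hand side is $(X,n)\mapsto(X,n+1)$, $[f;p]\mapsto[f;p+1]$, and its distinguished triangles are those isomorphic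 to $$(X,n)\xrightarrow{[\underline f;n]}(Y,n)\xrightarrow{[\underline g;n]}(Z,n)\xrightarrow{(-1)^{n+1}[\underline\omega;n+1]}(X,n+1)$$ for some $n\in\mathbb Z$ and some exact sequence $0\to X\xrightarrow{f}Y\xrightarrow{g}Z\to0$ in $\Lambda\text{-mod}$, where $\omega\colon\Omega_{\rm nc}\otimes_\Lambda Z\to X$ is part of a morphism $(\omega,\phi,{\rm id}_Z)$ of short exact sequences from $$0\to\Omega_{\rm nc}\otimes_\Lambda Z\xrightarrow{\iota_Z}\Lambda\otimes_EZ\xrightarrow{\mu_Z}Z\to0,\qquad \iota_Z((\overline a\otimes b)\otimes z)=a\otimes bz-1\otimes abz,\quad \mu_Z(a\otimes z)=az,$$ to $0\to X\to Y\to Z\to 0$. 4. There is a triangle equivalence $$\underline{\mathcal S}\;\simeq\;\mathbf D_{\rm sg}(\Lambda),$$ where $\mathbf D_{\rm sg}(\Lambda)=\mathbf D^b(\Lambda\text{-mod})/\mathbf K^b(\Lambda\text{-proj})$ is the singularity category, the Verdier quotient of the bounded derived category of $\Lambda\text{-mod}$ by the bounded homotopy category of finitely generated projective modules. -/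

import Mathlib

open CategoryTheory CategoryTheory.Limits
open scoped TensorProduct

universe w v u v' u'

namespace Looped

section Stab

variable {C : Type u} [Category.{v} C]

/-- The iterates `Ω ^ k` of an endofunctor. -/
def iter (Ω : C ⥤ C) : ℕ → (C ⥤ C)
  | 0 => 𝟭 C
  | k + 1 => iter Ω k ⋙ Ω

/-- The objects of the stabilization `S(C, Ω)`: pairs `(X, n)` of an object of `C` and an integer. -/
structure Stabilization (Ω : C ⥤ C) where
  /-- the object of `C` -/
  obj : C
  /-- the integer -/
  deg : ℤ

namespace Stabilization

variable {Ω : C ⥤ C}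

/-- `Ω f`, for a morphism `f` between iterates of `Ω`. -/
def bump {X Y : C} {a b : ℕ} (f : (iter Ω a).obj X ⟶ (iter Ω b).obj Y) :
    (iter Ω (a + 1)).obj X ⟶ (iter Ω (b + 1)).obj Y :=
  Ω.map f

/-- A representative of a morphism `(X, n) ⟶ (Y, m)`: a morphism `Ω ^ (p - n) X ⟶ Ω ^ (p - m) Y` of `C`
for some `p ≥ max n m`.  We record `a = p - n` and `b = p - m`, so `p = n + a = m + b`. -/
structure Rep (X Y : Stabilization Ω) where
  /-- the exponent `p - n` -/
  a : ℕ
  /-- the exponent `p - m` -/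
  b : ℕ
  /-- both exponents come from the same `p` -/
  eq : X.deg + a = Y.deg + b
  /-- the morphism of `C` -/
  map : (iter Ω a).obj X.obj ⟶ (iter Ω b).obj Y.obj

/-- The transition map of the colimit: `f` at stage `p` is sent to `Ω f` at stage `p + 1`. -/
def Rep.next {X Y : Stabilization Ω} (r : Rep X Y) : Rep X Y :=
  ⟨r.a + 1, r.b + 1, by have := r.eq; push_cast; omega, bump r.map⟩

/-- The Hom-set `colim_p C(Ω ^ (p - n) X, Ω ^ (p - m) Y)`. -/
def Hom (X Y : Stabilization Ω) : Type v :=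
  Quot (fun r s : Rep X Y => s = r.next)

/-- The class `[f; p]` of a morphism `f : Ω ^ a X ⟶ Ω ^ b Y`, where `p = n + a = m + b`. -/
def cls {X Y : Stabilization Ω} (a b : ℕ) (h : X.deg + a = Y.deg + b)
    (f : (iter Ω a).obj X.obj ⟶ (iter Ω b).obj Y.obj) : Hom X Y :=
  Quot.mk _ ⟨a, b, h, f⟩

/-- `Ω ^ k f`, as a morphism between the iterates with exponents `a + k` and `b + k`. -/
def raise {X Y : C} {a b : ℕ} (f : (iter Ω a).obj X ⟶ (iter Ω b).obj Y) :
    (k : ℕ) → ((iter Ω (a + k)).obj X ⟶ (iter Ω (b + k)).obj Y)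
  | 0 => f
  | k + 1 => bump (raise f k)

/-- Transport along equalities of exponents. -/
def castMap {X Y : C} {a b a' b' : ℕ} (ha : a = a') (hb : b = b')
    (f : (iter Ω a).obj X ⟶ (iter Ω b).obj Y) : (iter Ω a').obj X ⟶ (iter Ω b').obj Y :=
  eqToHom (by rw [ha]) ≫ f ≫ eqToHom (by rw [hb])

theorem castMap_rfl {X Y : C} {a b : ℕ} (f : (iter Ω a).obj X ⟶ (iter Ω b).obj Y) :
    castMap rfl rfl f = f := by
  simp [castMap]

theorem bump_comp {X Y Z : C} {a b c : ℕ} (f : (iter Ω a).obj X ⟶ (iter Ω b).obj Y)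
    (g : (iter Ω b).obj Y ⟶ (iter Ω c).obj Z) : bump (f ≫ g) = bump f ≫ bump g :=
  Ω.map_comp f g

theorem raise_comp {X Y Z : C} {a b c : ℕ} (f : (iter Ω a).obj X ⟶ (iter Ω b).obj Y)
    (g : (iter Ω b).obj Y ⟶ (iter Ω c).obj Z) (k : ℕ) :
    raise (f ≫ g) k = raise f k ≫ raise g k := by
  induction k with
  | zero => rfl
  | succ k ih => exact (congrArg bump ih).trans (bump_comp _ _)

theorem raise_id (X : C) (a k : ℕ) :
    raise (𝟙 ((iter Ω a).obj X)) k = 𝟙 ((iter Ω (a + k)).obj X) := by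
  induction k with
  | zero => rfl
  | succ k ih => exact (congrArg bump ih).trans (Ω.map_id _)

theorem bump_castMap {X Y : C} {a b a' b' : ℕ} (ha : a = a') (hb : b = b')
    (f : (iter Ω a).obj X ⟶ (iter Ω b).obj Y) :
    bump (castMap ha hb f) = castMap (congrArg (· + 1) ha) (congrArg (· + 1) hb) (bump f) := by
  subst ha hb
  rw [castMap_rfl, castMap_rfl]

theorem raise_bump {X Y : C} {a b : ℕ} (f : (iter Ω a).obj X ⟶ (iter Ω b).obj Y) (k : ℕ) :
    raise (bump f) k = castMap (by omega) (by omega) (raise f (k + 1)) := by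
  induction k with
  | zero => exact (castMap_rfl _).symm
  | succ k ih => exact (congrArg bump ih).trans (bump_castMap _ _ _)

theorem cls_bump {X Y : Stabilization Ω} (a b : ℕ) (h : X.deg + a = Y.deg + b)
    (h' : X.deg + (a + 1 : ℕ) = Y.deg + (b + 1 : ℕ))
    (f : (iter Ω a).obj X.obj ⟶ (iter Ω b).obj Y.obj) :
    cls (a + 1) (b + 1) h' (bump f) = cls a b h f :=
  (Quot.sound (r := fun r s : Rep X Y => s = r.next) (a := ⟨a, b, h, f⟩) rfl).symm

theorem cls_raise {X Y : Stabilization Ω} (a b : ℕ) (h : X.deg + a = Y.deg + b)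
    (f : (iter Ω a).obj X.obj ⟶ (iter Ω b).obj Y.obj) (k : ℕ)
    (h' : X.deg + (a + k : ℕ) = Y.deg + (b + k : ℕ)) :
    cls (a + k) (b + k) h' (raise f k) = cls a b h f := by
  induction k with
  | zero => rfl
  | succ k ih =>
    rw [← ih (by push_cast; omega)]
    exact cls_bump _ _ _ _ _

theorem cls_castMap {X Y : Stabilization Ω} {a b a' b' : ℕ} (ha : a = a') (hb : b = b')
    (h : X.deg + a = Y.deg + b) (h' : X.deg + a' = Y.deg + b')
    (f : (iter Ω a).obj X.obj ⟶ (iter Ω b).obj Y.obj) :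
    cls a' b' h' (castMap ha hb f) = cls a b h f := by
  subst ha hb
  rw [castMap_rfl]

theorem exists_rep {X Y : Stabilization Ω} (u : Hom X Y) :
    ∃ (a b : ℕ) (h : X.deg + a = Y.deg + b)
      (f : (iter Ω a).obj X.obj ⟶ (iter Ω b).obj Y.obj), u = cls a b h f := by
  obtain ⟨a, b, h, f⟩ := u
  exact ⟨a, b, h, f, rfl⟩

/-- The composite of two representatives, formed after raising them by `k` and `l`. -/
def compAt {X Y Z : Stabilization Ω} (r : Rep X Y) (s : Rep Y Z) (k l : ℕ)
    (h : s.a + l = r.b + k) : Hom X Z :=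
  cls (r.a + k) (s.b + l) (by have := r.eq; have := s.eq; push_cast; omega)
    (raise r.map k ≫ castMap h rfl (raise s.map l))

theorem compAt_succ {X Y Z : Stabilization Ω} (r : Rep X Y) (s : Rep Y Z) (k l : ℕ)
    (h : s.a + l = r.b + k) (h' : s.a + (l + 1) = r.b + (k + 1)) :
    compAt r s (k + 1) (l + 1) h' = compAt r s k l h := by
  have h0 : X.deg + (r.a + k : ℕ) = Z.deg + (s.b + l : ℕ) := by
    have := r.eq; have := s.eq; push_cast; omega
  refine Eq.trans ?_ (cls_bump _ _ h0 (by push_cast at h0 ⊢; omega) _)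
  rw [bump_comp, bump_castMap]
  rfl

theorem compAt_add {X Y Z : Stabilization Ω} (r : Rep X Y) (s : Rep Y Z) (k l j : ℕ)
    (h : s.a + l = r.b + k) (h' : s.a + (l + j) = r.b + (k + j)) :
    compAt r s (k + j) (l + j) h' = compAt r s k l h := by
  induction j with
  | zero => rfl
  | succ j ih =>
    rw [← ih (by omega)]
    exact compAt_succ _ _ _ _ _ _

theorem compAt_eq {X Y Z : Stabilization Ω} (r : Rep X Y) (s : Rep Y Z) (k l k' l' : ℕ)
    (h : s.a + l = r.b + k) (h' : s.a + l' = r.b + k') :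
    compAt r s k l h = compAt r s k' l' h' := by
  rcases le_total k k' with hk | hk
  · obtain ⟨j, rfl⟩ := Nat.exists_eq_add_of_le hk
    obtain rfl : l' = l + j := by omega
    exact (compAt_add _ _ _ _ _ _ _).symm
  · obtain ⟨j, rfl⟩ := Nat.exists_eq_add_of_le hk
    obtain rfl : l = l' + j := by omega
    exact compAt_add _ _ _ _ _ _ _

theorem compAt_next_left {X Y Z : Stabilization Ω} (r : Rep X Y) (s : Rep Y Z) (k l : ℕ)
    (h : s.a + l = r.b + 1 + k) (h' : s.a + l = r.b + (k + 1)) :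
    compAt r.next s k l h = compAt r s (k + 1) l h' := by
  have e : ∀ {P Q R : C} {a b b' c a' d : ℕ} (ha : a = a') (hb : b = b') (hc : c = b)
      (f : (iter Ω a).obj P ⟶ (iter Ω b).obj Q) (g : (iter Ω c).obj Q ⟶ (iter Ω d).obj R),
      castMap ha hb f ≫ castMap (hc.trans hb) rfl g = castMap ha rfl (f ≫ castMap hc rfl g) := by
    intro P Q R a b b' c a' d ha hb hc f g
    subst ha hb hc
    simp only [castMap_rfl]
  have hd : X.deg + (r.a + (k + 1) : ℕ) = Z.deg + (s.b + l : ℕ) := by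
    have := r.eq; have := s.eq; push_cast; omega
  refine Eq.trans ?_ (cls_castMap (show r.a + (k + 1) = r.a + 1 + k by omega) rfl hd
    (by push_cast at hd ⊢; omega) _)
  rw [← e (show r.a + (k + 1) = r.a + 1 + k by omega) (show r.b + (k + 1) = r.b + 1 + k by omega) h',
    ← raise_bump]
  rfl

theorem compAt_next_right {X Y Z : Stabilization Ω} (r : Rep X Y) (s : Rep Y Z) (k l : ℕ)
    (h : s.a + 1 + l = r.b + k) (h' : s.a + (l + 1) = r.b + k) :
    compAt r s.next k l h = compAt r s k (l + 1) h' := by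
  have e : ∀ {P Q R : C} {a b c c' d d' : ℕ} (hc : c = b) (hc' : c = c') (hcb : c' = b) (hd : d = d')
      (f : (iter Ω a).obj P ⟶ (iter Ω b).obj Q) (g : (iter Ω c).obj Q ⟶ (iter Ω d).obj R),
      f ≫ castMap hcb rfl (castMap hc' hd g) = castMap rfl hd (f ≫ castMap hc rfl g) := by
    intro P Q R a b c c' d d' hc hc' hcb hd f g
    subst hc hc' hd
    simp only [castMap_rfl]
  have hd : X.deg + (r.a + k : ℕ) = Z.deg + (s.b + (l + 1) : ℕ) := by
    have := r.eq; have := s.eq; push_cast; omega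
  refine Eq.trans ?_ (cls_castMap rfl (show s.b + (l + 1) = s.b + 1 + l by omega) hd
    (by push_cast at hd ⊢; omega) _)
  rw [← e h' (show s.a + (l + 1) = s.a + 1 + l by omega) h, ← raise_bump]
  rfl

/-- Composition in the stabilization: two representatives are raised to a common stage and composed
in `C`; the result does not depend on the stage. -/
def comp {X Y Z : Stabilization Ω} (u : Hom X Y) (v : Hom Y Z) : Hom X Z :=
  Quot.liftOn₂ u v (fun r s => compAt r s s.a r.b (Nat.add_comm _ _))
    (by
      rintro r s _ rfl
      exact (compAt_eq r s _ _ (s.a + 1) (r.b + 1) _ (by omega)).trans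
        (compAt_next_right r s (s.a + 1) r.b (by omega) (by omega)).symm)
    (by
      rintro r _ s rfl
      exact (compAt_eq r s _ _ (s.a + 1) (r.b + 1) _ (by omega)).trans
        (compAt_next_left r s s.a (r.b + 1) (by omega) (by omega)).symm)

theorem comp_cls {X Y Z : Stabilization Ω} {a b c : ℕ} (h : X.deg + a = Y.deg + b)
    (h' : Y.deg + b = Z.deg + c) (f : (iter Ω a).obj X.obj ⟶ (iter Ω b).obj Y.obj)
    (g : (iter Ω b).obj Y.obj ⟶ (iter Ω c).obj Z.obj) :
    comp (cls a b h f) (cls b c h' g) = cls a c (h.trans h') (f ≫ g) := by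
  refine (compAt_eq (Rep.mk a b h f) (Rep.mk b c h' g) _ _ 0 0 _ rfl).trans ?_
  unfold compAt
  rw [castMap_rfl]
  rfl

theorem exists_rep_comp {X Y Z : Stabilization Ω} (u : Hom X Y) (v : Hom Y Z) :
    ∃ (a b c : ℕ) (h : X.deg + a = Y.deg + b) (h' : Y.deg + b = Z.deg + c)
      (f : (iter Ω a).obj X.obj ⟶ (iter Ω b).obj Y.obj)
      (g : (iter Ω b).obj Y.obj ⟶ (iter Ω c).obj Z.obj), u = cls a b h f ∧ v = cls b c h' g := by
  obtain ⟨a, b, h, f, rfl⟩ := exists_rep u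
  obtain ⟨b', c, h', g, rfl⟩ := exists_rep v
  refine ⟨a + b', b + b', c + b, by push_cast; omega, by push_cast; omega, raise f b',
    castMap (Nat.add_comm _ _) rfl (raise g b), (cls_raise _ _ _ _ _ _).symm, ?_⟩
  rw [cls_castMap (h := by push_cast; omega), cls_raise]

theorem exists_rep_add {X Y : Stabilization Ω} (u v : Hom X Y) :
    ∃ (a b : ℕ) (h : X.deg + a = Y.deg + b)
      (f g : (iter Ω a).obj X.obj ⟶ (iter Ω b).obj Y.obj), u = cls a b h f ∧ v = cls a b h g := by
  obtain ⟨a, b, h, f, rfl⟩ := exists_rep u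
  obtain ⟨a', b', h', g, rfl⟩ := exists_rep v
  refine ⟨a + a', b + a', by push_cast; omega, raise f a',
    castMap (Nat.add_comm _ _) (by omega) (raise g a), (cls_raise _ _ _ _ _ _).symm, ?_⟩
  rw [cls_castMap (h := by push_cast; omega), cls_raise]

theorem cls_id (X : Stabilization Ω) (a : ℕ) :
    cls a a rfl (𝟙 ((iter Ω a).obj X.obj)) = (cls 0 0 rfl (𝟙 X.obj) : Hom X X) := by
  rw [← cls_raise 0 0 rfl (𝟙 X.obj) a rfl]
  have h := raise_id (Ω := Ω) X.obj 0 a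
  refine Eq.trans ?_ (congrArg (cls (X := X) (Y := X) (0 + a) (0 + a) rfl) h).symm
  rw [← cls_castMap (Nat.zero_add a).symm (Nat.zero_add a).symm rfl rfl]
  congr 1
  simp [castMap]

instance : Category.{v} (Stabilization Ω) where
  Hom := Hom
  id X := cls 0 0 rfl (𝟙 X.obj)
  comp := comp
  id_comp u := by
    obtain ⟨a, b, h, f, rfl⟩ := exists_rep u
    rw [← cls_id _ a, comp_cls, Category.id_comp]
  comp_id u := by
    obtain ⟨a, b, h, f, rfl⟩ := exists_rep u
    rw [← cls_id _ b, comp_cls, Category.comp_id]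
  assoc {W X Y Z} u v t := by
    obtain ⟨a, b, c, h, h', f, g, rfl, rfl⟩ := exists_rep_comp u v
    obtain ⟨c', d, h'', k, rfl⟩ := exists_rep t
    rw [← cls_raise a b h f c' (by push_cast; omega), ← cls_raise b c h' g c' (by push_cast; omega),
      ← cls_raise c' d h'' k c (by push_cast; omega),
      ← cls_castMap (Nat.add_comm c' c) rfl (by push_cast; omega) (by push_cast; omega)
        (raise k c), comp_cls, comp_cls, comp_cls, comp_cls, Category.assoc]

/-- The morphism `[f; p] : (X, n) ⟶ (Y, m)` given by `f : Ω ^ a X ⟶ Ω ^ b Y` with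
`p = n + a = m + b`. -/
def homMk {X Y : Stabilization Ω} (a b : ℕ) (h : X.deg + a = Y.deg + b)
    (f : (iter Ω a).obj X.obj ⟶ (iter Ω b).obj Y.obj) : X ⟶ Y :=
  cls a b h f

/-- The automorphism `Σ` of the stabilization, `(X, n) ↦ (X, n + 1)` and `[f; p] ↦ [f; p + 1]`. -/
def suspension (Ω : C ⥤ C) : Stabilization Ω ⥤ Stabilization Ω where
  obj X := ⟨X.obj, X.deg + 1⟩
  map {X Y} u := Quot.liftOn u
    (fun r => cls (X := ⟨X.obj, X.deg + 1⟩) (Y := ⟨Y.obj, Y.deg + 1⟩) r.a r.b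
      (by have := r.eq; dsimp only; omega) r.map)
    (by
      rintro r _ rfl
      exact (cls_bump _ _ _ _ _).symm)
  map_id X := rfl
  map_comp {X Y Z} u v := by
    obtain ⟨a, b, c, h, h', f, g, rfl, rfl⟩ := exists_rep_comp u v
    have e := comp_cls (X := ⟨X.obj, X.deg + 1⟩) (Y := ⟨Y.obj, Y.deg + 1⟩) (Z := ⟨Z.obj, Z.deg + 1⟩)
      (a := a) (b := b) (c := c) (by dsimp only; omega) (by dsimp only; omega) f g
    have e' := comp_cls h h' f g
    change Quot.liftOn (comp (cls a b h f) (cls b c h' g)) _ _ = _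
    rw [e']
    exact e.symm

section Preadditive

variable [Preadditive C]

theorem raise_zero [Ω.Additive] (X Y : C) (a b k : ℕ) :
    raise (0 : (iter Ω a).obj X ⟶ (iter Ω b).obj Y) k = 0 := by
  induction k with
  | zero => rfl
  | succ k ih => exact (congrArg bump ih).trans (Ω.map_zero _ _)

theorem bump_add [Ω.Additive] {X Y : C} {a b : ℕ} (f g : (iter Ω a).obj X ⟶ (iter Ω b).obj Y) :
    bump (f + g) = bump f + bump g :=
  Ω.map_add

theorem raise_add [Ω.Additive] {X Y : C} {a b : ℕ} (f g : (iter Ω a).obj X ⟶ (iter Ω b).obj Y)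
    (k : ℕ) : raise (f + g) k = raise f k + raise g k := by
  induction k with
  | zero => rfl
  | succ k ih => exact (congrArg bump ih).trans (bump_add _ _)

theorem castMap_add {X Y : C} {a b a' b' : ℕ} (ha : a = a') (hb : b = b')
    (f g : (iter Ω a).obj X ⟶ (iter Ω b).obj Y) :
    castMap ha hb (f + g) = castMap ha hb f + castMap ha hb g := by
  subst ha hb
  simp only [castMap_rfl]

/-- The sum of two representatives, formed after raising them by `k` and `l`. -/
def addAt {X Y : Stabilization Ω} (r s : Rep X Y) (k l : ℕ) (h : s.a + l = r.a + k) : Hom X Y :=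
  cls (r.a + k) (r.b + k) (by have := r.eq; push_cast; omega)
    (raise r.map k + castMap h (by have := r.eq; have := s.eq; omega) (raise s.map l))

theorem addAt_next_left {X Y : Stabilization Ω} (r s : Rep X Y) (k l : ℕ)
    (h : s.a + l = r.a + 1 + k) (h' : s.a + l = r.a + (k + 1)) :
    addAt r.next s k l h = addAt r s (k + 1) l h' := by
  have e : ∀ {P Q : C} {a b a' b' c d : ℕ} (ha : a = a') (hb : b = b') (hc : c = a) (hd : d = b)
      (f : (iter Ω a).obj P ⟶ (iter Ω b).obj Q) (g : (iter Ω c).obj P ⟶ (iter Ω d).obj Q),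
      castMap ha hb f + castMap (hc.trans ha) (hd.trans hb) g =
        castMap ha hb (f + castMap hc hd g) := by
    intro P Q a b a' b' c d ha hb hc hd f g
    subst ha hb hc hd
    simp only [castMap_rfl]
  have h0 : X.deg + (r.a + (k + 1) : ℕ) = Y.deg + (r.b + (k + 1) : ℕ) := by
    have := r.eq; push_cast; omega
  refine Eq.trans ?_ (cls_castMap (show r.a + (k + 1) = r.a + 1 + k by omega)
    (show r.b + (k + 1) = r.b + 1 + k by omega) h0 (by push_cast at h0 ⊢; omega) _)
  rw [← e, ← raise_bump]
  rfl

theorem addAt_next_right {X Y : Stabilization Ω} (r s : Rep X Y) (k l : ℕ)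
    (h : s.a + 1 + l = r.a + k) (h' : s.a + (l + 1) = r.a + k) :
    addAt r s.next k l h = addAt r s k (l + 1) h' := by
  have e : ∀ {P Q : C} {a b a' b' c d : ℕ} (ha : a = a') (hb : b = b') (ha' : a' = c) (hb' : b' = d)
      (f : (iter Ω a).obj P ⟶ (iter Ω b).obj Q),
      castMap ha' hb' (castMap ha hb f) = castMap (ha.trans ha') (hb.trans hb') f := by
    intro P Q a b a' b' c d ha hb ha' hb' f
    subst ha hb ha' hb'
    simp only [castMap_rfl]
  unfold addAt
  congr 2
  refine Eq.trans (congrArg _ (raise_bump s.map l)) ?_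
  exact e _ _ _ _ _

variable [Ω.Additive]

theorem addAt_succ {X Y : Stabilization Ω} (r s : Rep X Y) (k l : ℕ)
    (h : s.a + l = r.a + k) (h' : s.a + (l + 1) = r.a + (k + 1)) :
    addAt r s (k + 1) (l + 1) h' = addAt r s k l h := by
  have h0 : X.deg + (r.a + k : ℕ) = Y.deg + (r.b + k : ℕ) := by
    have := r.eq; push_cast; omega
  refine Eq.trans ?_ (cls_bump _ _ h0 (by push_cast at h0 ⊢; omega) _)
  rw [bump_add, bump_castMap]
  rfl

theorem addAt_add {X Y : Stabilization Ω} (r s : Rep X Y) (k l j : ℕ)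
    (h : s.a + l = r.a + k) (h' : s.a + (l + j) = r.a + (k + j)) :
    addAt r s (k + j) (l + j) h' = addAt r s k l h := by
  induction j with
  | zero => rfl
  | succ j ih =>
    rw [← ih (by omega)]
    exact addAt_succ _ _ _ _ _ _

theorem addAt_eq {X Y : Stabilization Ω} (r s : Rep X Y) (k l k' l' : ℕ)
    (h : s.a + l = r.a + k) (h' : s.a + l' = r.a + k') :
    addAt r s k l h = addAt r s k' l' h' := by
  rcases le_total k k' with hk | hk
  · obtain ⟨j, rfl⟩ := Nat.exists_eq_add_of_le hk
    obtain rfl : l' = l + j := by omega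
    exact (addAt_add _ _ _ _ _ _ _).symm
  · obtain ⟨j, rfl⟩ := Nat.exists_eq_add_of_le hk
    obtain rfl : l = l' + j := by omega
    exact addAt_add _ _ _ _ _ _ _

/-- Addition in the Hom-groups of the stabilization. -/
def add {X Y : Stabilization Ω} (u v : Hom X Y) : Hom X Y :=
  Quot.liftOn₂ u v (fun r s => addAt r s s.a r.a (Nat.add_comm _ _))
    (by
      rintro r s _ rfl
      exact (addAt_eq r s _ _ (s.a + 1) (r.a + 1) _ (by omega)).trans
        (addAt_next_right r s (s.a + 1) r.a (by omega) (by omega)).symm)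
    (by
      rintro r _ s rfl
      exact (addAt_eq r s _ _ (s.a + 1) (r.a + 1) _ (by omega)).trans
        (addAt_next_left r s s.a (r.a + 1) (by omega) (by omega)).symm)

theorem add_cls {X Y : Stabilization Ω} {a b : ℕ} (h : X.deg + a = Y.deg + b)
    (f g : (iter Ω a).obj X.obj ⟶ (iter Ω b).obj Y.obj) :
    add (cls a b h f) (cls a b h g) = cls a b h (f + g) := by
  refine (addAt_eq (Rep.mk a b h f) (Rep.mk a b h g) _ _ 0 0 _ rfl).trans ?_
  unfold addAt
  rw [castMap_rfl]
  rfl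

/-- The zero morphism. -/
def zero (X Y : Stabilization Ω) : Hom X Y :=
  cls (Y.deg - X.deg).toNat (X.deg - Y.deg).toNat (by omega) 0

theorem cls_zero {X Y : Stabilization Ω} (a b : ℕ) (h : X.deg + a = Y.deg + b) :
    cls a b h 0 = zero X Y := by
  obtain ⟨k, rfl⟩ : ∃ k, a = (Y.deg - X.deg).toNat + k := ⟨a - (Y.deg - X.deg).toNat, by omega⟩
  obtain rfl : b = (X.deg - Y.deg).toNat + k := by omega
  rw [← raise_zero, cls_raise (h := by omega)]
  rfl

/-- Negation in the Hom-groups of the stabilization. -/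
def neg {X Y : Stabilization Ω} (u : Hom X Y) : Hom X Y :=
  Quot.liftOn u (fun r => cls r.a r.b r.eq (-r.map))
    (by
      rintro r _ rfl
      refine (cls_bump _ _ _ (by have := r.eq; push_cast; omega) _).symm.trans ?_
      exact congrArg (cls _ _ _) (Ω.map_neg))

theorem neg_cls {X Y : Stabilization Ω} {a b : ℕ} (h : X.deg + a = Y.deg + b)
    (f : (iter Ω a).obj X.obj ⟶ (iter Ω b).obj Y.obj) :
    neg (cls a b h f) = cls a b h (-f) := rfl

theorem add_comm' {X Y : Stabilization Ω} (u v : Hom X Y) : add u v = add v u := by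
  obtain ⟨a, b, h, f, g, rfl, rfl⟩ := exists_rep_add u v
  rw [add_cls, add_cls, add_comm]

theorem zero_add' {X Y : Stabilization Ω} (u : Hom X Y) : add (zero X Y) u = u := by
  obtain ⟨a, b, h, f, rfl⟩ := exists_rep u
  rw [← cls_zero a b h, add_cls, zero_add]

/-- The Hom-sets of the stabilization are abelian groups, as colimits of abelian groups. -/
instance homGroup (X Y : Stabilization Ω) : AddCommGroup (X ⟶ Y) where
  add := add
  zero := zero X Y
  neg := neg
  add_comm := add_comm'
  zero_add := zero_add'
  add_zero u := (add_comm' _ _).trans (zero_add' u)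
  neg_add_cancel u := by
    obtain ⟨a, b, h, f, rfl⟩ := exists_rep u
    change add (neg _) _ = zero X Y
    rw [neg_cls, add_cls, neg_add_cancel, cls_zero]
  add_assoc u v t := by
    obtain ⟨a, b, h, f, g, rfl, rfl⟩ := exists_rep_add u v
    obtain ⟨a', b', h', k, rfl⟩ := exists_rep t
    change add (add _ _) _ = add _ (add _ _)
    rw [← cls_raise a b h f a' (by push_cast; omega), ← cls_raise a b h g a' (by push_cast; omega),
      ← cls_raise a' b' h' k a (by push_cast; omega),
      ← cls_castMap (Nat.add_comm a' a) (show b' + a = b + a' by omega) (by push_cast; omega)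
        (by push_cast; omega) (raise k a), add_cls, add_cls, add_cls, add_cls, add_assoc]
  nsmul := @nsmulRec _ ⟨zero X Y⟩ ⟨add⟩
  zsmul := @zsmulRec _ ⟨zero X Y⟩ ⟨add⟩ ⟨neg⟩ (@nsmulRec _ ⟨zero X Y⟩ ⟨add⟩)

instance : Preadditive (Stabilization Ω) where
  homGroup := homGroup
  add_comp X Y Z u u' v := by
    obtain ⟨a, b, h, f, f', rfl, rfl⟩ := exists_rep_add u u'
    obtain ⟨b', c, h', g, rfl⟩ := exists_rep v
    change comp (add _ _) _ = add (comp _ _) (comp _ _)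
    rw [← cls_raise a b h f b' (by push_cast; omega), ← cls_raise a b h f' b' (by push_cast; omega),
      ← cls_raise b' c h' g b (by push_cast; omega),
      ← cls_castMap (Nat.add_comm b' b) rfl (by push_cast; omega) (by push_cast; omega)
        (raise g b), add_cls, comp_cls, comp_cls, comp_cls, add_cls, Preadditive.add_comp]
  comp_add X Y Z v u u' := by
    obtain ⟨a, b, h, f, f', rfl, rfl⟩ := exists_rep_add u u'
    obtain ⟨c, a', h', g, rfl⟩ := exists_rep v
    change comp _ (add _ _) = add (comp _ _) (comp _ _)
    rw [← cls_raise a b h f a' (by push_cast; omega), ← cls_raise a b h f' a' (by push_cast; omega),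
      ← cls_raise c a' h' g a (by push_cast; omega),
      ← cls_castMap rfl (Nat.add_comm a' a) (by push_cast; omega) (by push_cast; omega)
        (raise g a), add_cls, comp_cls, comp_cls, comp_cls, add_cls, Preadditive.comp_add]

end Preadditive

end Stabilization

end Stab

section Tensor

variable (R : Type*) [Ring R] (M N : Type*) [AddCommGroup M] [Module Rᵐᵒᵖ M]
  [AddCommGroup N] [Module R N]

/-- The relations `m r ⊗ n = m ⊗ r n`. -/
def balancedRel : AddSubgroup (M ⊗[ℤ] N) :=
  AddSubgroup.closure
    {t | ∃ (m : M) (r : R) (n : N), t = (MulOpposite.op r • m) ⊗ₜ[ℤ] n - m ⊗ₜ[ℤ] (r • n)}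

/-- The tensor product `M ⊗_R N` of a right module `M` and a left module `N` over a ring `R`
which need not be commutative. -/
def BTensor : Type _ := (M ⊗[ℤ] N) ⧸ balancedRel R M N

instance : AddCommGroup (BTensor R M N) :=
  inferInstanceAs (AddCommGroup ((M ⊗[ℤ] N) ⧸ balancedRel R M N))

variable {M N}

namespace BTensor

/-- The projection from the tensor product over the integers. -/
def proj : (M ⊗[ℤ] N) →+ BTensor R M N := QuotientAddGroup.mk' (balancedRel R M N)

/-- The elementary tensor `m ⊗ n`. -/
def tmul (m : M) (n : N) : BTensor R M N := proj R (m ⊗ₜ[ℤ] n)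

theorem add_tmul (m m' : M) (n : N) : tmul R (m + m') n = tmul R m n + tmul R m' n := by
  unfold tmul
  rw [TensorProduct.add_tmul, map_add]

theorem tmul_add (m : M) (n n' : N) : tmul R m (n + n') = tmul R m n + tmul R m n' := by
  unfold tmul
  rw [TensorProduct.tmul_add, map_add]

theorem smul_tmul (r : R) (m : M) (n : N) :
    tmul R (MulOpposite.op r • m) n = tmul R m (r • n) := by
  unfold tmul
  rw [← sub_eq_zero, ← map_sub]
  exact (QuotientAddGroup.eq_zero_iff _).mpr (AddSubgroup.subset_closure ⟨m, r, n, rfl⟩)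

theorem induction {p : BTensor R M N → Prop} (t : BTensor R M N) (h : ∀ m n, p (tmul R m n))
    (h0 : p 0) (ha : ∀ s t, p s → p t → p (s + t)) : p t := by
  obtain ⟨t, rfl⟩ : ∃ t', proj R t' = t := QuotientAddGroup.mk'_surjective (balancedRel R M N) t
  induction t using TensorProduct.induction_on with
  | zero => rw [map_zero]; exact h0
  | tmul m n => exact h m n
  | add s t hs ht => rw [map_add]; exact ha _ _ hs ht

variable {A : Type*} [AddCommGroup A]

theorem hom_ext {f g : BTensor R M N →+ A} (h : ∀ m n, f (tmul R m n) = g (tmul R m n)) :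
    f = g := by
  ext t
  induction t using BTensor.induction with
  | h m n => exact h m n
  | h0 => rw [map_zero, map_zero]
  | ha s t hs ht => rw [map_add, map_add, hs, ht]

/-- The universal property of the tensor product. -/
def lift (f : M →+ N →+ A) (hf : ∀ m (r : R) n, f (MulOpposite.op r • m) n = f m (r • n)) :
    BTensor R M N →+ A :=
  QuotientAddGroup.lift (balancedRel R M N)
    (TensorProduct.liftAddHom f (fun z m n => by rw [map_zsmul, map_zsmul]; rfl))
    (by
      refine (AddSubgroup.closure_le _).mpr ?_
      rintro _ ⟨m, r, n, rfl⟩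
      change TensorProduct.liftAddHom f _ _ = 0
      rw [map_sub, TensorProduct.liftAddHom_tmul, TensorProduct.liftAddHom_tmul, hf, sub_self])

theorem lift_tmul (f : M →+ N →+ A)
    (hf : ∀ m (r : R) n, f (MulOpposite.op r • m) n = f m (r • n)) (m : M) (n : N) :
    lift R f hf (tmul R m n) = f m n :=
  TensorProduct.liftAddHom_tmul f (fun z m n => by rw [map_zsmul, map_zsmul]; rfl) m n

/-- `tmul` as a biadditive map. -/
def tmulHom : M →+ N →+ BTensor R M N :=
  AddMonoidHom.mk' (fun m => AddMonoidHom.mk' (tmul R m) (tmul_add R m)) (by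
    intro m m'
    ext n
    exact add_tmul R m m' n)

section Left

variable {S : Type*} [Ring S] [Module S M] [SMulCommClass S Rᵐᵒᵖ M]

/-- The left action of `S` on `M ⊗_R N`, for an `S`-`R`-bimodule `M`. -/
def smulHom (s : S) : BTensor R M N →+ BTensor R M N :=
  lift R ((tmulHom R).comp (DistribSMul.toAddMonoidHom M s)) (by
    intro m r n
    change tmul R (s • MulOpposite.op r • m) n = tmul R (s • m) (r • n)
    rw [smul_comm, smul_tmul])

theorem smulHom_tmul (s : S) (m : M) (n : N) :
    smulHom R s (tmul R m n) = tmul R (s • m) n :=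
  lift_tmul R _ _ m n

/-- `M ⊗_R N` is a left `S`-module if `M` is an `S`-`R`-bimodule. -/
instance : Module S (BTensor R M N) where
  smul s t := smulHom R s t
  one_smul t := by
    change smulHom R (1 : S) t = AddMonoidHom.id _ t
    congr 1
    refine hom_ext R fun m n => ?_
    rw [smulHom_tmul, one_smul]
    rfl
  mul_smul a b t := by
    change smulHom R (a * b) t = ((smulHom R a).comp (smulHom R b)) t
    congr 1
    refine hom_ext R fun m n => ?_
    rw [AddMonoidHom.comp_apply, smulHom_tmul, smulHom_tmul, smulHom_tmul, mul_smul]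
  smul_zero a := map_zero (smulHom R a)
  smul_add a := map_add (smulHom R a)
  add_smul a b t := by
    change smulHom R (a + b) t = (smulHom R a + smulHom R b : BTensor R M N →+ BTensor R M N) t
    congr 1
    refine hom_ext R fun m n => ?_
    rw [AddMonoidHom.add_apply, smulHom_tmul, smulHom_tmul, smulHom_tmul, add_smul, add_tmul]
  zero_smul t := by
    change smulHom R (0 : S) t = (0 : BTensor R M N →+ BTensor R M N) t
    congr 1
    refine hom_ext R fun m n => ?_
    rw [smulHom_tmul, zero_smul]
    exact map_zero ((tmulHom R (M := M) (N := N)).flip n)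

theorem smul_tmul' (s : S) (m : M) (n : N) : s • tmul R m n = tmul R (s • m) n :=
  smulHom_tmul R s m n

/-- An additive map out of `M ⊗_R N` which respects the action on elementary tensors is linear. -/
def toLinear {A : Type*} [AddCommGroup A] [Module S A] (f : BTensor R M N →+ A)
    (hf : ∀ (s : S) m n, f (tmul R (s • m) n) = s • f (tmul R m n)) : BTensor R M N →ₗ[S] A where
  toFun := f
  map_add' := map_add f
  map_smul' s t := by
    change f (s • t) = s • f t
    induction t using BTensor.induction with
    | h m n => rw [smul_tmul', hf]
    | h0 => rw [smul_zero, map_zero, smul_zero]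
    | ha x y hx hy => rw [smul_add, map_add, hx, hy, map_add, smul_add]

/-- The additive map underlying `M ⊗ f`. -/
def mapRightHom {N' : Type*} [AddCommGroup N'] [Module R N'] (f : N →ₗ[R] N') :
    BTensor R M N →+ BTensor R M N' :=
  lift R (AddMonoidHom.mk' (fun m => (tmulHom R m).comp f.toAddMonoidHom) (by
      intro m m'
      ext n
      exact add_tmul R m m' (f n)))
    (by
      intro m r n
      change tmul R (MulOpposite.op r • m) (f n) = tmul R m (f (r • n))
      rw [map_smul, smul_tmul])

theorem mapRightHom_tmul {N' : Type*} [AddCommGroup N'] [Module R N'] (f : N →ₗ[R] N')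
    (m : M) (n : N) : mapRightHom R f (tmul R m n) = tmul R m (f n) :=
  lift_tmul R _ _ m n

/-- The map `M ⊗ f`, for a linear map `f` of left modules. -/
def mapRight (S : Type*) [Ring S] [Module S M] [SMulCommClass S Rᵐᵒᵖ M]
    {N' : Type*} [AddCommGroup N'] [Module R N'] (f : N →ₗ[R] N') :
    BTensor R M N →ₗ[S] BTensor R M N' :=
  toLinear R (mapRightHom R f) (by
    intro s m n
    rw [mapRightHom_tmul, mapRightHom_tmul, smul_tmul'])

theorem mapRight_tmul (S : Type*) [Ring S] [Module S M] [SMulCommClass S Rᵐᵒᵖ M]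
    {N' : Type*} [AddCommGroup N'] [Module R N'] (f : N →ₗ[R] N')
    (m : M) (n : N) : mapRight R S f (tmul R m n) = tmul R m (f n) :=
  mapRightHom_tmul R f m n

theorem linear_ext {A : Type*} [AddCommGroup A] [Module S A] {f g : BTensor R M N →ₗ[S] A}
    (h : ∀ m n, f (tmul R m n) = g (tmul R m n)) : f = g := by
  have := hom_ext R (f := f.toAddMonoidHom) (g := g.toAddMonoidHom) h
  ext t
  exact DFunLike.congr_fun this t

end Left

end BTensor

end Tensor

section Forms

variable {Λ : Type u} [Ring Λ] (E : Subring Λ)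

/-- `Λ` as a right module over a subring. -/
instance rightModule : Module (E)ᵐᵒᵖ Λ := Module.compHom Λ (E.subtype.op)

instance : SMulCommClass Λ (E)ᵐᵒᵖ Λ where
  smul_comm a e x := (mul_assoc a x (e.unop : Λ)).symm

/-- The subring `E`, as a right `E`-submodule of `Λ`. -/
def rightSub : Submodule (E)ᵐᵒᵖ Λ where
  carrier := E
  add_mem' := E.add_mem
  zero_mem' := E.zero_mem
  smul_mem' e _ hx := E.mul_mem hx e.unop.2

/-- The right `E`-module `Λ / E`. -/
abbrev Bar : Type u := Λ ⧸ rightSub E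

/-- The class in `Λ / E` of an element of `Λ`. -/
def bar (a : Λ) : Bar E := Submodule.Quotient.mk a

theorem bar_add (a b : Λ) : bar E (a + b) = bar E a + bar E b := rfl

theorem bar_eq_zero {a : Λ} (ha : a ∈ E) : bar E a = 0 :=
  (Submodule.Quotient.mk_eq_zero (rightSub E)).mpr ha

theorem smul_bar (e : E) (a : Λ) : MulOpposite.op e • bar E a = bar E (a * e) := rfl

/-- The bimodule `(Λ / E) ⊗_E Λ` of relative noncommutative differential `1`-forms. -/
def Forms : Type u := BTensor E (Bar E) Λ

instance : AddCommGroup (Forms E) := inferInstanceAs (AddCommGroup (BTensor E (Bar E) Λ))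

namespace Forms

variable {E}

/-- The form `ā ⊗ x`. -/
def mk (a x : Λ) : Forms E := BTensor.tmul E (bar E a) x

theorem mk_add_left (a b x : Λ) : (mk (a + b) x : Forms E) = mk a x + mk b x :=
  BTensor.add_tmul E (bar E a) (bar E b) x

theorem mk_add_right (a x y : Λ) : (mk a (x + y) : Forms E) = mk a x + mk a y :=
  BTensor.tmul_add E _ _ _

theorem mk_mem {a : Λ} (ha : a ∈ E) (x : Λ) : (mk a x : Forms E) = 0 := by
  unfold mk
  rw [bar_eq_zero E ha]
  exact map_zero ((BTensor.tmulHom E (M := Bar E) (N := Λ)).flip x)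

theorem mk_mul (a : Λ) (e : E) (x : Λ) : (mk (a * e) x : Forms E) = mk a (e * x) :=
  BTensor.smul_tmul E e (bar E a) x

theorem induction {p : Forms E → Prop} (t : Forms E) (h : ∀ a x, p (mk a x)) (h0 : p 0)
    (ha : ∀ s t, p s → p t → p (s + t)) : p t := by
  refine BTensor.induction E t ?_ h0 ha
  intro m n
  obtain ⟨a, rfl⟩ := Submodule.Quotient.mk_surjective _ m
  exact h a n

variable {A : Type*} [AddCommGroup A]

theorem hom_ext {f g : Forms E →+ A} (h : ∀ a x, f (mk a x) = g (mk a x)) : f = g := by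
  ext t
  induction t using Forms.induction with
  | h m n => exact h m n
  | h0 => rw [map_zero, map_zero]
  | ha s t hs ht => rw [map_add, map_add, hs, ht]

/-- Additive maps out of the bimodule of forms. -/
def lift (f : Λ →+ Λ →+ A) (h0 : ∀ a ∈ E, f a = 0) (hf : ∀ a (e : E) x, f (a * e) x = f a (e * x)) :
    Forms E →+ A :=
  BTensor.lift E (QuotientAddGroup.lift (rightSub E).toAddSubgroup f h0) (by
    intro m e x
    obtain ⟨a, rfl⟩ := Submodule.Quotient.mk_surjective _ m
    exact hf a e x)

theorem lift_mk (f : Λ →+ Λ →+ A) (h0 : ∀ a ∈ E, f a = 0)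
    (hf : ∀ a (e : E) x, f (a * e) x = f a (e * x)) (a x : Λ) : lift f h0 hf (mk a x) = f a x :=
  BTensor.lift_tmul E _ _ _ _

/-- `mk` as a biadditive map. -/
def mkHom : Λ →+ Λ →+ Forms E :=
  AddMonoidHom.mk' (fun a => AddMonoidHom.mk' (mk a) (mk_add_right a)) (by
    intro a b
    ext n
    exact mk_add_left a b n)

/-- The left action `b (ā ⊗ x) = (ba)‾ ⊗ x - b̄ ⊗ ax`. -/
def leftHom (b : Λ) : Forms E →+ Forms E :=
  lift (mkHom.comp (AddMonoidHom.mulLeft b) - (AddMonoidHom.compr₂ AddMonoidHom.mul (mkHom b)))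
    (by
      intro a ha
      ext x
      change mk (b * a) x - mk b (a * x) = 0
      rw [sub_eq_zero]
      exact mk_mul b ⟨a, ha⟩ x)
    (by
      intro a e x
      change mk (b * (a * e)) x - mk b (a * e * x) = mk (b * a) (e * x) - mk b (a * (e * x))
      rw [← mul_assoc, mk_mul, mul_assoc])

theorem leftHom_mk (b a x : Λ) : leftHom b (mk a x : Forms E) = mk (b * a) x - mk b (a * x) :=
  lift_mk _ _ _ _ _

/-- The right action `(ā ⊗ x) b = ā ⊗ xb`. -/
def rightHom (b : Λ) : Forms E →+ Forms E :=
  lift (mkHom.compr₂ (AddMonoidHom.id _) |>.compl₂ (AddMonoidHom.mulRight b))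
    (by
      intro a ha
      ext x
      exact mk_mem ha _)
    (by
      intro a e x
      change mk (a * e) (x * b) = mk a (e * x * b)
      rw [mk_mul, mul_assoc])

theorem rightHom_mk (b a x : Λ) : rightHom b (mk a x : Forms E) = mk a (x * b) :=
  lift_mk _ _ _ _ _

/-- The left `Λ`-module structure of the bimodule of forms. -/
instance : Module Λ (Forms E) where
  smul b t := leftHom b t
  one_smul t := by
    change leftHom 1 t = AddMonoidHom.id _ t
    congr 1
    refine hom_ext fun a x => ?_
    rw [leftHom_mk, one_mul, mk_mem E.one_mem, sub_zero]
    rfl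
  mul_smul b c t := by
    change leftHom (b * c) t = ((leftHom b).comp (leftHom c)) t
    congr 1
    refine hom_ext fun a x => ?_
    rw [AddMonoidHom.comp_apply, leftHom_mk, leftHom_mk, map_sub, leftHom_mk, leftHom_mk,
      ← mul_assoc, ← mul_assoc]
    abel
  smul_zero b := map_zero (leftHom b)
  smul_add b := map_add (leftHom b)
  add_smul b c t := by
    change leftHom (b + c) t = (leftHom b + leftHom c : Forms E →+ Forms E) t
    congr 1
    refine hom_ext fun a x => ?_
    rw [AddMonoidHom.add_apply, leftHom_mk, leftHom_mk, leftHom_mk, add_mul, mk_add_left, mk_add_left]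
    abel
  zero_smul t := by
    change leftHom 0 t = (0 : Forms E →+ Forms E) t
    congr 1
    refine hom_ext fun a x => ?_
    rw [leftHom_mk, zero_mul, mk_mem E.zero_mem, mk_mem E.zero_mem, sub_self]
    rfl

/-- The right `Λ`-module structure of the bimodule of forms. -/
instance : Module Λᵐᵒᵖ (Forms E) where
  smul b t := rightHom b.unop t
  one_smul t := by
    change rightHom 1 t = AddMonoidHom.id _ t
    congr 1
    refine hom_ext fun a x => ?_
    rw [rightHom_mk, mul_one]
    rfl
  mul_smul b c t := by
    change rightHom (c.unop * b.unop) t = ((rightHom b.unop).comp (rightHom c.unop)) t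
    congr 1
    refine hom_ext fun a x => ?_
    rw [AddMonoidHom.comp_apply, rightHom_mk, rightHom_mk, rightHom_mk, mul_assoc]
  smul_zero b := map_zero (rightHom b.unop)
  smul_add b := map_add (rightHom b.unop)
  add_smul b c t := by
    change rightHom (b.unop + c.unop) t = (rightHom b.unop + rightHom c.unop : Forms E →+ Forms E) t
    congr 1
    refine hom_ext fun a x => ?_
    rw [AddMonoidHom.add_apply, rightHom_mk, rightHom_mk, rightHom_mk, mul_add, mk_add_right]
  zero_smul t := by
    change rightHom 0 t = (0 : Forms E →+ Forms E) t
    congr 1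
    refine hom_ext fun a x => ?_
    rw [rightHom_mk, mul_zero]
    exact map_zero (mkHom a)

theorem smul_mk (b a x : Λ) : b • (mk a x : Forms E) = mk (b * a) x - mk b (a * x) :=
  leftHom_mk b a x

theorem op_smul_mk (b a x : Λ) : MulOpposite.op b • (mk a x : Forms E) = mk a (x * b) :=
  rightHom_mk b a x

instance : SMulCommClass Λ Λᵐᵒᵖ (Forms E) where
  smul_comm b c t := by
    change ((leftHom b).comp (rightHom c.unop)) t = ((rightHom c.unop).comp (leftHom b)) t
    congr 1
    refine hom_ext fun a x => ?_
    rw [AddMonoidHom.comp_apply, AddMonoidHom.comp_apply, leftHom_mk, rightHom_mk, map_sub, leftHom_mk,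
      rightHom_mk, rightHom_mk, mul_assoc]

end Forms


variable (X : Type u) [AddCommGroup X] [Module Λ X]

/-- The left `Λ`-module `Ω_nc ⊗_Λ X`. -/
abbrev FormsTensor : Type u := BTensor Λ (Forms E) X

/-- The left `Λ`-module `Λ ⊗_E X`. -/
abbrev Induced : Type u := BTensor E Λ X

variable {X}

theorem formsTensor_tmul (a x : Λ) (y : X) :
    BTensor.tmul Λ (Forms.mk a x : Forms E) y = BTensor.tmul Λ (Forms.mk a 1) (x • y) := by
  rw [← BTensor.smul_tmul, Forms.op_smul_mk, one_mul]

theorem formsTensor_induction {p : FormsTensor E X → Prop} (t : FormsTensor E X)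
    (h : ∀ a y, p (BTensor.tmul Λ (Forms.mk a 1) y)) (h0 : p 0)
    (ha : ∀ s t, p s → p t → p (s + t)) : p t := by
  induction t using BTensor.induction with
  | h m y =>
    induction m using Forms.induction with
    | h a x => rw [formsTensor_tmul]; exact h a _
    | h0 => rw [show BTensor.tmul Λ (0 : Forms E) y = 0 from
        map_zero ((BTensor.tmulHom Λ (M := Forms E) (N := X)).flip y)]; exact h0
    | ha s t hs ht => rw [BTensor.add_tmul]; exact ha _ _ hs ht
  | h0 => exact h0
  | ha s t hs ht => exact ha _ _ hs ht

instance [Module.Finite E Λ] [Module.Finite Λ X] : Module.Finite Λ (FormsTensor E X) := by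
  have : Module.Finite E X := Module.Finite.trans Λ X
  obtain ⟨s, hs⟩ := (Module.finite_def (R := E) (M := Λ)).mp inferInstance
  obtain ⟨t, ht⟩ := (Module.finite_def (R := E) (M := X)).mp inferInstance
  classical
  refine ⟨⟨(s ×ˢ t).image (fun q => BTensor.tmul Λ (Forms.mk q.1 1 : Forms E) q.2), ?_⟩⟩
  rw [eq_top_iff]
  rintro z -
  set S := Submodule.span Λ ((((s ×ˢ t).image
    (fun q => BTensor.tmul Λ (Forms.mk q.1 1 : Forms E) q.2) : Finset (FormsTensor E X))) :
      Set (FormsTensor E X)) with hS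
  have key : ∀ y ∈ t, ∀ a : Λ, BTensor.tmul Λ (Forms.mk a 1 : Forms E) y ∈ S := by
    intro y hy a
    have ha : a ∈ Submodule.span E (s : Set Λ) := by rw [hs]; trivial
    induction ha using Submodule.span_induction with
    | mem a ha =>
      refine Submodule.subset_span ?_
      rw [Finset.coe_image]
      exact ⟨(a, y), by simpa using ⟨ha, hy⟩, rfl⟩
    | zero =>
      rw [Forms.mk_mem E.zero_mem]
      rw [show BTensor.tmul Λ (0 : Forms E) y = 0 from
        map_zero ((BTensor.tmulHom Λ (M := Forms E) (N := X)).flip y)]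
      exact S.zero_mem
    | add a b _ _ iha ihb =>
      rw [Forms.mk_add_left, BTensor.add_tmul]
      exact S.add_mem iha ihb
    | smul e a _ ih =>
      have h := S.smul_mem (e : Λ) ih
      rw [BTensor.smul_tmul', Forms.smul_mk, Forms.mk_mem e.2, sub_zero] at h
      exact h
  induction z using formsTensor_induction with
  | h a y =>
    have hy : y ∈ Submodule.span E (t : Set X) := by rw [ht]; trivial
    induction hy using Submodule.span_induction generalizing a with
    | mem y hy => exact key y hy a
    | zero =>
      rw [show BTensor.tmul Λ (Forms.mk a 1 : Forms E) (0 : X) = 0 from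
        map_zero (BTensor.tmulHom Λ (N := X) (Forms.mk a 1 : Forms E))]
      exact S.zero_mem
    | add x y _ _ ihx ihy =>
      rw [BTensor.tmul_add]
      exact S.add_mem (ihx a) (ihy a)
    | smul e y _ ih =>
      have h := ih (a * e)
      rw [Forms.mk_mul, mul_one, formsTensor_tmul] at h
      exact h
  | h0 => exact S.zero_mem
  | ha x y hx hy => exact S.add_mem hx hy

instance [Module.Finite E Λ] [Module.Finite Λ X] : Module.Finite Λ (Induced E X) := by
  have : Module.Finite E X := Module.Finite.trans Λ X
  obtain ⟨t, ht⟩ := (Module.finite_def (R := E) (M := X)).mp inferInstance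
  classical
  refine ⟨⟨t.image (fun q => BTensor.tmul E (1 : Λ) q), ?_⟩⟩
  rw [eq_top_iff]
  rintro z -
  set S := Submodule.span Λ (((t.image (fun q => BTensor.tmul E (1 : Λ) q) :
    Finset (Induced E X))) : Set (Induced E X)) with hS
  induction z using BTensor.induction with
  | h a y =>
    have hy : y ∈ Submodule.span E (t : Set X) := by rw [ht]; trivial
    induction hy using Submodule.span_induction generalizing a with
    | mem y hy =>
      have h := S.smul_mem a (Submodule.subset_span (by
        rw [Finset.coe_image]; exact ⟨y, hy, rfl⟩) : BTensor.tmul E (1 : Λ) y ∈ S)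
      rw [BTensor.smul_tmul', smul_eq_mul, mul_one] at h
      exact h
    | zero =>
      rw [show BTensor.tmul E a (0 : X) = 0 from map_zero (BTensor.tmulHom E (N := X) a)]
      exact S.zero_mem
    | add x y _ _ ihx ihy =>
      rw [BTensor.tmul_add]
      exact S.add_mem (ihx a) (ihy a)
    | smul e y _ ih =>
      rw [← BTensor.smul_tmul]
      exact ih _
  | h0 => exact S.zero_mem
  | ha x y hx hy => exact S.add_mem hx hy

variable (X)

/-- The additive map underlying `muMap`. -/
def muHom : Induced E X →+ X :=
  BTensor.lift E (smulAddHom Λ X) (by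
    intro a e x
    exact mul_smul a (e : Λ) x)

theorem muHom_tmul (a : Λ) (x : X) : muHom E X (BTensor.tmul E a x) = a • x :=
  BTensor.lift_tmul E (smulAddHom Λ X) _ a x

/-- The multiplication map `μ : Λ ⊗_E X ⟶ X`, `a ⊗ x ↦ ax`. -/
def muMap : Induced E X →ₗ[Λ] X :=
  BTensor.toLinear E (muHom E X) (by
    intro s a x
    rw [muHom_tmul, muHom_tmul]
    exact mul_smul s a x)

theorem muMap_tmul (a : Λ) (x : X) : muMap E X (BTensor.tmul E a x) = a • x :=
  muHom_tmul E X a x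

variable {X}

/-- For `x : X`, the map `Ω_nc ⟶ Λ ⊗_E X`, `ā ⊗ b ↦ a ⊗ bx - 1 ⊗ abx`. -/
def iotaAux (x : X) : Forms E →+ Induced E X :=
  Forms.lift
    (AddMonoidHom.mk' (fun a => AddMonoidHom.mk'
        (fun b => BTensor.tmul E a (b • x) - BTensor.tmul E (1 : Λ) ((a * b) • x))
        (by
          intro b c
          rw [add_smul, mul_add, add_smul, BTensor.tmul_add, BTensor.tmul_add]
          abel))
      (by
        intro a b
        ext c
        change BTensor.tmul E (a + b) (c • x) - BTensor.tmul E (1 : Λ) (((a + b) * c) • x) =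
          (BTensor.tmul E a (c • x) - BTensor.tmul E (1 : Λ) ((a * c) • x)) +
          (BTensor.tmul E b (c • x) - BTensor.tmul E (1 : Λ) ((b * c) • x))
        rw [add_mul, add_smul, BTensor.tmul_add, BTensor.add_tmul]
        abel))
    (by
      intro a ha
      ext b
      change BTensor.tmul E a (b • x) - BTensor.tmul E (1 : Λ) ((a * b) • x) = 0
      rw [sub_eq_zero, mul_smul]
      have h := BTensor.smul_tmul E (⟨a, ha⟩ : E) (1 : Λ) (b • x)
      rw [← (show (⟨a, ha⟩ : E) • (b • x) = a • b • x from rfl), ← h]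
      exact congrArg (fun c => BTensor.tmul E c (b • x)) (one_mul a).symm)
    (by
      intro a e b
      change BTensor.tmul E (a * e) (b • x) - BTensor.tmul E (1 : Λ) ((a * e * b) • x) =
        BTensor.tmul E a (((e : Λ) * b) • x) - BTensor.tmul E (1 : Λ) ((a * (e * b)) • x)
      rw [mul_assoc]
      congr 1
      rw [mul_smul]
      exact BTensor.smul_tmul E e a (b • x))

theorem iotaAux_mk (x : X) (a b : Λ) : iotaAux E x (Forms.mk a b) =
    BTensor.tmul E a (b • x) - BTensor.tmul E (1 : Λ) ((a * b) • x) :=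
  Forms.lift_mk _ _ _ _ _

variable (X)

/-- The additive map underlying `iotaMap`. -/
def iotaHom : FormsTensor E X →+ Induced E X :=
  BTensor.lift Λ (AddMonoidHom.flip (AddMonoidHom.mk' (iotaAux E (X := X)) (by
      intro x y
      refine Forms.hom_ext fun a b => ?_
      rw [AddMonoidHom.add_apply, iotaAux_mk, iotaAux_mk, iotaAux_mk, smul_add, smul_add,
        BTensor.tmul_add, BTensor.tmul_add]
      abel)))
    (by
      intro m r x
      change iotaAux E x (MulOpposite.op r • m) = iotaAux E (r • x) m
      induction m using Forms.induction with
      | h a b => rw [Forms.op_smul_mk, iotaAux_mk, iotaAux_mk, mul_smul, ← mul_assoc, mul_smul (a * b)]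
      | h0 => rw [smul_zero, map_zero, map_zero]
      | ha s t hs ht => rw [smul_add, map_add, hs, ht, map_add])

theorem iotaHom_tmul (m : Forms E) (x : X) : iotaHom E X (BTensor.tmul Λ m x) = iotaAux E x m :=
  BTensor.lift_tmul Λ _ _ _ _

/-- The map `ι : Ω_nc ⊗_Λ X ⟶ Λ ⊗_E X`, `(ā ⊗ b) ⊗ x ↦ a ⊗ bx - 1 ⊗ abx`. -/
def iotaMap : FormsTensor E X →ₗ[Λ] Induced E X :=
  BTensor.toLinear Λ (iotaHom E X)
    (by
      intro s m x
      rw [iotaHom_tmul, iotaHom_tmul]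
      induction m using Forms.induction with
      | h a b =>
        rw [Forms.smul_mk, map_sub, iotaAux_mk, iotaAux_mk, iotaAux_mk, smul_sub, BTensor.smul_tmul',
          BTensor.smul_tmul', smul_eq_mul, smul_eq_mul, mul_one, mul_assoc]
        abel
      | h0 => rw [smul_zero, map_zero, smul_zero]
      | ha s t hs ht => rw [smul_add, map_add, hs, ht, map_add, smul_add])

theorem iotaMap_tmul (a b : Λ) (x : X) : iotaMap E X (BTensor.tmul Λ (Forms.mk a b) x) =
    BTensor.tmul E a (b • x) - BTensor.tmul E (1 : Λ) ((a * b) • x) :=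
  (iotaHom_tmul E X _ x).trans (iotaAux_mk E x a b)

theorem induced_projective [IsSemisimpleRing E] : Module.Projective Λ (Induced E X) := by
  refine Module.Projective.of_lifting_property'' ?_
  intro f hf
  have : Module.Projective E X := Module.projective_of_isSemisimpleRing E X
  let j : X →ₗ[E] Induced E X :=
    { toFun := fun x => BTensor.tmul E 1 x
      map_add' := BTensor.tmul_add E 1
      map_smul' := by
        intro e x
        change _ = (e : Λ) • BTensor.tmul E 1 x
        rw [BTensor.smul_tmul', ← BTensor.smul_tmul]
        congr 1
        change 1 * (e : Λ) = (e : Λ) * 1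
        rw [one_mul, mul_one] }
  let f' : (Induced E X →₀ Λ) →ₗ[E] Induced E X :=
    { toFun := f
      map_add' := map_add f
      map_smul' := fun e y => map_smul f (e : Λ) y }
  obtain ⟨h, hh⟩ := Module.projective_lifting_property f' j hf
  refine ⟨(muMap E (Induced E X →₀ Λ)).comp (BTensor.mapRight E Λ h), ?_⟩
  refine BTensor.linear_ext E fun a x => ?_
  change f (muMap E _ (BTensor.mapRight E Λ h (BTensor.tmul E a x))) = BTensor.tmul E a x
  rw [BTensor.mapRight_tmul, muMap_tmul, map_smul]
  have hx : f (h x) = BTensor.tmul E 1 x := LinearMap.congr_fun hh x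
  rw [hx, BTensor.smul_tmul', smul_eq_mul, mul_one]

/-- The additive map `Λ ⊗_E X ⟶ Ω_nc ⊗_Λ X`, `a ⊗ x ↦ (ā ⊗ 1) ⊗ x`. -/
def rhoHom : Induced E X →+ FormsTensor E X :=
  BTensor.lift E ((AddMonoidHom.mk' (fun a => BTensor.tmulHom Λ (Forms.mk a 1 : Forms E)) (by
      intro a b
      rw [Forms.mk_add_left, map_add])))
    (by
      intro a e x
      change BTensor.tmul Λ (Forms.mk (a * e) 1 : Forms E) x =
        BTensor.tmul Λ (Forms.mk a 1 : Forms E) ((e : Λ) • x)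
      rw [Forms.mk_mul, mul_one, formsTensor_tmul])

theorem rhoHom_tmul (a : Λ) (x : X) : rhoHom E X (BTensor.tmul E a x) =
    BTensor.tmul Λ (Forms.mk a 1 : Forms E) x :=
  BTensor.lift_tmul E _ _ _ _

theorem rhoHom_smul (b : Λ) (t : Induced E X) : rhoHom E X (b • t) =
    b • rhoHom E X t + BTensor.tmul Λ (Forms.mk b 1) (muMap E X t) := by
  induction t using BTensor.induction with
  | h a x =>
    rw [BTensor.smul_tmul', rhoHom_tmul, rhoHom_tmul, BTensor.smul_tmul', Forms.smul_mk, muMap_tmul,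
      smul_eq_mul, ← formsTensor_tmul, ← BTensor.add_tmul, mul_one, sub_add_cancel]
  | h0 =>
    rw [smul_zero, map_zero, smul_zero, map_zero, zero_add]
    exact (map_zero (BTensor.tmulHom Λ (N := X) (Forms.mk b 1 : Forms E))).symm
  | ha s t hs ht =>
    rw [smul_add, map_add, map_add, hs, ht, map_add, smul_add, BTensor.tmul_add]
    abel

theorem muMap_iotaMap (t : FormsTensor E X) : muMap E X (iotaMap E X t) = 0 := by
  induction t using formsTensor_induction with
  | h a x => rw [iotaMap_tmul, map_sub, muMap_tmul, muMap_tmul, one_smul, one_smul, mul_one, sub_self]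
  | h0 => rw [map_zero, map_zero]
  | ha s t hs ht => rw [map_add, map_add, hs, ht, add_zero]

theorem rhoHom_iotaMap (t : FormsTensor E X) : rhoHom E X (iotaMap E X t) = t := by
  induction t using formsTensor_induction with
  | h a x =>
    rw [iotaMap_tmul, map_sub, rhoHom_tmul, rhoHom_tmul, Forms.mk_mem E.one_mem, one_smul]
    rw [show BTensor.tmul Λ (0 : Forms E) ((a * 1) • x) = 0 from
        map_zero ((BTensor.tmulHom Λ (M := Forms E) (N := X)).flip _), sub_zero]
  | h0 => rw [map_zero, map_zero]
  | ha s t hs ht => rw [map_add, map_add, hs, ht]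

/-- `Ω_nc ⊗_Λ -` preserves projective modules. -/
theorem formsTensor_projective [IsSemisimpleRing E] [Module.Projective Λ X] :
    Module.Projective Λ (FormsTensor E X) := by
  have := induced_projective E X
  obtain ⟨t, ht⟩ := Module.projective_lifting_property (muMap E X) (LinearMap.id) (by
    intro x
    exact ⟨BTensor.tmul E 1 x, by rw [muMap_tmul, one_smul]⟩)
  have ht' : ∀ x, muMap E X (t x) = x := fun x => LinearMap.congr_fun ht x
  let r : Induced E X →ₗ[Λ] FormsTensor E X :=
    { toFun := fun y => rhoHom E X (y - t (muMap E X y))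
      map_add' := by
        intro y z
        rw [← map_add]
        congr 1
        rw [map_add, map_add]
        abel
      map_smul' := by
        intro b y
        rw [map_smul, map_smul, ← smul_sub, rhoHom_smul, map_sub (muMap E X), ht', sub_self]
        rw [show BTensor.tmul Λ (Forms.mk b 1 : Forms E) (0 : X) = 0 from
          map_zero (BTensor.tmulHom Λ (N := X) (Forms.mk b 1 : Forms E)), add_zero]
        rfl }
  refine Module.Projective.of_split (iotaMap E X) r ?_
  ext y
  change rhoHom E X (iotaMap E X y - t (muMap E X (iotaMap E X y))) = y
  rw [muMap_iotaMap, map_zero, sub_zero, rhoHom_iotaMap]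

end Forms

section Stable

variable (C : Type u) [Category.{v} C] [Preadditive C]

/-- Two parallel morphisms are identified if their difference factors through a projective object. -/
def projRel : HomRel C := fun X Y f g =>
  ∃ (P : C) (_ : Projective P) (a : X ⟶ P) (b : P ⟶ Y), f - g = a ≫ b

/-- The stable category: the factor category of `C` modulo its projective objects. -/
abbrev StableCategory := CategoryTheory.Quotient (projRel C)

/-- The projection to the stable category. -/
abbrev toStable : C ⥤ StableCategory C := CategoryTheory.Quotient.functor (projRel C)

variable {C}

/-- The functor between stable categories induced by an additive functor preserving projectives. -/
def stableMap {D : Type u'} [Category.{v'} D] [Preadditive D] (F : C ⥤ D) [F.Additive]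
    (hF : ∀ P : C, Projective P → Projective (F.obj P)) : StableCategory C ⥤ StableCategory D :=
  CategoryTheory.Quotient.lift (projRel C) (F ⋙ toStable D) (by
    rintro X Y f g ⟨P, hP, a, b, h⟩
    exact CategoryTheory.Quotient.sound _ ⟨F.obj P, hF P hP, F.map a, F.map b, by
      rw [← F.map_sub, h, F.map_comp]⟩)

/-- A category with an endofunctor `shift` and a class of triangles `X ⟶ Y ⟶ Z ⟶ shift X`. -/
structure TriangleData (T : Type u) [Category.{v} T] where
  /-- the suspension functor -/
  shift : T ⥤ T
  /-- the distinguished triangles -/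
  dist : ∀ {X Y Z : T}, (X ⟶ Y) → (Y ⟶ Z) → (Z ⟶ shift.obj X) → Prop

/-- Two triangles of the form `X ⟶ Y ⟶ Z ⟶ F X` are isomorphic. -/
def TriangleIso {T : Type u} [Category.{v} T] (F : T ⥤ T) {X Y Z X₂ Y₂ Z₂ : T}
    (f : X ⟶ Y) (g : Y ⟶ Z) (h : Z ⟶ F.obj X) (f₂ : X₂ ⟶ Y₂) (g₂ : Y₂ ⟶ Z₂) (h₂ : Z₂ ⟶ F.obj X₂) :
    Prop :=
  ∃ (a : X ≅ X₂) (b : Y ≅ Y₂) (c : Z ≅ Z₂),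
    f ≫ b.hom = a.hom ≫ f₂ ∧ g ≫ c.hom = b.hom ≫ g₂ ∧ h ≫ F.map a.hom = c.hom ≫ h₂

/-- The data underlying a pretriangulated category. -/
def TriangleData.ofPretriangulated (T : Type u) [Category.{v} T] [HasZeroObject T] [HasShift T ℤ]
    [Preadditive T] [∀ n : ℤ, (shiftFunctor T n).Additive] [Pretriangulated T] : TriangleData T where
  shift := shiftFunctor T (1 : ℤ)
  dist f g h := Pretriangulated.Triangle.mk f g h ∈ Pretriangulated.distinguishedTriangles

/-- A triangle equivalence: an equivalence of categories `F` with a natural isomorphism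
`F ∘ shift ≅ shift ∘ F` such that a triangle is distinguished if and only if its image is. -/
structure TriangleEquivalence {T : Type u} [Category.{v} T] {T₂ : Type u'} [Category.{v'} T₂]
    (S : TriangleData T) (S₂ : TriangleData T₂) where
  /-- the underlying equivalence of categories -/
  equiv : T ≌ T₂
  /-- the compatibility with the suspension functors -/
  comm : S.shift ⋙ equiv.functor ≅ equiv.functor ⋙ S₂.shift
  /-- distinguished triangles correspond to distinguished triangles -/
  dist_iff : ∀ {X Y Z : T} (f : X ⟶ Y) (g : Y ⟶ Z) (h : Z ⟶ S.shift.obj X),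
    S.dist f g h ↔
      S₂.dist (equiv.functor.map f) (equiv.functor.map g) (equiv.functor.map h ≫ comm.hom.app X)

variable (C)

/-- A Frobenius abelian category: an abelian category with enough projectives and enough injectives,
in which projective and injective objects coincide. -/
structure IsFrobeniusAbelian : Prop where
  hasFiniteProducts : HasFiniteProducts C
  hasKernels : HasKernels C
  hasCokernels : HasCokernels C
  isNormalMonoCategory : IsNormalMonoCategory C
  isNormalEpiCategory : IsNormalEpiCategory C
  enoughProjectives : EnoughProjectives C
  enoughInjectives : EnoughInjectives C
  projective_iff_injective : ∀ X : C, Projective X ↔ Injective X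

namespace IsFrobeniusAbelian

variable {C} (hC : IsFrobeniusAbelian C)

/-- A chosen injective object `I X` into which `X` embeds. -/
noncomputable def hull (X : C) : C :=
  haveI := hC.enoughInjectives
  Injective.under X

/-- The monomorphism `X ⟶ I X`. -/
noncomputable def toHull (X : C) : X ⟶ hC.hull X :=
  haveI := hC.enoughInjectives
  Injective.ι X

theorem mono_toHull (X : C) : Mono (hC.toHull X) :=
  haveI := hC.enoughInjectives
  inferInstanceAs (Mono (Injective.ι X))

theorem injective_hull (X : C) : Injective (hC.hull X) :=
  haveI := hC.enoughInjectives
  inferInstanceAs (Injective (Injective.under X))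

/-- The cokernel `T X` of `X ⟶ I X`. -/
noncomputable def cosyzygy (X : C) : C :=
  haveI := hC.hasCokernels
  cokernel (hC.toHull X)

/-- The projection `I X ⟶ T X`. -/
noncomputable def fromHull (X : C) : hC.hull X ⟶ hC.cosyzygy X :=
  haveI := hC.hasCokernels
  cokernel.π (hC.toHull X)

theorem toHull_fromHull (X : C) : hC.toHull X ≫ hC.fromHull X = 0 :=
  haveI := hC.hasCokernels
  cokernel.condition (hC.toHull X)

theorem exists_desc {X Z : C} (k : hC.hull X ⟶ Z) (hk : hC.toHull X ≫ k = 0) :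
    ∃ l : hC.cosyzygy X ⟶ Z, hC.fromHull X ≫ l = k :=
  haveI := hC.hasCokernels
  ⟨cokernel.desc (hC.toHull X) k hk, cokernel.π_desc _ _ _⟩

theorem epi_fromHull (X : C) : Epi (hC.fromHull X) :=
  haveI := hC.hasCokernels
  inferInstanceAs (Epi (cokernel.π (hC.toHull X)))

theorem exists_extend {X Y : C} (f : X ⟶ Y) :
    ∃ t : hC.cosyzygy X ⟶ hC.cosyzygy Y, ∃ i : hC.hull X ⟶ hC.hull Y,
      hC.toHull X ≫ i = f ≫ hC.toHull Y ∧ hC.fromHull X ≫ t = i ≫ hC.fromHull Y := by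
  have := hC.mono_toHull X
  have := hC.injective_hull Y
  obtain ⟨i, hi⟩ := Injective.factors (f ≫ hC.toHull Y) (hC.toHull X)
  obtain ⟨t, ht⟩ := hC.exists_desc (i ≫ hC.fromHull Y) (by
    rw [← Category.assoc, hi, Category.assoc, hC.toHull_fromHull, comp_zero])
  exact ⟨t, i, hi, ht⟩

/-- If `i : I X ⟶ I Y` extends a morphism `f` which factors through a projective object, then the
induced morphism `T X ⟶ T Y` vanishes in the stable category. -/
theorem stable_zero {X Y P : C} (hP : Projective P) (a : X ⟶ P) (b : P ⟶ Y)
    (t : hC.cosyzygy X ⟶ hC.cosyzygy Y) (i : hC.hull X ⟶ hC.hull Y)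
    (hi : hC.toHull X ≫ i = (a ≫ b) ≫ hC.toHull Y) (ht : hC.fromHull X ≫ t = i ≫ hC.fromHull Y) :
    ∃ (Q : C) (_ : Projective Q) (a' : hC.cosyzygy X ⟶ Q) (b' : Q ⟶ hC.cosyzygy Y), t = a' ≫ b' := by
  have := hC.mono_toHull X
  have := hC.epi_fromHull X
  have : Injective P := (hC.projective_iff_injective P).mp hP
  obtain ⟨c, hc⟩ := Injective.factors a (hC.toHull X)
  obtain ⟨d, hd⟩ := hC.exists_desc (i - c ≫ b ≫ hC.toHull Y) (by
    rw [Preadditive.comp_sub, hi, ← Category.assoc, hc, Category.assoc, sub_self])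
  refine ⟨hC.hull Y, (hC.projective_iff_injective _).mpr (hC.injective_hull Y), d, hC.fromHull Y, ?_⟩
  rw [← cancel_epi (hC.fromHull X), ← Category.assoc, hd, ht, Preadditive.sub_comp, Category.assoc,
    Category.assoc, hC.toHull_fromHull, comp_zero, comp_zero, sub_zero]

theorem stable_eq {X Y : C} (f g : X ⟶ Y) (hfg : projRel C f g)
    (t t' : hC.cosyzygy X ⟶ hC.cosyzygy Y) (i i' : hC.hull X ⟶ hC.hull Y)
    (hi : hC.toHull X ≫ i = f ≫ hC.toHull Y) (ht : hC.fromHull X ≫ t = i ≫ hC.fromHull Y)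
    (hi' : hC.toHull X ≫ i' = g ≫ hC.toHull Y) (ht' : hC.fromHull X ≫ t' = i' ≫ hC.fromHull Y) :
    (toStable C).map t = (toStable C).map t' := by
  obtain ⟨P, hP, a, b, h⟩ := hfg
  refine CategoryTheory.Quotient.sound _ (hC.stable_zero hP a b (t - t') (i - i') ?_ ?_)
  · rw [Preadditive.comp_sub, hi, hi', ← h, Preadditive.sub_comp]
  · rw [Preadditive.comp_sub, ht, ht', Preadditive.sub_comp]

theorem projRel_refl (hC : IsFrobeniusAbelian C) {X Y : C} (f : X ⟶ Y) : projRel C f f :=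
  ⟨hC.hull X, (hC.projective_iff_injective _).mpr (hC.injective_hull X), 0, 0, by simp⟩

/-- The suspension functor of the stable category of a Frobenius abelian category: `T X` is the
cokernel of `X ⟶ I X`, and `T f` is induced by an extension `I X ⟶ I Y` of `f`. -/
noncomputable def stableShift : StableCategory C ⥤ StableCategory C :=
  CategoryTheory.Quotient.lift (projRel C)
    { obj := fun X => (toStable C).obj (hC.cosyzygy X)
      map := fun f => (toStable C).map (hC.exists_extend f).choose
      map_id := by
        intro X
        obtain ⟨i, hi, ht⟩ := (hC.exists_extend (𝟙 X)).choose_spec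
        rw [← (toStable C).map_id]
        exact hC.stable_eq _ _ (hC.projRel_refl (𝟙 X)) _ _ i (𝟙 _) hi ht (by simp) (by simp)
      map_comp := by
        intro X Y Z f g
        obtain ⟨i, hi, ht⟩ := (hC.exists_extend (f ≫ g)).choose_spec
        obtain ⟨j, hj, hu⟩ := (hC.exists_extend f).choose_spec
        obtain ⟨k, hk, hv⟩ := (hC.exists_extend g).choose_spec
        rw [← (toStable C).map_comp]
        refine hC.stable_eq _ _ (hC.projRel_refl (f ≫ g)) _ _ i (j ≫ k) hi ht ?_ ?_
        · rw [← Category.assoc, hj, Category.assoc, hk, Category.assoc]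
        · rw [← Category.assoc, hu, Category.assoc, hv, Category.assoc] }
    (by
      intro X Y f g hfg
      obtain ⟨i, hi, ht⟩ := (hC.exists_extend f).choose_spec
      obtain ⟨j, hj, hu⟩ := (hC.exists_extend g).choose_spec
      exact hC.stable_eq f g hfg _ _ i j hi ht hj hu)

/-- The canonical triangulated structure on the stable category of a Frobenius abelian category.
For `u : X ⟶ Y`, let `Z` be the pushout of `X ⟶ I X` and `u`; the distinguished triangles are those
isomorphic to some `X ⟶ Y ⟶ Z ⟶ T X`, where `w : Z ⟶ T X` restricts to the projection `I X ⟶ T X`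
and to zero on `Y`. -/
noncomputable def triangles : TriangleData (StableCategory C) where
  shift := hC.stableShift
  dist f g h := ∃ (X Y Z : C) (u : X ⟶ Y) (v : Y ⟶ Z) (i : hC.hull X ⟶ Z) (w : Z ⟶ hC.cosyzygy X),
    IsPushout (hC.toHull X) u i v ∧ i ≫ w = hC.fromHull X ∧ v ≫ w = 0 ∧
      TriangleIso hC.stableShift f g h ((toStable C).map u) ((toStable C).map v)
        ((toStable C).map w)

end IsFrobeniusAbelian

/-- `X` lies in `add U`: it is a direct summand of a finite direct sum of objects from the
family `U`. -/
def InAdd {C : Type u} [Category.{v} C] [Preadditive C] {J : Type*} (U : J → C) (X : C) : Prop :=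
  ∃ (k : ℕ) (j : Fin k → J) (b : Bicone (fun i => U (j i))) (Y : C) (c : BinaryBicone X Y),
    Nonempty b.IsBilimit ∧ Nonempty c.IsBilimit ∧ Nonempty (c.pt ≅ b.pt)

end Stable

section Dsg

open Pretriangulated ZeroObject

variable (A : Type u) [Category.{v} A] [Abelian A]

/-- The objects of the homotopy category given by bounded complexes of projective objects. -/
def bddProj : ObjectProperty (HomotopyCategory A (ComplexShape.up ℤ)) := fun K =>
  (∃ n : ℤ, CochainComplex.IsStrictlyGE K.as n) ∧ (∃ n : ℤ, CochainComplex.IsStrictlyLE K.as n) ∧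
    ∀ i : ℤ, Projective (K.as.X i)

variable {A}

theorem bddProj_quotient_iff (K : CochainComplex A ℤ) :
    bddProj A ((HomotopyCategory.quotient A (ComplexShape.up ℤ)).obj K) ↔
      (∃ n : ℤ, K.IsStrictlyGE n) ∧ (∃ n : ℤ, K.IsStrictlyLE n) ∧ ∀ i : ℤ, Projective (K.X i) :=
  Iff.rfl

instance : (bddProj A).ContainsZero where
  exists_zero :=
    ⟨(HomotopyCategory.quotient _ _).obj (0 : CochainComplex A ℤ),
      Functor.map_isZero _ (isZero_zero _),
      (bddProj_quotient_iff _).mpr ⟨⟨0, inferInstance⟩, ⟨0, inferInstance⟩, fun i =>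
        ((HomologicalComplex.eval A (ComplexShape.up ℤ) i).map_isZero
          (isZero_zero (CochainComplex A ℤ))).projective⟩⟩

instance : (bddProj A).IsStableUnderShift ℤ where
  isStableUnderShiftBy n :=
    { le_shift K hK := by
        obtain ⟨K : CochainComplex _ _, rfl⟩ := K.quotient_obj_surjective
        obtain ⟨⟨p, hp⟩, ⟨q, hq⟩, h⟩ := (bddProj_quotient_iff K).mp hK
        rw [ObjectProperty.prop_shift_iff, HomotopyCategory.shift_quotient_obj]
        exact ⟨⟨p - n, K.isStrictlyGE_shift p n (p - n) (by lia)⟩,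
          ⟨q - n, K.isStrictlyLE_shift q n (q - n) (by lia)⟩, fun i => h (i + n)⟩ }

instance : (bddProj A).IsTriangulatedClosed₃ where
  ext₃' T hT h₁ h₂ := by
    obtain ⟨⟨p₁, _⟩, ⟨q₁, _⟩, h₁⟩ := h₁
    obtain ⟨⟨p₂, _⟩, ⟨q₂, _⟩, h₂⟩ := h₂
    obtain ⟨f : T.obj₁.as ⟶ T.obj₂.as, hf⟩ :=
      (HomotopyCategory.quotient _ _).map_surjective T.mor₁
    refine ⟨_, ?_,
      ⟨Triangle.π₃.mapIso (isoTriangleOfIso₁₂ T _ hT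
        (HomotopyCategory.mappingCone_triangleh_distinguished f)
        (Iso.refl _) (Iso.refl _) ?_)⟩⟩
    · change bddProj A ((HomotopyCategory.quotient _ _).obj (CochainComplex.mappingCone f))
      rw [bddProj_quotient_iff]
      refine ⟨⟨min (p₁ - 1) p₂, CochainComplex.isStrictlyGE_mappingCone f p₁ p₂ _
        (by simp) (by simp)⟩, ⟨max q₁ q₂, ?_⟩, ?_⟩
      · rw [CochainComplex.isStrictlyLE_iff]
        intro i hi
        rw [CochainComplex.mappingCone.isZero_X_iff]
        exact ⟨CochainComplex.isZero_of_isStrictlyLE T.obj₁.as q₁ _ (by omega),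
          CochainComplex.isZero_of_isStrictlyLE T.obj₂.as q₂ _ (by omega)⟩
      · intro i
        have e := HomologicalComplex.homotopyCofiber.XIsoBiprod f i (i + 1) rfl
        have : Projective (T.obj₁.as.X (i + 1)) := h₁ _
        have : Projective (T.obj₂.as.X i) := h₂ _
        exact Projective.of_iso e.symm inferInstance
    · change T.mor₁ ≫ 𝟙 _ = 𝟙 _ ≫ (HomotopyCategory.quotient _ _).map f
      rw [hf]
      exact (Category.comp_id _).trans (Category.id_comp _).symm

instance : (bddProj A).IsTriangulated where
  toIsTriangulatedClosed₂ := .of_isTriangulatedClosed₃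

variable [HasDerivedCategory.{w} A]

variable (A)

/-- The functor `K^b(proj A) ⟶ D^b(A)`. -/
noncomputable def projToBounded : (bddProj A).FullSubcategory ⥤ DerivedCategory.Bounded A :=
  ObjectProperty.lift _ ((bddProj A).ι ⋙ DerivedCategory.Qh) (by
    rintro ⟨K, ⟨p, hp⟩, ⟨q, hq⟩, h⟩
    obtain ⟨K : CochainComplex _ _, rfl⟩ := K.quotient_obj_surjective
    exact ⟨⟨p, ⟨K, (DerivedCategory.quotientCompQhIso A).app K, hp⟩⟩,
      ⟨q, ⟨K, (DerivedCategory.quotientCompQhIso A).app K, hq⟩⟩⟩)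

noncomputable instance : (projToBounded A).CommShift ℤ := by
  dsimp only [projToBounded]
  infer_instance

instance : (projToBounded A).IsTriangulated := by
  dsimp only [projToBounded]
  infer_instance

instance : (projToBounded A).Full where
  map_surjective {K L} g := by
    obtain ⟨K, ⟨p, hp⟩, ⟨q, hq⟩, h⟩ := K
    have : CochainComplex.IsKProjective K.as := CochainComplex.isKProjective_of_projective K.as q
    obtain ⟨f, hf⟩ := (CochainComplex.IsKProjective.Qh_map_bijective K.as L.obj).surjective g.hom
    exact ⟨ObjectProperty.homMk f, ObjectProperty.hom_ext _ hf⟩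

/-- The triangulated subcategory `K^b(proj A)` of `D^b(A)`. -/
def perfect : ObjectProperty (DerivedCategory.Bounded A) := (projToBounded A).essImage

instance : (perfect A).IsTriangulated := by
  unfold perfect
  infer_instance

/-- The singularity category: the Verdier quotient of `D^b(A)` by `K^b(proj A)`. -/
abbrev SingularityCategory := (perfect A).trW.Localization

end Dsg

section Modules

variable {Λ : Type u} [Ring Λ] (E : Subring Λ)

theorem finite_projective {X : FGModuleCat.{u} Λ} (hX : Projective X) : Module.Projective Λ X := by
  obtain ⟨n, f, hf⟩ := Module.Finite.exists_fin' Λ X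
  have : Module.Finite Λ (ULift.{u} (Fin n) → Λ) := inferInstance
  let q : (Fin n → Λ) →ₗ[Λ] X := f
  let p : FGModuleCat.of Λ (Fin n → Λ) ⟶ X := FGModuleCat.ofHom q
  have hp : Epi p := ConcreteCategory.epi_of_surjective p hf
  have h := Projective.factorThru_comp (𝟙 X) p
  refine Module.Projective.of_split (Projective.factorThru (𝟙 X) p).hom.hom q ?_
  exact congrArg (fun k => k.hom.hom) h

theorem projective_of_module (X : FGModuleCat.{u} Λ) [Module.Projective Λ X] : Projective X where
  factors {_ Z} f e he := by
    have hs : Function.Surjective e.hom.hom := by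
      rw [← LinearMap.range_eq_top, ← Submodule.ker_mkQ (LinearMap.range e.hom.hom),
        LinearMap.ker_eq_top]
      let p : Z ⟶ FGModuleCat.of Λ (Z ⧸ LinearMap.range e.hom.hom) :=
        FGModuleCat.ofHom (LinearMap.range e.hom.hom).mkQ
      have h : e ≫ p = e ≫ 0 := FGModuleCat.hom_ext (LinearMap.range_mkQ_comp e.hom.hom)
      exact congrArg (fun k => k.hom.hom) ((cancel_epi e).mp h)
    obtain ⟨h, hh⟩ := Module.projective_lifting_property e.hom.hom f.hom.hom hs
    exact ⟨FGModuleCat.ofHom h, FGModuleCat.hom_ext hh⟩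

variable [Module.Finite E Λ]

/-- The endofunctor `Ω_nc ⊗_Λ -` of the category of finitely generated left `Λ`-modules. -/
def tensorFunctor : FGModuleCat.{u} Λ ⥤ FGModuleCat.{u} Λ where
  obj X := FGModuleCat.of Λ (FormsTensor E X)
  map f := FGModuleCat.ofHom (BTensor.mapRight Λ Λ f.hom.hom)
  map_id _ := FGModuleCat.hom_ext (BTensor.linear_ext Λ fun m x => BTensor.mapRight_tmul Λ Λ _ m x)
  map_comp f g := FGModuleCat.hom_ext (BTensor.linear_ext Λ fun m x =>
    (BTensor.mapRight_tmul Λ Λ _ m x).trans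
      ((congrArg (BTensor.mapRight Λ Λ g.hom.hom) (BTensor.mapRight_tmul Λ Λ f.hom.hom m x)).trans
        (BTensor.mapRight_tmul Λ Λ g.hom.hom m _)).symm)

instance : (tensorFunctor E).Additive where
  map_add {_ _ f g} := FGModuleCat.hom_ext (BTensor.linear_ext Λ fun m x =>
    (BTensor.mapRight_tmul Λ Λ _ m x).trans
      ((BTensor.tmul_add Λ m (f.hom.hom x) (g.hom.hom x)).trans
        (congrArg₂ (· + ·) (BTensor.mapRight_tmul Λ Λ f.hom.hom m x)
          (BTensor.mapRight_tmul Λ Λ g.hom.hom m x)).symm))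

/-- The endofunctor of the stable module category induced by `Ω_nc ⊗_Λ -`. -/
def stableTensor [IsSemisimpleRing E] :
    StableCategory (FGModuleCat.{u} Λ) ⥤ StableCategory (FGModuleCat.{u} Λ) :=
  stableMap (tensorFunctor E) (by
    intro P hP
    have := finite_projective hP
    have : Module.Projective Λ ((tensorFunctor E).obj P) := formsTensor_projective E P
    exact projective_of_module _)

/-- The module `Λ ⊗_E X`, for a finitely generated `Λ`-module `X`. -/
abbrev induced (X : FGModuleCat.{u} Λ) : FGModuleCat.{u} Λ := FGModuleCat.of Λ (Induced E X)

/-- The multiplication `μ : Λ ⊗_E X ⟶ X`. -/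
def mu (X : FGModuleCat.{u} Λ) : induced E X ⟶ X := FGModuleCat.ofHom (muMap E X)

/-- The inclusion `ι : Ω_nc ⊗_Λ X ⟶ Λ ⊗_E X` of the kernel of `μ`. -/
def iota (X : FGModuleCat.{u} Λ) : (tensorFunctor E).obj X ⟶ induced E X :=
  FGModuleCat.ofHom (iotaMap E X)

/-- The triangulated structure on the stabilization of the stable module category with respect to
`Ω_nc ⊗_Λ -`. Its suspension is `(X, n) ↦ (X, n + 1)`. An exact sequence `0 ⟶ X ⟶ Y ⟶ Z ⟶ 0`
of `Λ`-modules, with maps `f` and `g`, receives a morphism from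
`0 ⟶ Ω_nc ⊗_Λ Z ⟶ Λ ⊗_E Z ⟶ Z ⟶ 0` which is the identity on `Z` and some `ω` on the left; for
every integer `n` the triangle `(X, n) ⟶ (Y, n) ⟶ (Z, n) ⟶ (X, n + 1)` with maps `[f; n]`, `[g; n]`
and `(-1) ^ (n + 1) [ω; n + 1]` is distinguished, and all distinguished triangles are isomorphic to
one of these. -/
def moduleTriangles [IsSemisimpleRing E] : TriangleData (Stabilization (stableTensor E)) where
  shift := Stabilization.suspension (stableTensor E)
  dist u v w := ∃ (n : ℤ) (X Y Z : FGModuleCat.{u} Λ) (f : X ⟶ Y) (g : Y ⟶ Z)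
    (φ : induced E Z ⟶ Y) (ω : (tensorFunctor E).obj Z ⟶ X),
    Function.Injective f.hom.hom ∧ Function.Exact f.hom.hom g.hom.hom ∧
      Function.Surjective g.hom.hom ∧ φ ≫ g = mu E Z ∧ iota E Z ≫ φ = ω ≫ f ∧
      TriangleIso (Stabilization.suspension (stableTensor E)) u v w
        (X₂ := ⟨(toStable _).obj X, n⟩) (Y₂ := ⟨(toStable _).obj Y, n⟩)
        (Z₂ := ⟨(toStable _).obj Z, n⟩)
        (Stabilization.homMk 0 0 rfl ((toStable _).map f))
        (Stabilization.homMk 0 0 rfl ((toStable _).map g))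
        (Stabilization.homMk 1 0 (add_zero (n + 1)).symm
          ((toStable _).map (((n + 1).negOnePow : ℤ) • ω)))

end Modules

end Looped

set_option linter.unusedSectionVars false

/-! Write `Ω` for the functor `Ω_nc ⊗_Λ -` on the category `A` of finitely generated modules, and `G
X = Λ ⊗_E X`. The sequence `0 ⟶ Ω X ⟶ G X ⟶ X ⟶ 0` is functorial. Since `E` is semisimple, sequences
of modules split over `E`; therefore `G X` is projective, `G` turns monomorphisms into split ones,
and `Ω` is exact. Together with a comparison `ψ : G Ω X ⟶ Ω G X` this is all that the categorical
argument uses, and it is recorded in `LoopStructure`; the modules enter only through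
`loopStructure`.

In the stabilization `Ω` becomes invertible: `(X, n) ≅ (Ω X, n + 1)`. Every morphism comes from a
morphism of `A` at a late stage, and equality or being monic can be tested after applying some `Ω ^
k`. As `Ω` is exact, kernels and cokernels are those of `A`, so the stabilization is abelian. If `P`
is projective, so is every `Ω ^ a P`, and `(P, n)` is projective. Given a monomorphism `X ⟶ Y` and a
morphism `h : X ⟶ P`, the detour `Ω Y ⟶ G Y ⟶ G X ⟶ G P ⟶ Ω P` extends `Ω h` (`exists_extension`);
so `(P, n)` is also injective. Every `(X, n)` is a quotient of `(G X, n)` and embeds into `(G X, n +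
1)`, which gives the Frobenius property and the description of the projective objects.

The cokernel of that embedding is `(X, n + 1)`, so cosyzygies raise the degree by one. For the
isomorphism `(X, n) ≅ (Ω X, n + 1)` the induced map of cosyzygies is minus its suspension, because
`ι ≫ ψ = -Ω ι`; this is the origin of the signs (`Extends.projRel_suspension`). The stable category
of the stabilization is the stabilization of the stable category, since both identify `f` and `g`
exactly when some `Ω ^ k f - Ω ^ k g` factors through a projective object.

For the singularity category, `(X, n)` is sent to `X[n]`, using that the connecting morphism `X[n] ⟶
(Ω X)[n + 1]` has perfect cone. The vanishing of morphisms `Q[n] ⟶ Z[p]` for `Q` projective and `n <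
p` permits dimension shifting, and a perfect complex has no morphisms to `Z[p]` for large `p`;
together they give full faithfulness on the stable category. Essential surjectivity holds because
stalk complexes generate the bounded derived category. A fully faithful functor preserving
distinguished triangles also reflects them; the same fact shows that every short exact sequence in
`A` gives a standard triangle, which the comparison with the stabilization of the stable category
needs. -/

namespace Looped

/-! ### The inclusions `X ↦ (X, n)` and representatives of morphisms at late stages. -/

namespace Stabilization

section Inclusions

variable {C : Type u} [Category.{v} C] {Ω : C ⥤ C}

theorem cls_comp_cls {X Y Z : Stabilization Ω} {a b c : ℕ} (h : X.deg + a = Y.deg + b)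
    (h' : Y.deg + b = Z.deg + c) (f : (iter Ω a).obj X.obj ⟶ (iter Ω b).obj Y.obj)
    (g : (iter Ω b).obj Y.obj ⟶ (iter Ω c).obj Z.obj) :
    (homMk a b h f : X ⟶ Y) ≫ (homMk b c h' g : Y ⟶ Z) = homMk a c (h.trans h') (f ≫ g) :=
  comp_cls h h' f g

theorem homMk_id (X : Stabilization Ω) (a : ℕ) :
    homMk a a rfl (𝟙 ((iter Ω a).obj X.obj)) = 𝟙 X :=
  cls_id X a

variable (Ω)

/-- The functor `X ↦ (X, n)`. -/
def incl (n : ℤ) : C ⥤ Stabilization Ω where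
  obj X := ⟨X, n⟩
  map {X Y} f := homMk (X := ⟨X, n⟩) (Y := ⟨Y, n⟩) 0 0 rfl f
  map_id _ := rfl
  map_comp {X Y Z} f g :=
    (cls_comp_cls (X := ⟨X, n⟩) (Y := ⟨Y, n⟩) (Z := ⟨Z, n⟩) (a := 0) (b := 0) (c := 0) rfl rfl f g).symm

variable {Ω}

theorem homMk_iter_map {X Y : C} (n : ℤ) (f : X ⟶ Y) (a : ℕ) :
    homMk (X := ⟨X, n⟩) (Y := ⟨Y, n⟩) a a rfl ((iter Ω a).map f) = (incl Ω n).map f := by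
  induction a with
  | zero => rfl
  | succ a ih =>
    rw [← ih]
    exact cls_bump (X := ⟨X, n⟩) (Y := ⟨Y, n⟩) a a rfl rfl ((iter Ω a).map f)

variable (Ω)

/-- The isomorphism `(X, n) ≅ (Ω ^ a X, p)`, for `n + a = p`. -/
def nextIter (a : ℕ) (n p : ℤ) (h : n + a = p) : incl Ω n ≅ iter Ω a ⋙ incl Ω p :=
  NatIso.ofComponents
    (fun X =>
      { hom := homMk (X := ⟨X, n⟩) (Y := ⟨(iter Ω a).obj X, p⟩) a 0 (by simpa using h)
          (𝟙 ((iter Ω a).obj X))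
        inv := homMk (X := ⟨(iter Ω a).obj X, p⟩) (Y := ⟨X, n⟩) 0 a (by simpa using h.symm)
          (𝟙 ((iter Ω a).obj X))
        hom_inv_id := by
          refine (cls_comp_cls (X := ⟨X, n⟩) (Y := ⟨(iter Ω a).obj X, p⟩) (Z := ⟨X, n⟩) _ _ _ _).trans ?_
          exact (congrArg (homMk (X := ⟨X, n⟩) (Y := ⟨X, n⟩) a a rfl) (Category.comp_id _)).trans
            (homMk_id (⟨X, n⟩ : Stabilization Ω) a)
        inv_hom_id := by
          refine (cls_comp_cls (X := ⟨(iter Ω a).obj X, p⟩) (Y := ⟨X, n⟩)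
            (Z := ⟨(iter Ω a).obj X, p⟩) _ _ _ _).trans ?_
          exact congrArg (homMk (X := ⟨(iter Ω a).obj X, p⟩) (Y := ⟨(iter Ω a).obj X, p⟩) 0 0 rfl)
            (Category.comp_id _) })
    (by
      intro X Y f
      have e₁ := cls_comp_cls (X := ⟨X, n⟩) (Y := ⟨Y, n⟩) (Z := ⟨(iter Ω a).obj Y, p⟩)
        (a := a) (b := a) (c := 0) rfl (by simpa using h) ((iter Ω a).map f) (𝟙 ((iter Ω a).obj Y))
      have e₂ := cls_comp_cls (X := ⟨X, n⟩) (Y := ⟨(iter Ω a).obj X, p⟩)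
        (Z := ⟨(iter Ω a).obj Y, p⟩) (a := a) (b := 0) (c := 0) (by simpa using h) rfl
        (𝟙 ((iter Ω a).obj X)) ((iter Ω a).map f)
      rw [homMk_iter_map] at e₁
      refine e₁.trans (Eq.trans ?_ e₂.symm)
      congr 1
      exact (Category.comp_id _).trans (Category.id_comp _).symm)

/-- The isomorphism `(X, n) ≅ (Ω X, m)`, for `n + 1 = m`. -/
def next (n m : ℤ) (h : n + 1 = m) : incl Ω n ≅ Ω ⋙ incl Ω m :=
  nextIter Ω 1 n m (by simpa using h)

variable {Ω}

/-- Both outer isomorphisms are classes of identities, so the composite collapses to `f` at stage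
`p`. Up to isomorphism every morphism is thereby reduced to the image of a morphism of `C`. -/
theorem homMk_eq {X Y : Stabilization Ω} (a b : ℕ) (p : ℤ) (hX : X.deg + a = p) (hY : Y.deg + b = p)
    (f : (iter Ω a).obj X.obj ⟶ (iter Ω b).obj Y.obj) :
    homMk a b (hX.trans hY.symm) f =
      (nextIter Ω a X.deg p hX).hom.app X.obj ≫ (incl Ω p).map f ≫
        (nextIter Ω b Y.deg p hY).inv.app Y.obj := by
  have e₁ := cls_comp_cls (X := ⟨(iter Ω a).obj X.obj, p⟩) (Y := ⟨(iter Ω b).obj Y.obj, p⟩)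
    (Z := Y) (a := 0) (b := 0) (c := b) rfl (by simpa using hY.symm) f (𝟙 ((iter Ω b).obj Y.obj))
  have e₂ := cls_comp_cls (X := X) (Y := ⟨(iter Ω a).obj X.obj, p⟩)
    (Z := Y) (a := a) (b := 0) (c := b) (by simpa using hX) (by simpa using hY.symm)
    (𝟙 ((iter Ω a).obj X.obj)) f
  refine Eq.trans ?_ (e₂.symm.trans ?_)
  · congr 1
    exact (Category.id_comp _).symm
  · refine congrArg (fun t => homMk a 0 _ (𝟙 ((iter Ω a).obj X.obj)) ≫ t) (Eq.trans ?_ e₁.symm)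
    congr 1
    exact (Category.comp_id _).symm

theorem nextIter_succ (a : ℕ) (n q p : ℤ) (h : n + a = q) (h' : q + 1 = p)
    (h'' : n + (a + 1 : ℕ) = p) (X : C) :
    (nextIter Ω (a + 1) n p h'').hom.app X =
      (nextIter Ω a n q h).hom.app X ≫ (next Ω q p h').hom.app ((iter Ω a).obj X) := by
  -- The first factor is raised by one stage, where `bump` of an identity represents it; both
  -- factors then meet at exponent `1` on `(Ω ^ a X, q)`.
  have e := cls_comp_cls (X := ⟨X, n⟩) (Y := ⟨(iter Ω a).obj X, q⟩)
    (Z := ⟨(iter Ω (a + 1)).obj X, p⟩) (a := a + 1) (b := 1) (c := 0)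
    (by push_cast; omega) (by push_cast; omega)
    (bump (b := 0) (𝟙 ((iter Ω a).obj X))) (𝟙 ((iter Ω (a + 1)).obj X))
  have e' : homMk (X := ⟨X, n⟩) (Y := ⟨(iter Ω a).obj X, q⟩) (a + 1) 1
      (by push_cast; omega) (bump (b := 0) (𝟙 ((iter Ω a).obj X))) =
      (nextIter Ω a n q h).hom.app X :=
    cls_bump (X := ⟨X, n⟩) (Y := ⟨(iter Ω a).obj X, q⟩) a 0 (by simpa using h) _ _
  rw [e'] at e
  refine Eq.trans ?_ e.symm
  change homMk _ _ _ _ = _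
  congr 1
  refine Eq.trans ?_ (Category.comp_id _).symm
  exact (Ω.map_id _).symm

/-- Every morphism of the stabilization has a representative at each sufficiently late stage. -/
theorem exists_stage {X Y : Stabilization Ω} (u : X ⟶ Y) :
    ∃ N : ℤ, ∀ p ≥ N, ∃ (a b : ℕ) (hX : X.deg + a = p) (hY : Y.deg + b = p)
      (f : (iter Ω a).obj X.obj ⟶ (iter Ω b).obj Y.obj),
      u = (nextIter Ω a X.deg p hX).hom.app X.obj ≫ (incl Ω p).map f ≫
        (nextIter Ω b Y.deg p hY).inv.app Y.obj := by
  obtain ⟨a, b, h, f, rfl⟩ := exists_rep u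
  refine ⟨X.deg + a, fun p hp => ?_⟩
  obtain ⟨k, rfl⟩ : ∃ k : ℕ, p = X.deg + a + k := ⟨(p - (X.deg + a)).toNat, by omega⟩
  refine ⟨a + k, b + k, by push_cast; omega, by push_cast; omega, raise f k, ?_⟩
  rw [← homMk_eq]
  exact (cls_raise a b h f k (by push_cast; omega)).symm

theorem exists_stage_incl {n m : ℤ} {X Y : C} (u : (incl Ω n).obj X ⟶ (incl Ω m).obj Y) :
    ∃ N : ℤ, ∀ p ≥ N, ∃ (a b : ℕ) (hX : n + a = p) (hY : m + b = p)
      (f : (iter Ω a).obj X ⟶ (iter Ω b).obj Y),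
      u = (nextIter Ω a n p hX).hom.app X ≫ (incl Ω p).map f ≫ (nextIter Ω b m p hY).inv.app Y :=
  exists_stage u

theorem nextIter_conj (a : ℕ) (n p : ℤ) (h : n + a = p) {X Y : C} (f : X ⟶ Y) :
    (incl Ω n).map f = (nextIter Ω a n p h).hom.app X ≫ (incl Ω p).map ((iter Ω a).map f) ≫
      (nextIter Ω a n p h).inv.app Y := by
  have h5 := (nextIter Ω a n p h).hom.naturality f
  rw [← Category.assoc]
  exact ((Iso.comp_inv_eq ((nextIter Ω a n p h).app _)).mpr h5.symm).symm

theorem castMap_comp_castMap {X Y : C} {a b a' b' a'' b'' : ℕ} (ha : a = a') (hb : b = b')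
    (ha' : a' = a'') (hb' : b' = b'') (f : (iter Ω a).obj X ⟶ (iter Ω b).obj Y) :
    castMap ha' hb' (castMap ha hb f) = castMap (ha.trans ha') (hb.trans hb') f := by
  subst ha hb ha' hb'
  simp only [castMap_rfl]

/-- The relation satisfied by a representative which agrees with `f` after raising both. -/
def Agrees {X Y : Stabilization Ω} {a b : ℕ} (f : (iter Ω a).obj X.obj ⟶ (iter Ω b).obj Y.obj)
    (r : Rep X Y) : Prop :=
  ∃ (k l : ℕ) (h : r.a + k = a + l) (h' : r.b + k = b + l), castMap h h' (raise r.map k) = raise f l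

theorem agrees_next {X Y : Stabilization Ω} {a b : ℕ}
    (f : (iter Ω a).obj X.obj ⟶ (iter Ω b).obj Y.obj) (r : Rep X Y) :
    Agrees f r.next ↔ Agrees f r := by
  constructor
  · rintro ⟨k, l, h, h', e⟩
    refine ⟨k + 1, l, by rw [← h]; change _ = r.a + 1 + k; omega,
      by rw [← h']; change _ = r.b + 1 + k; omega, ?_⟩
    rw [← e]
    exact ((congrArg (castMap h h') (raise_bump r.map k)).trans
      (castMap_comp_castMap _ _ _ _ _)).symm
  · rintro ⟨k, l, h, h', e⟩
    refine ⟨k, l + 1, by change r.a + 1 + k = _; omega, by change r.b + 1 + k = _; omega, ?_⟩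
    refine ((congrArg (castMap _ _) (raise_bump r.map k)).trans
      (castMap_comp_castMap _ _ _ _ _)).trans ?_
    exact (bump_castMap h h' _).symm.trans (congrArg bump e)

/-- The Hom-sets are quotients by the relation generated by single transitions, so equality of
classes does not directly give an equality at a later stage. But `Agrees f` is invariant under
transitions and hence is a predicate on classes; it holds for the class of `f`, so also for the
class of `g`. -/
theorem exists_raise_eq {X Y : Stabilization Ω} {a b : ℕ} (h : X.deg + a = Y.deg + b)
    (f g : (iter Ω a).obj X.obj ⟶ (iter Ω b).obj Y.obj)
    (e : (homMk a b h f : X ⟶ Y) = homMk a b h g) : ∃ k, raise f k = raise g k := by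
  let P : (X ⟶ Y) → Prop := Quot.lift (Agrees f) (by
    rintro r _ rfl
    exact propext (agrees_next f r).symm)
  have hf : P (homMk a b h f) := ⟨0, 0, rfl, rfl, castMap_rfl _⟩
  rw [e] at hf
  obtain ⟨k, l, h₁, h₂, e'⟩ := hf
  obtain rfl : k = l := by change a + k = a + l at h₁; omega
  rw [castMap_rfl] at e'
  exact ⟨k, e'.symm⟩

theorem raise_eq_iter_map {X Y : C} (f : X ⟶ Y) (k : ℕ) :
    raise (Ω := Ω) (a := 0) (b := 0) f k =
      castMap (Nat.zero_add k).symm (Nat.zero_add k).symm ((iter Ω k).map f) := by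
  induction k with
  | zero => exact (castMap_rfl _).symm
  | succ k ih => exact (congrArg bump ih).trans (bump_castMap _ _ _)

theorem exists_iter_map_eq {X Y : C} (n : ℤ) (f g : X ⟶ Y)
    (h : (incl Ω n).map f = (incl Ω n).map g) : ∃ k, (iter Ω k).map f = (iter Ω k).map g := by
  obtain ⟨k, hk⟩ := exists_raise_eq (Ω := Ω) (X := ⟨X, n⟩) (Y := ⟨Y, n⟩) (a := 0) (b := 0) rfl f g h
  rw [raise_eq_iter_map, raise_eq_iter_map] at hk
  refine ⟨k, ?_⟩
  have := congrArg (castMap (Nat.zero_add k) (Nat.zero_add k)) hk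
  rwa [castMap_comp_castMap, castMap_comp_castMap, castMap_rfl, castMap_rfl] at this

theorem incl_map_eq_of_iter_map_eq {X Y : C} (n : ℤ) (f g : X ⟶ Y) (k : ℕ)
    (h : (iter Ω k).map f = (iter Ω k).map g) : (incl Ω n).map f = (incl Ω n).map g := by
  rw [← homMk_iter_map n f k, ← homMk_iter_map n g k, h]

/-- The morphisms of the stabilization are generated by the images of the morphisms of `C`, the
isomorphisms `(X, n) ≅ (Ω X, n + 1)` and their inverses. -/
theorem hom_induction {P : ∀ {X Y : Stabilization Ω}, (X ⟶ Y) → Prop}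
    (map : ∀ (n : ℤ) {X Y : C} (f : X ⟶ Y), P ((incl Ω n).map f))
    (next : ∀ (n m : ℤ) (h : n + 1 = m) (X : C), P ((next Ω n m h).hom.app X))
    (next_inv : ∀ (n m : ℤ) (h : n + 1 = m) (X : C), P ((Stabilization.next Ω n m h).inv.app X))
    (comp : ∀ {X Y Z : Stabilization Ω} (f : X ⟶ Y) (g : Y ⟶ Z), P f → P g → P (f ≫ g))
    {X Y : Stabilization Ω} (u : X ⟶ Y) : P u := by
  -- The isomorphisms over several stages are composites of those over one stage, and so are their
  -- inverses.
  have key : ∀ (a : ℕ) (n p : ℤ) (h : n + a = p) (X : C), P ((nextIter Ω a n p h).hom.app X) ∧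
      P ((nextIter Ω a n p h).inv.app X) := by
    intro a
    induction a with
    | zero =>
      intro n p h X
      obtain rfl : n = p := by simpa using h
      exact ⟨map n (𝟙 X), map n (𝟙 X)⟩
    | succ a ih =>
      intro n p h X
      have e := nextIter_succ (Ω := Ω) a n (n + a) p rfl (by push_cast at h; omega) h X
      have e' : (nextIter Ω (a + 1) n p h).inv.app X =
          (Stabilization.next Ω (n + a) p (by push_cast at h; omega)).inv.app ((iter Ω a).obj X) ≫
            (nextIter Ω a n (n + a) rfl).inv.app X := by
        have e₁ := IsIso.Iso.inv_hom ((nextIter Ω (a + 1) n p h).app X)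
        refine e₁.symm.trans (Eq.trans ?_ (IsIso.Iso.inv_hom ((nextIter Ω a n (n + a) rfl).app X ≪≫
          (Stabilization.next Ω (n + a) p (by push_cast at h; omega)).app ((iter Ω a).obj X))))
        congr 1
      rw [e, e']
      exact ⟨comp _ _ (ih _ _ _ _).1 (next _ _ _ _), comp _ _ (next_inv _ _ _ _) (ih _ _ _ _).2⟩
  obtain ⟨N, hN⟩ := exists_stage u
  obtain ⟨a, b, hX, hY, f, hu⟩ := hN N le_rfl
  rw [hu]
  exact comp _ _ (key _ _ _ _ _).1 (comp _ _ (map _ _) (key _ _ _ _ _).2)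

end Inclusions

/-! ### Functors out of the stabilization. -/

section Lift

variable {C : Type u} [Category.{v} C] {Ω : C ⥤ C} {D : Type u'} [Category.{v'} D]

/-- The composites `F n X ⟶ F (n + 1) (Ω X) ⟶ … ⟶ F p (Ω ^ a X)`, where `n + a = p`. -/
def iterHom (F : ℤ → C ⥤ D) (σ : ∀ n m : ℤ, n + 1 = m → (F n ⟶ Ω ⋙ F m)) (n : ℤ) :
    (a : ℕ) → (p : ℤ) → n + a = p → (F n ⟶ iter Ω a ⋙ F p)
  | 0, p, h => eqToHom (by
      obtain rfl : n = p := by simpa using h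
      rfl)
  | a + 1, p, h => iterHom F σ n a (p - 1) (by push_cast at h; omega) ≫
      Functor.whiskerLeft (iter Ω a) (σ (p - 1) p (by omega))

variable (F : ℤ → C ⥤ D) (σ : ∀ n m : ℤ, n + 1 = m → (F n ⟶ Ω ⋙ F m))

theorem isIso_iterHom (hσ : ∀ n m h, IsIso (σ n m h)) (n : ℤ) (a : ℕ) (p : ℤ) (h : n + a = p) :
    IsIso (iterHom F σ n a p h) := by
  induction a generalizing p with
  | zero => unfold iterHom; infer_instance
  | succ a ih =>
    unfold iterHom
    have := hσ (p - 1) p (by omega)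
    have e : IsIso (Functor.whiskerLeft (iter Ω a) (σ (p - 1) p (by omega))) :=
      inferInstance
    exact IsIso.comp_isIso' (ih (p - 1) (by push_cast at h; omega)) e

/-- The recursion passes through the literal index `p - 1`. Here the middle index is a variable,
which spares its users a transport. -/
theorem iterHom_succ_app (n : ℤ) (a : ℕ) (q p : ℤ) (h : n + a = q) (h' : q + 1 = p)
    (h'' : n + (a + 1 : ℕ) = p) (X : C) :
    (iterHom F σ n (a + 1) p h'').app X =
      (iterHom F σ n a q h).app X ≫ (σ q p h').app ((iter Ω a).obj X) := by
  obtain rfl : q = p - 1 := by omega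
  rfl

theorem iterHom_zero_app (n : ℤ) (h : n + (0 : ℕ) = n) (X : C) :
    (iterHom F σ n 0 n h).app X = 𝟙 ((F n).obj X) := rfl

theorem iterHom_one_app (n m : ℤ) (h : n + (1 : ℕ) = m) (h' : n + 1 = m) (X : C) :
    (iterHom F σ n 1 m h).app X = (σ n m h').app X := by
  rw [iterHom_succ_app F σ n 0 n m (by simp) h', iterHom_zero_app]
  exact Category.id_comp _

/-- An isomorphism between `F n X` and `F p (Ω ^ a X)`. -/
noncomputable def iterIso (hσ : ∀ n m h, IsIso (σ n m h)) (n : ℤ) (a : ℕ) (p : ℤ) (h : n + a = p) :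
    F n ≅ iter Ω a ⋙ F p :=
  have := isIso_iterHom F σ hσ n a p h
  asIso (iterHom F σ n a p h)

variable (hσ : ∀ n m h, IsIso (σ n m h))

/-- The morphism which the functor out of the stabilization assigns to a representative. -/
noncomputable def liftMap {X Y : Stabilization Ω} (a b : ℕ) (p : ℤ) (h : X.deg + a = p)
    (h' : Y.deg + b = p) (f : (iter Ω a).obj X.obj ⟶ (iter Ω b).obj Y.obj) :
    (F X.deg).obj X.obj ⟶ (F Y.deg).obj Y.obj :=
  (iterIso F σ hσ X.deg a p h).hom.app X.obj ≫ (F p).map f ≫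
    (iterIso F σ hσ Y.deg b p h').inv.app Y.obj

/-- This is independence of the stage. Passing from `p` to `q` inserts one more `σ` on each side,
and the two cancel by naturality of `σ p q` at `f`. -/
theorem liftMap_bump {X Y : Stabilization Ω} (a b : ℕ) (p q : ℤ) (h : X.deg + a = p)
    (h' : Y.deg + b = p) (hq : p + 1 = q) (k : X.deg + (a + 1 : ℕ) = q)
    (k' : Y.deg + (b + 1 : ℕ) = q) (f : (iter Ω a).obj X.obj ⟶ (iter Ω b).obj Y.obj) :
    liftMap F σ hσ (a + 1) (b + 1) q k k' (bump f) = liftMap F σ hσ a b p h h' f := by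
  unfold liftMap
  rw [← Category.assoc, ← Category.assoc]
  refine ((Iso.comp_inv_eq ((iterIso F σ hσ Y.deg (b + 1) q k').app Y.obj)).mpr ?_)
  change (iterHom F σ X.deg (a + 1) q k).app X.obj ≫ _ =
    _ ≫ (iterHom F σ Y.deg (b + 1) q k').app Y.obj
  rw [iterHom_succ_app F σ _ a p q h hq, iterHom_succ_app F σ _ b p q h' hq]
  have key : ∀ {x x₁ x₂ y y₁ y₂ : D} (α : x ⟶ x₁) (s : x₁ ⟶ x₂) (f₁ : x₁ ⟶ y₁) (f₂ : x₂ ⟶ y₂)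
      (t : y₁ ⟶ y₂) (β : y ≅ y₁), f₁ ≫ t = s ≫ f₂ →
        (α ≫ s) ≫ f₂ = ((α ≫ f₁) ≫ β.inv) ≫ β.hom ≫ t := by
    intro x x₁ x₂ y y₁ y₂ α s f₁ f₂ t β e
    simp [e]
  exact key _ _ _ _ _ ((iterIso F σ hσ Y.deg b p h').app Y.obj) ((σ p q hq).naturality f)

theorem liftMap_comp {X Y Z : Stabilization Ω} (a b c : ℕ) (p : ℤ) (h : X.deg + a = p)
    (h' : Y.deg + b = p) (h'' : Z.deg + c = p) (f : (iter Ω a).obj X.obj ⟶ (iter Ω b).obj Y.obj)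
    (g : (iter Ω b).obj Y.obj ⟶ (iter Ω c).obj Z.obj) :
    liftMap F σ hσ a c p h h'' (f ≫ g) =
      liftMap F σ hσ a b p h h' f ≫ liftMap F σ hσ b c p h' h'' g := by
  have e' : (iterIso F σ hσ Y.deg b p h').inv.app Y.obj ≫
      (iterIso F σ hσ Y.deg b p h').hom.app Y.obj =
    𝟙 _ := ((iterIso F σ hσ Y.deg b p h').app Y.obj).inv_hom_id
  unfold liftMap
  rw [Category.assoc, Category.assoc, reassoc_of% e', Functor.map_comp, Category.assoc]

/-- The functor out of the stabilization given by functors `F n` and isomorphisms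
`F n ≅ F (n + 1) ∘ Ω`, on morphisms. -/
noncomputable def liftHom {X Y : Stabilization Ω} (u : X ⟶ Y) :
    (F X.deg).obj X.obj ⟶ (F Y.deg).obj Y.obj :=
  Quot.liftOn u (fun r => liftMap F σ hσ r.a r.b _ rfl r.eq.symm r.map) (by
    rintro r _ rfl
    exact (liftMap_bump F σ hσ r.a r.b (X.deg + r.a) _ rfl r.eq.symm
      (by change _ = X.deg + ((r.a + 1 : ℕ) : ℤ); push_cast; omega) _ _ r.map).symm)

theorem liftHom_homMk {X Y : Stabilization Ω} (a b : ℕ) (p : ℤ) (h : X.deg + a = p)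
    (h' : Y.deg + b = p) (f : (iter Ω a).obj X.obj ⟶ (iter Ω b).obj Y.obj) :
    liftHom F σ hσ (homMk a b (h.trans h'.symm) f) = liftMap F σ hσ a b p h h' f := by
  subst h
  rfl

/-- The functor out of the stabilization given by functors `F n` and isomorphisms
`F n ≅ F (n + 1) ∘ Ω`. -/
noncomputable def lift : Stabilization Ω ⥤ D where
  obj X := (F X.deg).obj X.obj
  map u := liftHom F σ hσ u
  map_id X := by
    refine (liftHom_homMk F σ hσ 0 0 X.deg (by simp) (by simp) (𝟙 X.obj)).trans ?_
    unfold liftMap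
    have e : (iterIso F σ hσ X.deg 0 X.deg (by simp)).hom.app X.obj ≫
      (iterIso F σ hσ X.deg 0 X.deg (by simp)).inv.app X.obj = 𝟙 _ :=
      ((iterIso F σ hσ X.deg 0 X.deg (by simp)).app X.obj).hom_inv_id
    refine Eq.trans ?_ e
    congr 1
    refine Eq.trans (congrArg (· ≫ _) ((F X.deg).map_id X.obj)) ?_
    exact Category.id_comp _
  map_comp {X Y Z} u v := by
    obtain ⟨a, b, c, h, h', f, g, rfl, rfl⟩ := exists_rep_comp u v
    have e := cls_comp_cls h h' f g
    refine (congrArg (liftHom F σ hσ) e).trans ?_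
    refine (liftHom_homMk F σ hσ a c _ rfl (h.trans h').symm (f ≫ g)).trans ?_
    refine (liftMap_comp F σ hσ a b c _ rfl h.symm _ f g).trans ?_
    exact (congrArg₂ (· ≫ ·) (liftHom_homMk F σ hσ a b _ rfl h.symm f)
      (liftHom_homMk F σ hσ b c _ h.symm (h.trans h').symm g)).symm

theorem lift_map_incl_map (n : ℤ) {X Y : C} (f : X ⟶ Y) :
    (lift F σ hσ).map ((incl Ω n).map f) = (F n).map f := by
  refine (liftHom_homMk F σ hσ (X := ⟨X, n⟩) (Y := ⟨Y, n⟩) 0 0 n (by simp) (by simp) f).trans ?_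
  unfold liftMap
  rw [← Category.assoc]
  refine (Iso.comp_inv_eq ((iterIso F σ hσ n 0 n (by simp)).app Y)).mpr ?_
  exact (Category.id_comp _).trans (Category.comp_id _).symm

theorem lift_map_nextIter (a : ℕ) (n p : ℤ) (h : n + a = p) (X : C) :
    (lift F σ hσ).map ((nextIter Ω a n p h).hom.app X) = (iterHom F σ n a p h).app X := by
  refine (liftHom_homMk F σ hσ (X := ⟨X, n⟩) (Y := ⟨(iter Ω a).obj X, p⟩) a 0 p h (by simp)
    (𝟙 _)).trans ?_
  unfold liftMap
  rw [← Category.assoc]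
  refine (Iso.comp_inv_eq ((iterIso F σ hσ p 0 p (by simp)).app ((iter Ω a).obj X))).mpr ?_
  exact congrArg ((iterHom F σ n a p h).app X ≫ ·) ((F p).map_id ((iter Ω a).obj X))

theorem lift_map_next (n m : ℤ) (h : n + 1 = m) (X : C) :
    (lift F σ hσ).map ((next Ω n m h).hom.app X) = (σ n m h).app X :=
  (lift_map_nextIter F σ hσ 1 n m (by simpa using h) X).trans (iterHom_one_app F σ n m _ h X)

end Lift

end Stabilization

/-! ### Exact endofunctors: kernels and cokernels in the stabilization. -/

namespace Stabilization

section Additive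

variable {C : Type u} [Category.{v} C] [Preadditive C] {Ω : C ⥤ C} [Ω.Additive]

instance iter_additive (k : ℕ) : (iter Ω k).Additive := by
  induction k with
  | zero => exact inferInstanceAs (𝟭 C).Additive
  | succ k ih => exact inferInstanceAs (iter Ω k ⋙ Ω).Additive

instance incl_additive (n : ℤ) : (incl Ω n).Additive where
  map_add {X Y f g} := (add_cls (X := ⟨X, n⟩) (Y := ⟨Y, n⟩) (a := 0) (b := 0) rfl f g).symm

theorem exists_iter_map_eq_zero {X Y : C} (n : ℤ) (f : X ⟶ Y) (h : (incl Ω n).map f = 0) :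
    ∃ k, (iter Ω k).map f = 0 := by
  rw [← Functor.map_zero (incl Ω n)] at h
  obtain ⟨k, hk⟩ := exists_iter_map_eq n f 0 h
  exact ⟨k, by rw [hk, Functor.map_zero]⟩

end Additive

section Exact

variable {A : Type u} [Category.{v} A] [Abelian A] {Ω : A ⥤ A} [Ω.Additive]
  [PreservesFiniteLimits Ω] [PreservesFiniteColimits Ω]

instance iter_preservesFiniteLimits (k : ℕ) : PreservesFiniteLimits (iter Ω k) := by
  induction k with
  | zero => exact inferInstanceAs (PreservesFiniteLimits (𝟭 A))
  | succ k ih => exact comp_preservesFiniteLimits (iter Ω k) Ω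

instance iter_preservesFiniteColimits (k : ℕ) : PreservesFiniteColimits (iter Ω k) := by
  induction k with
  | zero => exact inferInstanceAs (PreservesFiniteColimits (𝟭 A))
  | succ k ih => exact comp_preservesFiniteColimits (iter Ω k) Ω

theorem _root_.CategoryTheory.Iso.comp_inv_eq_of_eq_zero {C : Type*} [Category* C] [Preadditive C]
    {X X' Y Y' : C} (α : X ≅ X') (β : Y ≅ Y') (f : X' ⟶ Y') (h : α.hom ≫ f ≫ β.inv = 0) : f = 0 := by
  have e : f = α.inv ≫ (α.hom ≫ f ≫ β.inv) ≫ β.hom := by simp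
  rw [e, h, zero_comp, comp_zero]

/-- Represent `u` by `w` at some stage. The vanishing of the composite in the stabilization means
that some further `Ω ^ k` kills the composite in `A`. After this enlargement the equation holds in
`A` itself, with `F` an iterate of `Ω` and hence exact, and ordinary arguments in an abelian
category apply. -/
theorem exists_stage_target {n : ℤ} {X Y : A} (g : X ⟶ Y) {W : Stabilization Ω}
    (u : W ⟶ (incl Ω n).obj X) (hu : u ≫ (incl Ω n).map g = 0) :
    ∃ (F : A ⥤ A) (_ : F.Additive) (_ : PreservesFiniteLimits F) (_ : PreservesFiniteColimits F)
      (q : ℤ) (e : incl Ω n ≅ F ⋙ incl Ω q) (W' : A) (α : W ≅ (incl Ω q).obj W') (w : W' ⟶ F.obj X),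
      w ≫ F.map g = 0 ∧ u = α.hom ≫ (incl Ω q).map w ≫ e.inv.app X := by
  obtain ⟨N, hN⟩ := exists_stage_incl (n := W.deg) (X := W.obj) u
  obtain ⟨a, b, hW, hX, w, e⟩ := hN N le_rfl
  let α := (nextIter Ω a W.deg N hW).app W.obj
  let β := nextIter Ω b n N hX
  have hβ : (incl Ω N).map ((iter Ω b).map g) ≫ β.inv.app Y = β.inv.app X ≫ (incl Ω n).map g :=
    β.inv.naturality g
  have h0 : (incl Ω N).map (w ≫ (iter Ω b).map g) = 0 := by
    have h2 : α.hom ≫ (incl Ω N).map (w ≫ (iter Ω b).map g) ≫ (β.app Y).inv = 0 := by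
      rw [Functor.map_comp, Category.assoc]
      refine (congrArg (fun t => α.hom ≫ (incl Ω N).map w ≫ t) hβ).trans ?_
      rw [e] at hu
      refine Eq.trans ?_ hu
      exact ((congrArg (α.hom ≫ ·) (Category.assoc _ _ _)).symm.trans (Category.assoc _ _ _).symm)
    rw [Iso.comp_inv_eq_of_eq_zero α (β.app Y) _ h2]
  obtain ⟨k, hk⟩ := exists_iter_map_eq_zero N _ h0
  rw [Functor.map_comp] at hk
  let γ := nextIter Ω k N (N + k) rfl
  refine ⟨iter Ω b ⋙ iter Ω k, inferInstance, comp_preservesFiniteLimits _ _,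
    comp_preservesFiniteColimits _ _, N + k,
    β ≪≫ Functor.isoWhiskerLeft (iter Ω b) γ ≪≫ (Functor.associator _ _ _).symm,
    (iter Ω k).obj ((iter Ω a).obj W.obj), α ≪≫ γ.app _, (iter Ω k).map w, hk, ?_⟩
  rw [e, nextIter_conj k N (N + k) rfl w]
  simp [α, β, γ]
  exact (Category.assoc _ _ _).symm

theorem exists_stage_source {n : ℤ} {X Y : A} (g : X ⟶ Y) {W : Stabilization Ω}
    (u : (incl Ω n).obj Y ⟶ W) (hu : (incl Ω n).map g ≫ u = 0) :
    ∃ (F : A ⥤ A) (_ : F.Additive) (_ : PreservesFiniteLimits F) (_ : PreservesFiniteColimits F)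
      (q : ℤ) (e : incl Ω n ≅ F ⋙ incl Ω q) (W' : A) (α : W ≅ (incl Ω q).obj W') (w : F.obj Y ⟶ W'),
      F.map g ≫ w = 0 ∧ u = e.hom.app Y ≫ (incl Ω q).map w ≫ α.inv := by
  obtain ⟨N, hN⟩ := exists_stage_incl (m := W.deg) (Y := W.obj) u
  obtain ⟨b, a, hX, hW, w, e⟩ := hN N le_rfl
  let α := (nextIter Ω a W.deg N hW).app W.obj
  let β := nextIter Ω b n N hX
  have hβ : (incl Ω n).map g ≫ β.hom.app Y = β.hom.app X ≫ (incl Ω N).map ((iter Ω b).map g) :=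
    β.hom.naturality g
  have h0 : (incl Ω N).map ((iter Ω b).map g ≫ w) = 0 := by
    have h2 : (β.app X).hom ≫ (incl Ω N).map ((iter Ω b).map g ≫ w) ≫ α.inv = 0 := by
      rw [Functor.map_comp, Category.assoc, ← Category.assoc]
      refine (congrArg (fun t => t ≫ (incl Ω N).map w ≫ α.inv) hβ.symm).trans ?_
      rw [e] at hu
      exact (Category.assoc _ _ _).trans hu
    rw [Iso.comp_inv_eq_of_eq_zero (β.app X) α _ h2]
  obtain ⟨k, hk⟩ := exists_iter_map_eq_zero N _ h0
  rw [Functor.map_comp] at hk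
  let γ := nextIter Ω k N (N + k) rfl
  refine ⟨iter Ω b ⋙ iter Ω k, inferInstance, comp_preservesFiniteLimits _ _,
    comp_preservesFiniteColimits _ _, N + k,
    β ≪≫ Functor.isoWhiskerLeft (iter Ω b) γ ≪≫ (Functor.associator _ _ _).symm,
    (iter Ω k).obj ((iter Ω a).obj W.obj), α ≪≫ γ.app _, (iter Ω k).map w, hk, ?_⟩
  rw [e, nextIter_conj k N (N + k) rfl w]
  simp [α, β, γ]
  rfl

instance mono_incl_map {n : ℤ} {X Y : A} (f : X ⟶ Y) [Mono f] : Mono ((incl Ω n).map f) := by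
  refine Preadditive.mono_of_cancel_zero _ fun u hu => ?_
  obtain ⟨F, _, _, _, q, e, W', α, w, hw, rfl⟩ := exists_stage_target f u hu
  have : w = 0 := by rw [← cancel_mono (F.map f), hw, zero_comp]
  rw [this, Functor.map_zero, zero_comp, comp_zero]

instance epi_incl_map {n : ℤ} {X Y : A} (f : X ⟶ Y) [Epi f] : Epi ((incl Ω n).map f) := by
  refine Preadditive.epi_of_cancel_zero _ fun u hu => ?_
  obtain ⟨F, _, _, _, q, e, W', α, w, hw, rfl⟩ := exists_stage_source f u hu
  have : w = 0 := by rw [← cancel_epi (F.map f), hw, comp_zero]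
  rw [this, Functor.map_zero, zero_comp, comp_zero]

/-- In the form given by `exists_stage_target`, the morphism `w` is killed by `F.map S.g` in `A`.
The functor `F` preserves the exactness of `S`, so `w` lifts already in `A`. -/
theorem exists_lift_of_shortExact {S : ShortComplex A} (hS : S.ShortExact) {n : ℤ}
    {W : Stabilization Ω} (u : W ⟶ (incl Ω n).obj S.X₂) (hu : u ≫ (incl Ω n).map S.g = 0) :
    ∃ v : W ⟶ (incl Ω n).obj S.X₁, v ≫ (incl Ω n).map S.f = u := by
  obtain ⟨F, _, _, _, q, e, W', α, w, hw, rfl⟩ := exists_stage_target S.g u hu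
  have hF := hS.map_of_exact F
  have := hF.mono_f
  obtain ⟨l, hl⟩ : ∃ l : W' ⟶ F.obj S.X₁, l ≫ F.map S.f = w :=
    ⟨hF.exact.lift w hw, hF.exact.lift_f w hw⟩
  refine ⟨α.hom ≫ (incl Ω q).map l ≫ e.inv.app S.X₁, ?_⟩
  have h : (incl Ω q).map (F.map S.f) ≫ e.inv.app S.X₂ = e.inv.app S.X₁ ≫ (incl Ω n).map S.f :=
    e.inv.naturality S.f
  subst hl
  rw [Functor.map_comp, Category.assoc, Category.assoc]
  exact congrArg (α.hom ≫ ·)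
    ((congrArg (fun t => (incl Ω q).map l ≫ t) h.symm).trans (Category.assoc _ _ _).symm)

theorem exists_desc_of_shortExact {S : ShortComplex A} (hS : S.ShortExact) {n : ℤ}
    {W : Stabilization Ω} (u : (incl Ω n).obj S.X₂ ⟶ W) (hu : (incl Ω n).map S.f ≫ u = 0) :
    ∃ v : (incl Ω n).obj S.X₃ ⟶ W, (incl Ω n).map S.g ≫ v = u := by
  obtain ⟨F, _, _, _, q, e, W', α, w, hw, rfl⟩ := exists_stage_source S.f u hu
  have hF := hS.map_of_exact F
  have := hF.epi_g
  obtain ⟨l, hl⟩ : ∃ l : F.obj S.X₃ ⟶ W', F.map S.g ≫ l = w :=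
    ⟨hF.exact.desc w hw, hF.exact.g_desc w hw⟩
  refine ⟨e.hom.app S.X₃ ≫ (incl Ω q).map l ≫ α.inv, ?_⟩
  have h : (incl Ω n).map S.g ≫ e.hom.app S.X₃ = e.hom.app S.X₂ ≫ (incl Ω q).map (F.map S.g) :=
    e.hom.naturality S.g
  subst hl
  rw [Functor.map_comp, Category.assoc, ← Category.assoc]
  exact (congrArg (fun t => t ≫ (incl Ω q).map l ≫ α.inv) h).trans (Category.assoc _ _ _)

/-- A morphism of the stabilization is isomorphic to one in the image of `incl`. -/
theorem exists_incl_iso {X Y : Stabilization Ω} (u : X ⟶ Y) :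
    ∃ (p : ℤ) (X' Y' : A) (α : X ≅ (incl Ω p).obj X') (β : Y ≅ (incl Ω p).obj Y') (f : X' ⟶ Y'),
      u = α.hom ≫ (incl Ω p).map f ≫ β.inv := by
  obtain ⟨N, hN⟩ := exists_stage u
  obtain ⟨a, b, hX, hY, f, e⟩ := hN N le_rfl
  exact ⟨N, _, _, (nextIter Ω a X.deg N hX).app X.obj, (nextIter Ω b Y.deg N hY).app Y.obj, f, e⟩

theorem shortExact_cokernel {X Y : A} (f : X ⟶ Y) [Mono f] :
    (ShortComplex.mk f (cokernel.π f) (cokernel.condition f)).ShortExact :=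
  .mk' (ShortComplex.exact_of_g_is_cokernel _ (cokernelIsCokernel f)) inferInstance
    (inferInstanceAs (Epi (cokernel.π f)))

theorem shortExact_kernel {X Y : A} (f : X ⟶ Y) [Epi f] :
    (ShortComplex.mk (kernel.ι f) f (kernel.condition f)).ShortExact :=
  .mk' (ShortComplex.exact_of_f_is_kernel _ (kernelIsKernel f))
    (inferInstanceAs (Mono (kernel.ι f))) inferInstance

/-- The image of a short exact sequence is the kernel of its second map. -/
noncomputable def inclIsKernel {S : ShortComplex A} (hS : S.ShortExact) (n : ℤ) :
    IsLimit (KernelFork.ofι ((incl Ω n).map S.f) (show _ ≫ (incl Ω n).map S.g = 0 by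
      rw [← Functor.map_comp, S.zero, Functor.map_zero])) :=
  have := hS.mono_f
  KernelFork.IsLimit.ofι' _ _ (fun k hk => ⟨(exists_lift_of_shortExact hS k hk).choose,
    (exists_lift_of_shortExact hS k hk).choose_spec⟩)

/-- The image of a short exact sequence is the cokernel of its first map. -/
noncomputable def inclIsCokernel {S : ShortComplex A} (hS : S.ShortExact) (n : ℤ) :
    IsColimit (CokernelCofork.ofπ ((incl Ω n).map S.g) (show (incl Ω n).map S.f ≫ _ = 0 by
      rw [← Functor.map_comp, S.zero, Functor.map_zero])) :=
  have := hS.epi_g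
  CokernelCofork.IsColimit.ofπ' _ _ (fun k hk => ⟨(exists_desc_of_shortExact hS k hk).choose,
    (exists_desc_of_shortExact hS k hk).choose_spec⟩)

/-- Up to isomorphism a morphism is the image of some `f` in `A`. The inclusion preserves
monomorphisms, so the second factor in the image factorisation of `f` may be dropped; the first
factor is an epimorphism and belongs to a short exact sequence, whose image supplies the kernel. -/
instance : HasKernels (Stabilization Ω) where
  has_limit {X Y} u := by
    obtain ⟨p, X', Y', α, β, f, rfl⟩ := exists_incl_iso u
    have : HasKernel ((incl Ω p).map (factorThruImage f)) :=
      ⟨_, inclIsKernel (shortExact_kernel (factorThruImage f)) p⟩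
    have e : (incl Ω p).map f = (incl Ω p).map (factorThruImage f) ≫ (incl Ω p).map (image.ι f) := by
      rw [← Functor.map_comp, image.fac]
    rw [e]
    have : HasKernel ((incl Ω p).map (factorThruImage f) ≫ (incl Ω p).map (image.ι f)) :=
      inferInstance
    infer_instance

instance : HasCokernels (Stabilization Ω) where
  has_colimit {X Y} u := by
    obtain ⟨p, X', Y', α, β, f, rfl⟩ := exists_incl_iso u
    have : HasCokernel ((incl Ω p).map (image.ι f)) :=
      ⟨_, inclIsCokernel (shortExact_cokernel (image.ι f)) p⟩
    have e : (incl Ω p).map f = (incl Ω p).map (factorThruImage f) ≫ (incl Ω p).map (image.ι f) := by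
      rw [← Functor.map_comp, image.fac]
    rw [e]
    have : HasCokernel ((incl Ω p).map (factorThruImage f) ≫ (incl Ω p).map (image.ι f)) :=
      inferInstance
    infer_instance

theorem mono_of_comp_isos {X Y X' Y' : Stabilization Ω} (α : X ≅ X') (β : Y ≅ Y') (f : X' ⟶ Y')
    [h : Mono (α.hom ≫ f ≫ β.inv)] : Mono f := by
  have e : f = α.inv ≫ (α.hom ≫ f ≫ β.inv) ≫ β.hom := by simp
  rw [e]
  infer_instance

theorem epi_of_comp_isos {X Y X' Y' : Stabilization Ω} (α : X ≅ X') (β : Y ≅ Y') (f : X' ⟶ Y')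
    [h : Epi (α.hom ≫ f ≫ β.inv)] : Epi f := by
  have e : f = α.inv ≫ (α.hom ≫ f ≫ β.inv) ≫ β.hom := by simp
  rw [e]
  infer_instance

/-- The inclusion of the kernel of `f` dies in the stabilization, so some `Ω ^ k` kills it. As `Ω ^
k` preserves kernels, the kernel of `Ω ^ k f` vanishes. -/
theorem exists_mono_iter_map {n : ℤ} {X Y : A} (f : X ⟶ Y) [Mono ((incl Ω n).map f)] :
    ∃ k, Mono ((iter Ω k).map f) := by
  have h : (incl Ω n).map (kernel.ι f) = 0 := by
    rw [← cancel_mono ((incl Ω n).map f), ← Functor.map_comp, kernel.condition, Functor.map_zero,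
      zero_comp]
  obtain ⟨k, hk⟩ := exists_iter_map_eq_zero n _ h
  refine ⟨k, Preadditive.mono_of_cancel_zero _ fun u hu => ?_⟩
  obtain ⟨l, hl⟩ := KernelFork.IsLimit.lift' (isLimitForkMapOfIsLimit' (iter Ω k)
    (kernel.condition f) (kernelIsKernel f)) u hu
  exact hl.symm.trans ((congrArg (l ≫ ·) hk).trans comp_zero)

theorem exists_epi_iter_map {n : ℤ} {X Y : A} (f : X ⟶ Y) [Epi ((incl Ω n).map f)] :
    ∃ k, Epi ((iter Ω k).map f) := by
  have h : (incl Ω n).map (cokernel.π f) = 0 := by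
    rw [← cancel_epi ((incl Ω n).map f), ← Functor.map_comp, cokernel.condition, Functor.map_zero,
      comp_zero]
  obtain ⟨k, hk⟩ := exists_iter_map_eq_zero n _ h
  refine ⟨k, Preadditive.epi_of_cancel_zero _ fun u hu => ?_⟩
  obtain ⟨l, hl⟩ := CokernelCofork.IsColimit.desc' (isColimitCoforkMapOfIsColimit' (iter Ω k)
    (cokernel.condition f) (cokernelIsCokernel f)) u hu
  exact hl.symm.trans ((congrArg (· ≫ l) hk).trans zero_comp)

end Exact

end Stabilization

/-! ### The stabilization is abelian. -/

namespace Stabilization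

section Abelian

open ZeroObject

variable {A : Type u} [Category.{v} A] [Abelian A] {Ω : A ⥤ A} [Ω.Additive]

theorem exists_incl_iso_of_le (X : Stabilization Ω) {p : ℤ} (h : X.deg ≤ p) :
    ∃ X' : A, Nonempty (X ≅ (incl Ω p).obj X') :=
  ⟨_, ⟨(nextIter Ω (p - X.deg).toNat X.deg p (by omega)).app X.obj⟩⟩

/-- Two objects can be moved to the larger of their degrees, and there the additive functor `incl`
preserves the biproduct formed in `A`. -/
instance : HasBinaryProducts (Stabilization Ω) := by
  have h : ∀ X Y : Stabilization Ω, HasLimit (pair X Y) := by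
    intro X Y
    obtain ⟨X', ⟨α⟩⟩ := exists_incl_iso_of_le X (le_max_left X.deg Y.deg)
    obtain ⟨Y', ⟨β⟩⟩ := exists_incl_iso_of_le Y (le_max_right X.deg Y.deg)
    generalize max X.deg Y.deg = p at α β
    have := preservesBinaryBiproducts_of_preservesBiproducts (incl Ω p)
    have : HasBinaryBiproduct ((incl Ω p).obj X') ((incl Ω p).obj Y') :=
      Functor.hasBinaryBiproduct_of_preserves (incl Ω p) X' Y'
    exact hasLimit_of_iso (F := pair ((incl Ω p).obj X') ((incl Ω p).obj Y'))
      (mapPairIso α.symm β.symm)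
  exact hasBinaryProducts_of_hasLimit_pair _

instance : HasZeroObject (Stabilization Ω) :=
  ⟨(incl Ω 0).obj 0, (incl Ω 0).map_isZero (isZero_zero A)⟩

instance : HasFiniteProducts (Stabilization Ω) :=
  hasFiniteProducts_of_has_binary_and_terminal

variable [PreservesFiniteLimits Ω] [PreservesFiniteColimits Ω]

theorem exists_mono_iso {X Y : Stabilization Ω} (u : X ⟶ Y) [Mono u] :
    ∃ (p : ℤ) (X' Y' : A) (α : X ≅ (incl Ω p).obj X') (β : Y ≅ (incl Ω p).obj Y') (f : X' ⟶ Y'),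
      Mono f ∧ u = α.hom ≫ (incl Ω p).map f ≫ β.inv := by
  obtain ⟨p, X', Y', α, β, f, rfl⟩ := exists_incl_iso u
  have := mono_of_comp_isos α β ((incl Ω p).map f)
  obtain ⟨k, hk⟩ := exists_mono_iter_map (Ω := Ω) (n := p) f
  let γ := nextIter Ω k p (p + k) rfl
  refine ⟨p + k, _, _, α ≪≫ γ.app X', β ≪≫ γ.app Y', (iter Ω k).map f, hk, ?_⟩
  rw [nextIter_conj k p (p + k) rfl f]
  simp [γ]

theorem exists_epi_iso {X Y : Stabilization Ω} (u : X ⟶ Y) [Epi u] :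
    ∃ (p : ℤ) (X' Y' : A) (α : X ≅ (incl Ω p).obj X') (β : Y ≅ (incl Ω p).obj Y') (f : X' ⟶ Y'),
      Epi f ∧ u = α.hom ≫ (incl Ω p).map f ≫ β.inv := by
  obtain ⟨p, X', Y', α, β, f, rfl⟩ := exists_incl_iso u
  have := epi_of_comp_isos α β ((incl Ω p).map f)
  obtain ⟨k, hk⟩ := exists_epi_iter_map (Ω := Ω) (n := p) f
  let γ := nextIter Ω k p (p + k) rfl
  refine ⟨p + k, _, _, α ≪≫ γ.app X', β ≪≫ γ.app Y', (iter Ω k).map f, hk, ?_⟩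
  rw [nextIter_conj k p (p + k) rfl f]
  simp [γ]

/-- A monomorphism is isomorphic to the image of a monomorphism of `A`, and the image of the
cokernel sequence of the latter exhibits it as a kernel. -/
instance : IsNormalMonoCategory (Stabilization Ω) where
  normalMonoOfMono u _ := by
    obtain ⟨p, X', Y', α, β, f, _, rfl⟩ := exists_mono_iso u
    let N : NormalMono ((incl Ω p).map f) :=
      { Z := _, g := _, w := _, isLimit := inclIsKernel (shortExact_cokernel f) p }
    exact ⟨N.ofArrowIso (Arrow.isoMk α.symm β.symm (by simp))⟩

instance : IsNormalEpiCategory (Stabilization Ω) where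
  normalEpiOfEpi u _ := by
    obtain ⟨p, X', Y', α, β, f, _, rfl⟩ := exists_epi_iso u
    let N : NormalEpi ((incl Ω p).map f) :=
      { W := _, g := _, w := _, isColimit := inclIsCokernel (shortExact_kernel f) p }
    exact ⟨N.ofArrowIso (Arrow.isoMk α.symm β.symm (by simp))⟩

noncomputable instance : Abelian (Stabilization Ω) where

end Abelian

end Stabilization

/-- The data relating an exact endofunctor `Ω` to a functorial presentation
`0 ⟶ Ω X ⟶ G X ⟶ X ⟶ 0` by projective objects. -/
structure LoopStructure {A : Type u} [Category.{v} A] [Abelian A] (Ω : A ⥤ A) where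
  /-- the functorial projective cover -/
  G : A ⥤ A
  /-- the inclusion of the syzygy -/
  ι : Ω ⟶ G
  /-- the projection onto the object -/
  μ : G ⟶ 𝟭 A
  zero : ∀ X, ι.app X ≫ μ.app X = 0
  shortExact : ∀ X, (ShortComplex.mk (ι.app X) (μ.app X) (zero X)).ShortExact
  projective : ∀ X, Projective (G.obj X)
  exists_retraction : ∀ {X Y : A} (i : X ⟶ Y) [Mono i], ∃ r, G.map i ≫ r = 𝟙 (G.obj X)
  /-- the comparison between the presentations of `Ω X` and of `X` -/
  ψ : ∀ X, G.obj (Ω.obj X) ⟶ Ω.obj (G.obj X)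
  ι_ψ : ∀ X, ι.app (Ω.obj X) ≫ ψ X = - Ω.map (ι.app X)
  ψ_μ : ∀ X, ψ X ≫ Ω.map (μ.app X) = μ.app (Ω.obj X)

/-! ### Projective and injective objects of the stabilization. -/

namespace LoopStructure

open Stabilization

variable {A : Type u} [Category.{v} A] [Abelian A] {Ω : A ⥤ A} (L : LoopStructure Ω)

theorem exists_retraction_ι (P : A) [Projective P] : ∃ r, L.ι.app P ≫ r = 𝟙 (Ω.obj P) :=
  have : Projective (ShortComplex.mk _ _ (L.zero P)).X₃ := inferInstanceAs (Projective P)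
  ⟨_, (L.shortExact P).splittingOfProjective.f_r⟩

include L in
theorem projective_obj (P : A) [Projective P] : Projective (Ω.obj P) := by
  obtain ⟨r, hr⟩ := L.exists_retraction_ι P
  have := L.projective P
  exact Retract.projective (Y := L.G.obj P) ⟨L.ι.app P, r, hr⟩

include L in
theorem projective_iter_obj (P : A) [Projective P] (k : ℕ) : Projective ((iter Ω k).obj P) := by
  induction k with
  | zero => assumption
  | succ k ih => exact L.projective_obj _

include L in
-- The presentation of `P` splits, and so does `G i`. The detour `Ω Y ⟶ G Y ⟶ G X ⟶ G P ⟶ Ω P`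
-- through the two retractions therefore restricts to `Ω h` along `Ω i`, by naturality of `ι`. This
-- is the source of injectivity.
theorem exists_extension {X Y P : A} (i : X ⟶ Y) [Mono i] [Projective P] (h : X ⟶ P) :
    ∃ k : Ω.obj Y ⟶ Ω.obj P, Ω.map i ≫ k = Ω.map h := by
  obtain ⟨r, hr⟩ := L.exists_retraction i
  obtain ⟨s, hs⟩ := L.exists_retraction_ι P
  refine ⟨L.ι.app Y ≫ r ≫ L.G.map h ≫ s, ?_⟩
  rw [L.ι.naturality_assoc, reassoc_of% hr, ← L.ι.naturality_assoc, hs, Category.comp_id]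

include L in
-- The application of `Ω` in `exists_extension` costs nothing in the stabilization, where `(Y, n) ≅
-- (Ω Y, n + 1)`.
theorem exists_incl_extension {X Y P : A} (n : ℤ) (i : X ⟶ Y) [Mono i] [Projective P] (h : X ⟶ P) :
    ∃ k : (incl Ω n).obj Y ⟶ (incl Ω n).obj P, (incl Ω n).map i ≫ k = (incl Ω n).map h := by
  obtain ⟨k, hk⟩ := L.exists_extension i h
  refine ⟨(next Ω n (n + 1) rfl).hom.app Y ≫ (incl Ω (n + 1)).map k ≫
    (next Ω n (n + 1) rfl).inv.app P, ?_⟩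
  rw [NatTrans.naturality_assoc, Functor.comp_map, ← Functor.map_comp_assoc, hk]
  exact (NatTrans.naturality_assoc _ _ _).symm.trans (by simp)

variable [Ω.Additive] [PreservesFiniteLimits Ω] [PreservesFiniteColimits Ω]

include L in
-- An epimorphism is represented by an epimorphism `g` of `A`, and the morphism to be lifted by some
-- `h` defined on `Ω ^ a P` at a late stage. There `Ω ^ a P` is projective and `Ω ^ b g` is still
-- epic, so the lift exists in `A`.
theorem projective_incl (P : A) [Projective P] (n : ℤ) : Projective ((incl Ω n).obj P) where
  factors {Y Z} f e _ := by
    obtain ⟨p, Y', Z', α, β, g, _, rfl⟩ := exists_epi_iso e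
    obtain ⟨N, hN⟩ := exists_stage_incl (n := n) (X := P) (m := p) (Y := Z') (f ≫ β.hom)
    obtain ⟨a, b, ha, hb, h, e⟩ := hN N le_rfl
    have : Projective ((iter Ω a).obj P) := L.projective_iter_obj P a
    let k := Projective.factorThru h ((iter Ω b).map g)
    have hk : k ≫ (iter Ω b).map g = h := Projective.factorThru_comp _ _
    let γ := nextIter Ω b p N hb
    refine ⟨(nextIter Ω a n N ha).hom.app P ≫ (incl Ω N).map k ≫ γ.inv.app Y' ≫ α.inv, ?_⟩
    have hγ : γ.inv.app Y' ≫ (incl Ω p).map g =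
      (incl Ω N).map ((iter Ω b).map g) ≫ γ.inv.app Z' := (γ.inv.naturality g).symm
    rw [← cancel_mono β.hom, e, ← hk, Functor.map_comp]
    simp only [Category.assoc, α.inv_hom_id_assoc, β.inv_hom_id, Category.comp_id]
    rw [hγ]

include L in
theorem injective_incl (P : A) [Projective P] (n : ℤ) : Injective ((incl Ω n).obj P) where
  factors {X Y} f i _ := by
    obtain ⟨p, X', Y', α, β, g, _, rfl⟩ := exists_mono_iso i
    obtain ⟨N, hN⟩ := exists_stage_incl (n := p) (X := X') (m := n) (Y := P) (α.inv ≫ f)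
    obtain ⟨b, a, hb, ha, h, e⟩ := hN N le_rfl
    have : Projective ((iter Ω a).obj P) := L.projective_iter_obj P a
    obtain ⟨k, hk⟩ := L.exists_incl_extension N ((iter Ω b).map g) h
    let γ := nextIter Ω b p N hb
    refine ⟨β.hom ≫ γ.hom.app Y' ≫ k ≫ (nextIter Ω a n N ha).inv.app P, ?_⟩
    have hγ : (incl Ω p).map g ≫ γ.hom.app Y' =
      γ.hom.app X' ≫ (incl Ω N).map ((iter Ω b).map g) := γ.hom.naturality g
    rw [← cancel_epi α.inv, e, ← hk]
    simp only [Category.assoc, β.inv_hom_id_assoc, α.inv_hom_id_assoc]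
    rw [reassoc_of% hγ]

/-- The projection of the presentation of `(X, n)`. -/
def inclμ (X : Stabilization Ω) : (incl Ω X.deg).obj (L.G.obj X.obj) ⟶ X :=
  (incl Ω X.deg).map (L.μ.app X.obj)

instance (X : A) : Epi (L.μ.app X) := (L.shortExact X).epi_g

instance (X : A) : Mono (L.ι.app X) := (L.shortExact X).mono_f

instance (X : Stabilization Ω) : Epi (L.inclμ X) :=
  epi_incl_map (L.μ.app X.obj)

/-- The embedding of `(X, n) ≅ (Ω X, n + 1)` into `(G X, n + 1)`. -/
def inclι (X : Stabilization Ω) : X ⟶ (incl Ω (X.deg + 1)).obj (L.G.obj X.obj) :=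
  (next Ω X.deg (X.deg + 1) rfl).hom.app X.obj ≫ (incl Ω (X.deg + 1)).map (L.ι.app X.obj)

instance (X : Stabilization Ω) : Mono (L.inclι X) := by
  have : Mono ((next Ω X.deg (X.deg + 1) rfl).hom.app X.obj) := inferInstance
  exact mono_comp' this (mono_incl_map (L.ι.app X.obj))

include L in
-- The objects `(G X, n)` and `(G X, n + 1)` are both projective and injective. A projective `(X,
-- n)` is a retract of the first, which covers it; an injective one is a retract of the second, into
-- which it embeds.
theorem isFrobeniusAbelian : IsFrobeniusAbelian (Stabilization Ω) where
  hasFiniteProducts := inferInstance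
  hasKernels := inferInstance
  hasCokernels := inferInstance
  isNormalMonoCategory := inferInstance
  isNormalEpiCategory := inferInstance
  enoughProjectives := ⟨fun X =>
    have := L.projective X.obj
    have := L.projective_incl (L.G.obj X.obj) X.deg
    ⟨{ p := _, f := L.inclμ X }⟩⟩
  enoughInjectives := ⟨fun X =>
    have := L.projective X.obj
    have := L.injective_incl (L.G.obj X.obj) (X.deg + 1)
    ⟨{ J := _, f := L.inclι X }⟩⟩
  projective_iff_injective X := by
    have := L.projective X.obj
    have h₁ := L.projective_incl (L.G.obj X.obj) (X.deg + 1)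
    have h₂ := L.injective_incl (L.G.obj X.obj) X.deg
    constructor
    · intro h
      let r : Retract X ((incl Ω X.deg).obj (L.G.obj X.obj)) :=
        ⟨_, L.inclμ X, Projective.factorThru_comp (𝟙 X) (L.inclμ X)⟩
      exact r.injective
    · intro h
      let r : Retract X ((incl Ω (X.deg + 1)).obj (L.G.obj X.obj)) :=
        ⟨L.inclι X, _, Injective.comp_factorThru (𝟙 X) (L.inclι X)⟩
      exact r.projective

theorem projective_iff_retract (X : Stabilization Ω) :
    Projective X ↔ Nonempty (Retract X ((incl Ω X.deg).obj (L.G.obj X.obj))) := by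
  have := L.projective X.obj
  have := L.projective_incl (L.G.obj X.obj) X.deg
  exact ⟨fun h => ⟨⟨_, L.inclμ X, Projective.factorThru_comp (𝟙 X) (L.inclμ X)⟩⟩,
    fun ⟨r⟩ => r.projective⟩

end LoopStructure

/-! ### The stable category as a quotient by a congruence. -/

section StableQuotient

open ZeroObject

variable {C : Type u} [Category.{v} C] [Preadditive C] [HasZeroObject C] [HasBinaryBiproducts C]

instance congruence_projRel : Congruence (projRel C) where
  equivalence :=
    { refl := fun f => ⟨0, (isZero_zero C).projective, 0, 0, by simp⟩
      symm := by
        rintro f g ⟨P, hP, a, b, h⟩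
        exact ⟨P, hP, -a, b, by rw [Preadditive.neg_comp, ← h, neg_sub]⟩
      trans := by
        rintro f g k ⟨P, hP, a, b, h⟩ ⟨Q, hQ, c, d, h'⟩
        exact ⟨P ⊞ Q, inferInstance, biprod.lift a c, biprod.desc b d, by
          rw [biprod.lift_desc, ← h, ← h', sub_add_sub_cancel]⟩ }
  comp_left := by
    rintro X Y Z f g g' ⟨P, hP, a, b, h⟩
    exact ⟨P, hP, f ≫ a, b, by rw [← Preadditive.comp_sub, h, Category.assoc]⟩
  comp_right := by
    rintro X Y Z f f' g ⟨P, hP, a, b, h⟩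
    exact ⟨P, hP, a, b ≫ g, by rw [← Preadditive.sub_comp, h, Category.assoc]⟩

theorem toStable_map_eq_iff {X Y : C} (f g : X ⟶ Y) :
    (toStable C).map f = (toStable C).map g ↔ projRel C f g :=
  CategoryTheory.Quotient.functor_map_eq_iff _ f g

theorem projRel.neg {X Y : C} {f g : X ⟶ Y} (h : projRel C f g) : projRel C (-f) (-g) := by
  obtain ⟨P, hP, a, b, h⟩ := h
  exact ⟨P, hP, -a, b, by rw [Preadditive.neg_comp, ← h]; abel⟩

variable {D : Type u'} [Category.{v'} D]

/-- The functor induced on the stable category. -/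
def stableLift (F : C ⥤ D) (hF : ∀ {X Y : C} (f g : X ⟶ Y), projRel C f g → F.map f = F.map g) :
    StableCategory C ⥤ D :=
  CategoryTheory.Quotient.lift _ F fun _ _ f g h => hF f g h

variable (F : C ⥤ D) (hF : ∀ {X Y : C} (f g : X ⟶ Y), projRel C f g → F.map f = F.map g)

instance stableLift_full [F.Full] : (stableLift F hF).Full where
  map_surjective {X Y} f := by
    obtain ⟨g, hg⟩ := F.map_surjective (X := X.as) (Y := Y.as) f
    exact ⟨(toStable C).map g, hg⟩

theorem stableLift_faithful
    (h : ∀ {X Y : C} (f g : X ⟶ Y), F.map f = F.map g → projRel C f g) :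
    (stableLift F hF).Faithful where
  map_injective {X Y} f g e := by
    obtain ⟨f, rfl⟩ := (toStable C).map_surjective (X := X.as) (Y := Y.as) f
    obtain ⟨g, rfl⟩ := (toStable C).map_surjective (X := X.as) (Y := Y.as) g
    exact (toStable_map_eq_iff f g).mpr (h f g e)

end StableQuotient

/-! ### The functor to the stabilization of the stable category. -/

namespace Stabilization

/-- The composition law of the iterates. -/
def iterAdd {C : Type u} [Category.{v} C] (Ω : C ⥤ C) (i : ℕ) :
    (l : ℕ) → (iter Ω i ⋙ iter Ω l ≅ iter Ω (i + l))
  | 0 => Iso.refl (iter Ω i)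
  | l + 1 => Functor.isoWhiskerRight (iterAdd Ω i l) Ω

variable {A : Type u} [Category.{v} A] [Abelian A] {Ω : A ⥤ A} [Ω.Additive]
  (hΩ : ∀ P : A, Projective P → Projective (Ω.obj P))

/-- The iterates of the induced endofunctor of the stable category are induced by the iterates. -/
def iterStable : (k : ℕ) → (iter Ω k ⋙ toStable A ≅ toStable A ⋙ iter (stableMap Ω hΩ) k)
  | 0 => Iso.refl (toStable A)
  | k + 1 => Functor.isoWhiskerRight (iterStable k) (stableMap Ω hΩ)

/-- The functor between stabilizations induced by the projection to the stable category. -/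
noncomputable def toStableStab : Stabilization Ω ⥤ Stabilization (stableMap Ω hΩ) :=
  lift (fun n => toStable A ⋙ incl (stableMap Ω hΩ) n)
    (fun n m h => Functor.whiskerLeft (toStable A) (next (stableMap Ω hΩ) n m h).hom)
    (fun n m h =>
      (Functor.isoWhiskerLeft (toStable A) (next (stableMap Ω hΩ) n m h)).isIso_hom)

theorem toStableStab_map_incl_map (n : ℤ) {X Y : A} (f : X ⟶ Y) :
    (toStableStab hΩ).map ((incl Ω n).map f) =
      (incl (stableMap Ω hΩ) n).map ((toStable A).map f) :=
  lift_map_incl_map _ _ _ n f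

theorem toStableStab_map_next (n m : ℤ) (h : n + 1 = m) (X : A) :
    (toStableStab hΩ).map ((next Ω n m h).hom.app X) =
      (next (stableMap Ω hΩ) n m h).hom.app ((toStable A).obj X) :=
  lift_map_next _ _ _ n m h X

/-- Morphisms of the target are generated by images of stable morphisms and by the isomorphisms `(X,
n) ≅ (Ω X, n + 1)` and their inverses; each generator is visibly an image. -/
instance toStableStab_full : (toStableStab hΩ).Full where
  map_surjective {X Y} u := by
    -- The source objects are read off from those of the target, so that `hom_induction` can run
    -- over all morphisms of the target.
    have key : ∀ {X Y : Stabilization (stableMap Ω hΩ)} (u : X ⟶ Y),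
        ∃ v : (⟨X.obj.as, X.deg⟩ : Stabilization Ω) ⟶ ⟨Y.obj.as, Y.deg⟩,
          (toStableStab hΩ).map v = u := by
      intro X Y u
      induction u using hom_induction with
      | map n f =>
        obtain ⟨g, rfl⟩ := (toStable A).map_surjective f
        exact ⟨(incl Ω n).map g, toStableStab_map_incl_map hΩ n g⟩
      | next n m h X =>
        exact ⟨(next Ω n m h).hom.app X.as, toStableStab_map_next hΩ n m h X.as⟩
      | next_inv n m h X =>
        refine ⟨(next Ω n m h).inv.app X.as, ?_⟩
        have h₁ := (toStableStab hΩ).mapIso ((next Ω n m h).app X.as)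
        have h₂ := IsIso.Iso.inv_hom ((toStableStab hΩ).mapIso ((next Ω n m h).app X.as))
        refine h₂.symm.trans (Eq.trans ?_
          (IsIso.Iso.inv_hom ((next (stableMap Ω hΩ) n m h).app X)))
        congr 1
        exact toStableStab_map_next hΩ n m h X.as
      | comp f g hf hg =>
        obtain ⟨f, rfl⟩ := hf
        obtain ⟨g, rfl⟩ := hg
        exact ⟨f ≫ g, Functor.map_comp _ _ _⟩
    exact key u

theorem iter_stableMap_map (k : ℕ) {X Y : A} (f g : X ⟶ Y) :
    (iter (stableMap Ω hΩ) k).map ((toStable A).map f) =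
        (iter (stableMap Ω hΩ) k).map ((toStable A).map g) ↔
      projRel A ((iter Ω k).map f) ((iter Ω k).map g) := by
  have hf := (iterStable hΩ k).hom.naturality f
  have hg := (iterStable hΩ k).hom.naturality g
  rw [← toStable_map_eq_iff]
  constructor
  · intro h
    rw [← cancel_mono ((iterStable hΩ k).hom.app Y)]
    exact hf.trans ((congrArg (fun t => (iterStable hΩ k).hom.app X ≫ t) h).trans hg.symm)
  · intro h
    rw [← cancel_epi ((iterStable hΩ k).hom.app X)]
    exact hf.symm.trans ((congrArg (fun t => t ≫ (iterStable hΩ k).hom.app Y) h).trans hg)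

theorem toStableStab_map_incl_map_eq_iff (n : ℤ) {X Y : A} (f g : X ⟶ Y) :
    (toStableStab hΩ).map ((incl Ω n).map f) = (toStableStab hΩ).map ((incl Ω n).map g) ↔
      ∃ k, projRel A ((iter Ω k).map f) ((iter Ω k).map g) := by
  rw [toStableStab_map_incl_map, toStableStab_map_incl_map]
  constructor
  · intro h
    obtain ⟨k, hk⟩ := exists_iter_map_eq n _ _ h
    exact ⟨k, (iter_stableMap_map hΩ k f g).mp hk⟩
  · rintro ⟨k, hk⟩
    exact incl_map_eq_of_iter_map_eq n _ _ k ((iter_stableMap_map hΩ k f g).mpr hk)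

/-- Two parallel morphisms are represented at a common stage. -/
theorem exists_stage_pair {X Y : Stabilization Ω} (u v : X ⟶ Y) :
    ∃ (p : ℤ) (X' Y' : A) (α : X ≅ (incl Ω p).obj X') (β : Y ≅ (incl Ω p).obj Y') (f g : X' ⟶ Y'),
      u = α.hom ≫ (incl Ω p).map f ≫ β.inv ∧ v = α.hom ≫ (incl Ω p).map g ≫ β.inv := by
  obtain ⟨N, hN⟩ := exists_stage u
  obtain ⟨M, hM⟩ := exists_stage v
  obtain ⟨a, b, hX, hY, f, e⟩ := hN (max N M) (le_max_left _ _)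
  obtain ⟨a', b', hX', hY', g, e'⟩ := hM (max N M) (le_max_right _ _)
  obtain rfl : a = a' := by omega
  obtain rfl : b = b' := by omega
  exact ⟨max N M, _, _, (nextIter Ω a X.deg _ hX).app X.obj, (nextIter Ω b Y.deg _ hY).app Y.obj,
    f, g, e, e'⟩

theorem _root_.Looped.projRel_iso_conj {C : Type u'} [Category.{v'} C] [Preadditive C]
    {X X' Y Y' : C} (α : X ≅ X') (β : Y ≅ Y') (f g : X' ⟶ Y') :
    projRel C (α.hom ≫ f ≫ β.inv) (α.hom ≫ g ≫ β.inv) ↔ projRel C f g := by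
  constructor
  · rintro ⟨P, hP, a, b, h⟩
    refine ⟨P, hP, α.inv ≫ a, b ≫ β.hom, ?_⟩
    rw [Category.assoc, ← Category.assoc a, ← h]
    simp
  · rintro ⟨P, hP, a, b, h⟩
    refine ⟨P, hP, α.hom ≫ a, b ≫ β.inv, ?_⟩
    rw [Category.assoc, ← Category.assoc a, ← h]
    simp

theorem _root_.Looped.map_iso_conj_eq_iff {C : Type u'} [Category.{v'} C] {D : Type*} [Category* D]
    (F : C ⥤ D) {X X' Y Y' : C} (α : X ≅ X') (β : Y ≅ Y') (f g : X' ⟶ Y') :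
    F.map (α.hom ≫ f ≫ β.inv) = F.map (α.hom ≫ g ≫ β.inv) ↔ F.map f = F.map g := by
  simp [cancel_mono, cancel_epi]

end Stabilization

/-! ### Stabilizing and passing to the stable category commute. -/

namespace LoopStructure

open Stabilization

variable {A : Type u} [Category.{v} A] [Abelian A] {Ω : A ⥤ A} (L : LoopStructure Ω)
  [Ω.Additive] [PreservesFiniteLimits Ω] [PreservesFiniteColimits Ω]

include L in
-- A projective object of the stabilization is a retract of some `(Q, m)` with `Q` projective in
-- `A`, so the factorisation may be taken through `(Q, m)`. At a late stage both factors are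
-- morphisms of `A` through `Ω ^ j Q`, which is projective, and one more application of some `Ω ^ l`
-- makes the equation hold in `A`. Conversely, a factorisation of `Ω ^ k f - Ω ^ k g` through `P`
-- gives one through the projective object `(P, n + k)`.
theorem projRel_incl_map_iff (n : ℤ) {X Y : A} (f g : X ⟶ Y) :
    projRel (Stabilization Ω) ((incl Ω n).map f) ((incl Ω n).map g) ↔
      ∃ k, projRel A ((iter Ω k).map f) ((iter Ω k).map g) := by
  constructor
  · rintro ⟨P, hP, a, b, h⟩
    obtain ⟨r⟩ := (L.projective_iff_retract P).mp hP
    have hQ := L.projective P.obj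
    set Q := L.G.obj P.obj
    obtain ⟨N, hN⟩ := exists_stage_incl (a ≫ r.i)
    obtain ⟨M, hM⟩ := exists_stage_incl (r.r ≫ b)
    obtain ⟨i, j, hi, hj, a', ea⟩ := hN (max N M) (le_max_left _ _)
    obtain ⟨j', i', hj', hi', b', eb⟩ := hM (max N M) (le_max_right _ _)
    obtain rfl : i = i' := by omega
    obtain rfl : j = j' := by omega
    generalize max N M = q at *
    have e : (incl Ω n).map (f - g) = (a ≫ r.i) ≫ (r.r ≫ b) := by
      rw [Functor.map_sub, h]
      simp
    have e' : (nextIter Ω i n q hi).hom.app X ≫ (incl Ω q).map ((iter Ω i).map (f - g)) ≫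
        (nextIter Ω i n q hi).inv.app Y =
      (nextIter Ω i n q hi).hom.app X ≫ (incl Ω q).map (a' ≫ b') ≫
        (nextIter Ω i n q hi).inv.app Y := by
      rw [← nextIter_conj, e, ea, eb]
      have : (nextIter Ω j P.deg q hj).inv.app Q ≫ (nextIter Ω j P.deg q hj).hom.app Q = 𝟙 _ :=
        ((nextIter Ω j P.deg q hj).app Q).inv_hom_id
      simp only [Category.assoc, reassoc_of% this, Functor.map_comp]
    have e'' : (incl Ω q).map ((iter Ω i).map (f - g)) = (incl Ω q).map (a' ≫ b') := by
      rw [← cancel_mono ((nextIter Ω i n q hi).inv.app Y),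
        ← cancel_epi ((nextIter Ω i n q hi).hom.app X)]
      exact e'
    obtain ⟨l, hl⟩ := exists_iter_map_eq q _ _ e''
    have := L.projective_iter_obj Q j
    have := L.projective_iter_obj ((iter Ω j).obj Q) l
    refine ⟨i + l, (iter Ω l).obj ((iter Ω j).obj Q), inferInstance,
      (iterAdd Ω i l).inv.app X ≫ (iter Ω l).map a', (iter Ω l).map b' ≫ (iterAdd Ω i l).hom.app Y, ?_⟩
    rw [← Functor.map_sub, Category.assoc, ← Functor.map_comp_assoc, ← hl]
    exact (NatIso.naturality_1 (iterAdd Ω i l) (f - g)).symm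
  · rintro ⟨k, P, hP, a, b, h⟩
    refine ⟨(incl Ω (n + k)).obj P, L.projective_incl P _,
      (nextIter Ω k n (n + k) rfl).hom.app X ≫ (incl Ω (n + k)).map a,
      (incl Ω (n + k)).map b ≫ (nextIter Ω k n (n + k) rfl).inv.app Y, ?_⟩
    rw [← Functor.map_sub, nextIter_conj k n (n + k) rfl, Functor.map_sub, h, Functor.map_comp]
    simp only [Category.assoc]

include L in
-- At a common stage both sides say that some `Ω ^ k f - Ω ^ k g` factors through a projective
-- object of `A`.
theorem toStableStab_map_eq_iff (hΩ : ∀ P : A, Projective P → Projective (Ω.obj P))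
    {X Y : Stabilization Ω} (u v : X ⟶ Y) :
    (toStableStab hΩ).map u = (toStableStab hΩ).map v ↔ projRel (Stabilization Ω) u v := by
  obtain ⟨p, X', Y', α, β, f, g, rfl, rfl⟩ := exists_stage_pair u v
  rw [projRel_iso_conj, map_iso_conj_eq_iff, L.projRel_incl_map_iff,
    toStableStab_map_incl_map_eq_iff]

/-- The functor from the stable category of the stabilization to the stabilization of the stable
category. -/
noncomputable def compare (hΩ : ∀ P : A, Projective P → Projective (Ω.obj P)) :
    StableCategory (Stabilization Ω) ⥤ Stabilization (stableMap Ω hΩ) :=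
  stableLift (toStableStab hΩ) fun u v h => (L.toStableStab_map_eq_iff hΩ u v).mpr h

theorem compare_isEquivalence (hΩ : ∀ P : A, Projective P → Projective (Ω.obj P)) :
    (L.compare hΩ).IsEquivalence where
  faithful := stableLift_faithful _ (fun u v h => (L.toStableStab_map_eq_iff hΩ u v).mpr h) fun u v h =>
     (L.toStableStab_map_eq_iff hΩ u v).mp h
  full := stableLift_full _ fun u v h => (L.toStableStab_map_eq_iff hΩ u v).mpr h
  essSurj := ⟨fun X => ⟨⟨⟨X.obj.as, X.deg⟩⟩, ⟨Iso.refl _⟩⟩⟩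

end LoopStructure

/-- Two morphisms of sequences `X ⟶ I ⟶ T` into a sequence with projective middle term which agree on
the left have stably equal right components. -/
theorem projRel_of_comp_eq {C : Type u} [Category.{v} C] [Preadditive C] {X I T I' T' : C}
    {i : X ⟶ I} {p : I ⟶ T} [Epi p] (hp : ∀ {Z : C} (k : I ⟶ Z), i ≫ k = 0 → ∃ l, p ≫ l = k)
    {p' : I' ⟶ T'} (hI' : Projective I') {a a' : I ⟶ I'} (h : i ≫ a = i ≫ a') {t t' : T ⟶ T'}
    (ht : p ≫ t = a ≫ p') (ht' : p ≫ t' = a' ≫ p') : projRel C t t' := by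
  obtain ⟨d, hd⟩ := hp (a - a') (by rw [Preadditive.comp_sub, h, sub_self])
  refine ⟨I', hI', d, p', ?_⟩
  rw [← cancel_epi p, Preadditive.comp_sub, ht, ht', reassoc_of% hd, Preadditive.sub_comp]

theorem projRel.zsmul {C : Type u} [Category.{v} C] [Preadditive C] {X Y : C} {f g : X ⟶ Y}
    (h : projRel C f g) (r : ℤ) : projRel C (r • f) (r • g) := by
  obtain ⟨P, hP, a, b, h⟩ := h
  exact ⟨P, hP, r • a, b, by rw [Preadditive.zsmul_comp, ← h, smul_sub]⟩

theorem projRel.comp {C : Type u} [Category.{v} C] [Preadditive C] [HasZeroObject C]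
    [HasBinaryBiproducts C] {X Y Z : C} {f f' : X ⟶ Y} {g g' : Y ⟶ Z} (h : projRel C f f')
    (h' : projRel C g g') : projRel C (f ≫ g) (f' ≫ g') :=
  congruence_projRel.equivalence.trans (congruence_projRel.comp_right g h)
    (congruence_projRel.comp_left f' h')

/-! ### The suspension of the stabilization and its signs. -/

namespace LoopStructure

open Stabilization

variable {A : Type u} [Category.{v} A] [Abelian A] {Ω : A ⥤ A} (L : LoopStructure Ω)
  [Ω.Additive]

/-- The injective object into which `X` embeds. -/
abbrev K (X : Stabilization Ω) : Stabilization Ω :=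
  (incl Ω (X.deg + 1)).obj (L.G.obj X.obj)

/-- The cokernel `K X ⟶ Σ X` of the embedding of `X`. -/
def toSuspension (X : Stabilization Ω) : L.K X ⟶ (suspension Ω).obj X :=
  (incl Ω (X.deg + 1)).map (L.μ.app X.obj)

theorem inclι_toSuspension (X : Stabilization Ω) : L.inclι X ≫ L.toSuspension X = 0 := by
  have h : (incl Ω (X.deg + 1)).map (L.ι.app X.obj) ≫ (incl Ω (X.deg + 1)).map (L.μ.app X.obj) = 0 := by
    rw [← Functor.map_comp, L.zero, Functor.map_zero]
  exact (Category.assoc _ _ _).trans ((congrArg (_ ≫ ·) h).trans comp_zero)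

/-- The right component `t` of a morphism between the sequences `X ⟶ K X ⟶ Σ X` and
`Y ⟶ K Y ⟶ Σ Y` which extends `f`. -/
def Extends {X Y : Stabilization Ω} (f : X ⟶ Y) (t : (suspension Ω).obj X ⟶ (suspension Ω).obj Y) :
    Prop :=
  ∃ a : L.K X ⟶ L.K Y, L.inclι X ≫ a = f ≫ L.inclι Y ∧
    L.toSuspension X ≫ t = a ≫ L.toSuspension Y

variable {L} in
theorem Extends.comp {X Y Z : Stabilization Ω} {f : X ⟶ Y} {g : Y ⟶ Z}
    {t : (suspension Ω).obj X ⟶ (suspension Ω).obj Y}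
    {t' : (suspension Ω).obj Y ⟶ (suspension Ω).obj Z} (h : L.Extends f t) (h' : L.Extends g t') :
    L.Extends (f ≫ g) (t ≫ t') := by
  obtain ⟨a, e, e'⟩ := h
  obtain ⟨b, k, k'⟩ := h'
  exact ⟨a ≫ b, by rw [reassoc_of% e, k, Category.assoc], by rw [reassoc_of% e', k', Category.assoc]⟩

theorem Extends.id (X : Stabilization Ω) : L.Extends (𝟙 X) (𝟙 _) :=
  ⟨𝟙 _, by simp, by simp⟩

/-- The middle morphism is the image of `G f`; the two squares are the naturality of `ι` and of `μ`.
No sign arises between objects of equal degree. -/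
theorem extends_incl_map (n : ℤ) {X Y : A} (f : X ⟶ Y) :
    L.Extends ((incl Ω n).map f) ((suspension Ω).map ((incl Ω n).map f)) := by
  refine ⟨(incl Ω (n + 1)).map (L.G.map f), ?_, ?_⟩
  · have h₁ : (incl Ω (n + 1)).map (L.ι.app X) ≫ (incl Ω (n + 1)).map (L.G.map f) =
        (incl Ω (n + 1)).map (Ω.map f) ≫ (incl Ω (n + 1)).map (L.ι.app Y) := by
      rw [← Functor.map_comp, ← Functor.map_comp, L.ι.naturality]
    have h₂ : (incl Ω n).map f ≫ (next Ω n (n + 1) rfl).hom.app Y =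
      (next Ω n (n + 1) rfl).hom.app X ≫ (incl Ω (n + 1)).map (Ω.map f) := NatTrans.naturality _ f
    exact (Category.assoc _ _ _).trans ((congrArg (_ ≫ ·) h₁).trans
      ((Category.assoc _ _ _).symm.trans ((congrArg (· ≫ _) h₂.symm).trans (Category.assoc _ _ _))))
  · change (incl Ω (n + 1)).map (L.μ.app X) ≫ (incl Ω (n + 1)).map f =
      (incl Ω (n + 1)).map (L.G.map f) ≫ (incl Ω (n + 1)).map (L.μ.app Y)
    rw [← Functor.map_comp, ← Functor.map_comp, L.μ.naturality]
    rfl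

/-- All signs originate here. Commutativity on the left forces the middle morphism to be minus the
one given by `ψ`, because `ι ≫ ψ = -Ω ι`; on the right, where `ψ` is compatible with `μ` without a
sign, the minus remains. -/
theorem extends_next_inv (n m : ℤ) (h : n + 1 = m) (X : A) :
    L.Extends ((next Ω n m h).inv.app X) (-(suspension Ω).map ((next Ω n m h).inv.app X)) := by
  subst h
  refine ⟨-((incl Ω (n + 1 + 1)).map (L.ψ X) ≫ (next Ω (n + 1) (n + 1 + 1) rfl).inv.app (L.G.obj X)),
    ?_, ?_⟩
  · change ((next Ω (n + 1) (n + 1 + 1) rfl).hom.app (Ω.obj X) ≫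
        (incl Ω (n + 1 + 1)).map (L.ι.app (Ω.obj X))) ≫ (-_) =
      (next Ω n (n + 1) rfl).inv.app X ≫ (next Ω n (n + 1) rfl).hom.app X ≫
        (incl Ω (n + 1)).map (L.ι.app X)
    have h₁ : (incl Ω (n + 1 + 1)).map (L.ι.app (Ω.obj X)) ≫ (incl Ω (n + 1 + 1)).map (L.ψ X) =
        -(incl Ω (n + 1 + 1)).map (Ω.map (L.ι.app X)) := by
      rw [← Functor.map_comp, L.ι_ψ, Functor.map_neg]
    have h₂ := nextIter_conj (Ω := Ω) 1 (n + 1) (n + 1 + 1) rfl (L.ι.app X)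
    have h₃ : (next Ω n (n + 1) rfl).inv.app X ≫ (next Ω n (n + 1) rfl).hom.app X = 𝟙 _ :=
      ((next Ω n (n + 1) rfl).app X).inv_hom_id
    rw [reassoc_of% h₃, h₂, Preadditive.comp_neg, Category.assoc, reassoc_of% h₁,
      Preadditive.neg_comp, Preadditive.comp_neg, neg_neg]
    rfl
  · change (incl Ω (n + 1 + 1)).map (L.μ.app (Ω.obj X)) ≫
        (-(next Ω (n + 1) (n + 1 + 1) rfl).inv.app X) =
      (-_) ≫ (incl Ω (n + 1)).map (L.μ.app X)
    have h₁ : (incl Ω (n + 1 + 1)).map (L.ψ X) ≫ (incl Ω (n + 1 + 1)).map (Ω.map (L.μ.app X)) =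
        (incl Ω (n + 1 + 1)).map (L.μ.app (Ω.obj X)) := by
      rw [← Functor.map_comp, L.ψ_μ]
    have h₂ : (incl Ω (n + 1 + 1)).map (Ω.map (L.μ.app X)) ≫
          (next Ω (n + 1) (n + 1 + 1) rfl).inv.app X =
        (next Ω (n + 1) (n + 1 + 1) rfl).inv.app (L.G.obj X) ≫ (incl Ω (n + 1)).map (L.μ.app X) :=
      (next Ω (n + 1) (n + 1 + 1) rfl).inv.naturality (L.μ.app X)
    rw [← h₁, Preadditive.comp_neg, Preadditive.neg_comp, Category.assoc, Category.assoc]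
    exact congrArg (fun t => -((incl Ω (n + 1 + 1)).map (L.ψ X) ≫ t)) h₂

variable [PreservesFiniteLimits Ω] [PreservesFiniteColimits Ω]

instance epi_toSuspension (X : Stabilization Ω) : Epi (L.toSuspension X) :=
  epi_incl_map (L.μ.app X.obj)

theorem exists_desc_toSuspension (X : Stabilization Ω) {Z : Stabilization Ω} (k : L.K X ⟶ Z)
    (hk : L.inclι X ≫ k = 0) : ∃ l, L.toSuspension X ≫ l = k := by
  refine exists_desc_of_shortExact (L.shortExact X.obj) k ?_
  have h := (Category.assoc _ _ _).symm.trans hk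
  exact (cancel_epi ((next Ω X.deg (X.deg + 1) rfl).hom.app X.obj)).mp (h.trans comp_zero.symm)

theorem projective_K (X : Stabilization Ω) : Projective (L.K X) :=
  have := L.projective X.obj
  L.projective_incl _ _

theorem injective_K (X : Stabilization Ω) : Injective (L.K X) :=
  have := L.projective X.obj
  L.injective_incl _ _

variable {L} in
theorem Extends.projRel {X Y : Stabilization Ω} {f : X ⟶ Y}
    {t t' : (suspension Ω).obj X ⟶ (suspension Ω).obj Y} (h : L.Extends f t) (h' : L.Extends f t') :
    projRel _ t t' := by
  obtain ⟨a, e, e'⟩ := h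
  obtain ⟨b, k, k'⟩ := h'
  exact projRel_of_comp_eq (L.exists_desc_toSuspension X) (L.projective_K Y) (e.trans k.symm) e' k'

theorem exists_extends {X Y : Stabilization Ω} (f : X ⟶ Y) : ∃ t, L.Extends f t := by
  have := L.injective_K Y
  obtain ⟨a, ha⟩ := Injective.factors (f ≫ L.inclι Y) (L.inclι X)
  obtain ⟨t, ht⟩ := L.exists_desc_toSuspension X (a ≫ L.toSuspension Y) (by
    rw [reassoc_of% ha, inclι_toSuspension, comp_zero])
  exact ⟨t, a, ha, ht⟩

/-- Composing `t` with the morphism of `extends_next_inv` extends an identity, and right components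
of extensions are stably unique. Thus `t` is determined as a stable inverse of a known isomorphism,
without a construction of its own. -/
theorem extends_next (n m : ℤ) (h : n + 1 = m) (X : A)
    {t : (suspension Ω).obj ((incl Ω n).obj X) ⟶ (suspension Ω).obj ((incl Ω m).obj (Ω.obj X))}
    (ht : L.Extends ((next Ω n m h).hom.app X) t) :
    projRel _ t (-(suspension Ω).map ((next Ω n m h).hom.app X)) := by
  have h₁ := ht.comp (L.extends_next_inv n m h X)
  have h₂ : L.Extends ((next Ω n m h).hom.app X ≫ (next Ω n m h).inv.app X)
      (𝟙 ((suspension Ω).obj ((incl Ω n).obj X))) := by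
    have e : (next Ω n m h).hom.app X ≫ (next Ω n m h).inv.app X = 𝟙 _ :=
      ((next Ω n m h).app X).hom_inv_id
    rw [e]
    exact Extends.id L _
  have h₃ := HomRel.comp_right (r := Looped.projRel _)
    (-(suspension Ω).map ((next Ω n m h).hom.app X)) (h₁.projRel h₂)
  have e : (suspension Ω).map ((next Ω n m h).inv.app X) ≫
      (suspension Ω).map ((next Ω n m h).hom.app X) = 𝟙 _ :=
    ((suspension Ω).mapIso ((next Ω n m h).app X)).inv_hom_id
  refine cast (congrArg₂ (fun a b => Looped.projRel (Stabilization Ω) a b) ?_ (Category.id_comp _)) h₃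
  rw [Category.assoc, Preadditive.neg_comp_neg]
  exact (congrArg (t ≫ ·) e).trans (Category.comp_id _)

/-- Up to the sign given by the difference of the degrees, the morphism `Σ f` extends `f`. -/
theorem Extends.projRel_suspension {X Y : Stabilization Ω} {f : X ⟶ Y}
    {t : (suspension Ω).obj X ⟶ (suspension Ω).obj Y} (h : L.Extends f t) :
    Looped.projRel _ t (((Y.deg - X.deg).negOnePow : ℤ) • (suspension Ω).map f) := by
  induction f using hom_induction with
  | map n f =>
    change Looped.projRel _ t (((n - n).negOnePow : ℤ) • _)
    rw [sub_self, Int.negOnePow_zero, Units.val_one, one_smul]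
    exact h.projRel (L.extends_incl_map n f)
  | next n m hm X =>
    change Looped.projRel _ t (((m - n).negOnePow : ℤ) • _)
    rw [show m - n = 1 by omega, Int.negOnePow_one, Units.val_neg, Units.val_one, neg_smul, one_smul]
    exact L.extends_next n m hm X h
  | next_inv n m hm X =>
    change Looped.projRel _ t (((n - m).negOnePow : ℤ) • _)
    rw [show n - m = -1 by omega, Int.negOnePow_neg, Int.negOnePow_one, Units.val_neg, Units.val_one,
      neg_smul, one_smul]
    exact h.projRel (L.extends_next_inv n m hm X)
  | comp f g hf hg =>
    -- The sign is multiplicative because differences of degrees add along a composite.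
    obtain ⟨t₁, h₁⟩ := L.exists_extends f
    obtain ⟨t₂, h₂⟩ := L.exists_extends g
    refine congruence_projRel.equivalence.trans (h.projRel (h₁.comp h₂)) ?_
    refine cast (congrArg (Looped.projRel _ (t₁ ≫ t₂)) ?_) ((hf h₁).comp (hg h₂))
    rw [Preadditive.zsmul_comp, Preadditive.comp_zsmul, smul_smul, ← Units.val_mul,
      ← Int.negOnePow_add, ← Functor.map_comp]
    congr 3
    ring

end LoopStructure

/-! ### Comparison of the cosyzygy with the suspension. -/

namespace LoopStructure

open Stabilization

variable {A : Type u} [Category.{v} A] [Abelian A] {Ω : A ⥤ A} (L : LoopStructure Ω)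
  [Ω.Additive] [PreservesFiniteLimits Ω] [PreservesFiniteColimits Ω]

section

variable (hC : IsFrobeniusAbelian (Stabilization Ω))

theorem exists_fromCosyzygy (X : Stabilization Ω) :
    ∃ (t : hC.cosyzygy X ⟶ (suspension Ω).obj X) (a : hC.hull X ⟶ L.K X),
      hC.toHull X ≫ a = L.inclι X ∧ hC.fromHull X ≫ t = a ≫ L.toSuspension X := by
  have := hC.mono_toHull X
  have := L.injective_K X
  obtain ⟨a, ha⟩ := Injective.factors (L.inclι X) (hC.toHull X)
  obtain ⟨t, ht⟩ := hC.exists_desc (a ≫ L.toSuspension X) (by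
    rw [reassoc_of% ha, inclι_toSuspension])
  exact ⟨t, a, ha, ht⟩

/-- The morphism `T X ⟶ Σ X` induced by an extension `I X ⟶ K X` of the identity. -/
noncomputable def fromCosyzygy (X : Stabilization Ω) : hC.cosyzygy X ⟶ (suspension Ω).obj X :=
  (L.exists_fromCosyzygy hC X).choose

theorem fromCosyzygy_spec (X : Stabilization Ω) : ∃ (a : hC.hull X ⟶ L.K X),
    hC.toHull X ≫ a = L.inclι X ∧ hC.fromHull X ≫ L.fromCosyzygy hC X = a ≫ L.toSuspension X :=
  (L.exists_fromCosyzygy hC X).choose_spec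

theorem projective_hull (X : Stabilization Ω) : Projective (hC.hull X) :=
  (hC.projective_iff_injective _).mpr (hC.injective_hull X)

/-- Both `X ⟶ I X` and `X ⟶ K X` embed `X` into an injective object, so there are extensions of the
identity in both directions. Each composite extends an identity and hence is stably the identity on
the cokernel. -/
theorem isIso_fromCosyzygy (X : Stabilization Ω) :
    IsIso ((toStable (Stabilization Ω)).map (L.fromCosyzygy hC X)) := by
  obtain ⟨a, ha, ht⟩ := L.fromCosyzygy_spec hC X
  have := hC.injective_hull X
  have := hC.epi_fromHull X
  obtain ⟨b, hb⟩ := Injective.factors (hC.toHull X) (L.inclι X)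
  obtain ⟨s, hs⟩ := L.exists_desc_toSuspension X (b ≫ hC.fromHull X) (by
    rw [reassoc_of% hb, hC.toHull_fromHull])
  refine ⟨(toStable (Stabilization Ω)).map s, ?_, ?_⟩
  · rw [← Functor.map_comp, ← CategoryTheory.Functor.map_id, toStable_map_eq_iff]
    refine projRel_of_comp_eq (p := hC.fromHull X) (p' := hC.fromHull X)
      (fun k hk => hC.exists_desc k hk) (projective_hull hC X) (a := a ≫ b) (a' := 𝟙 _) ?_ ?_ ?_
    · rw [reassoc_of% ha, hb, Category.comp_id]
    · rw [reassoc_of% ht, hs, Category.assoc]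
    · rw [Category.comp_id, Category.id_comp]
  · rw [← Functor.map_comp, ← CategoryTheory.Functor.map_id, toStable_map_eq_iff]
    refine projRel_of_comp_eq (p := L.toSuspension X) (p' := L.toSuspension X)
      (L.exists_desc_toSuspension X) (L.projective_K X) (a := b ≫ a) (a' := 𝟙 _) ?_ ?_ ?_
    · rw [reassoc_of% hb, ha, Category.comp_id]
    · rw [reassoc_of% hs, ht, Category.assoc]
    · rw [Category.comp_id, Category.id_comp]

theorem fromCosyzygy_naturality {X Y : Stabilization Ω} (f : X ⟶ Y)
    {s : hC.cosyzygy X ⟶ hC.cosyzygy Y} {i : hC.hull X ⟶ hC.hull Y}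
    (hi : hC.toHull X ≫ i = f ≫ hC.toHull Y) (hs : hC.fromHull X ≫ s = i ≫ hC.fromHull Y)
    {t : (suspension Ω).obj X ⟶ (suspension Ω).obj Y} (ht : L.Extends f t) :
    projRel _ (s ≫ L.fromCosyzygy hC Y) (L.fromCosyzygy hC X ≫ t) := by
  obtain ⟨a, ha, ht'⟩ := L.fromCosyzygy_spec hC X
  obtain ⟨b, hb, hu⟩ := L.fromCosyzygy_spec hC Y
  obtain ⟨c, hc, hv⟩ := ht
  have := hC.epi_fromHull X
  refine projRel_of_comp_eq (p := hC.fromHull X) (p' := L.toSuspension Y)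
    (fun k hk => hC.exists_desc k hk) (L.projective_K Y) (a := i ≫ b) (a' := a ≫ c) ?_ ?_ ?_
  · rw [reassoc_of% hi, hb, reassoc_of% ha, hc]
  · rw [reassoc_of% hs, hu, Category.assoc]
  · rw [reassoc_of% ht', hv, Category.assoc]

/-- The morphism `T X ⟶ Σ X`, natural in the stable category. -/
noncomputable def shiftHom (X : Stabilization Ω) : hC.cosyzygy X ⟶ (suspension Ω).obj X :=
  ((X.deg + 1).negOnePow : ℤ) • L.fromCosyzygy hC X

/-- The factor `(-1) ^ (deg + 1)` absorbs the sign `(-1) ^ (Y.deg - X.deg)` of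
`Extends.projRel_suspension`. The parity of the degree is what naturality requires; the additional
`1` fixes the sign of the triangles. -/
theorem shiftHom_naturality {X Y : Stabilization Ω} (f : X ⟶ Y)
    {s : hC.cosyzygy X ⟶ hC.cosyzygy Y} {i : hC.hull X ⟶ hC.hull Y}
    (hi : hC.toHull X ≫ i = f ≫ hC.toHull Y) (hs : hC.fromHull X ≫ s = i ≫ hC.fromHull Y) :
    projRel _ (s ≫ L.shiftHom hC Y) (L.shiftHom hC X ≫ (suspension Ω).map f) := by
  obtain ⟨t, ht⟩ := L.exists_extends f
  have h₁ := L.fromCosyzygy_naturality hC f hi hs ht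
  have h₂ := projRel.comp (congruence_projRel.equivalence.refl (L.fromCosyzygy hC X))
    ht.projRel_suspension
  have h₃ := (congruence_projRel.equivalence.trans h₁ h₂).zsmul ((Y.deg + 1).negOnePow : ℤ)
  refine cast (congrArg₂ (fun a b => projRel (Stabilization Ω) a b) ?_ ?_) h₃
  · exact (Preadditive.comp_zsmul _ _ _).symm
  · unfold shiftHom
    rw [Preadditive.zsmul_comp, Preadditive.comp_zsmul, smul_smul, ← Units.val_mul,
      ← Int.negOnePow_add]
    congr 2
    rw [Int.negOnePow_eq_iff]
    -- The exponents `(Y.deg + 1) + (Y.deg - X.deg)` and `X.deg + 1` differ by twice this number.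
    exact ⟨Y.deg - X.deg, by ring⟩

theorem isIso_shiftHom (X : Stabilization Ω) :
    IsIso ((toStable (Stabilization Ω)).map (L.shiftHom hC X)) := by
  have h := L.isIso_fromCosyzygy hC X
  obtain ⟨s, hs, hs'⟩ := h
  obtain ⟨s, rfl⟩ := (toStable (Stabilization Ω)).map_surjective s
  rw [← Functor.map_comp, ← CategoryTheory.Functor.map_id, toStable_map_eq_iff] at hs hs'
  have e : (((X.deg + 1).negOnePow : ℤ) * ((X.deg + 1).negOnePow : ℤ)) = 1 := by
    rw [← Units.val_mul, Int.units_mul_self, Units.val_one]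
  refine ⟨(toStable (Stabilization Ω)).map (((X.deg + 1).negOnePow : ℤ) • s), ?_, ?_⟩
  · rw [← Functor.map_comp, ← CategoryTheory.Functor.map_id, toStable_map_eq_iff]
    unfold shiftHom
    rwa [Preadditive.zsmul_comp, Preadditive.comp_zsmul, smul_smul, e, one_smul]
  · rw [← Functor.map_comp, ← CategoryTheory.Functor.map_id, toStable_map_eq_iff]
    unfold shiftHom
    rwa [Preadditive.zsmul_comp, Preadditive.comp_zsmul, smul_smul, e, one_smul]

variable {D : Type u'} [Category.{v'} D] (F : Stabilization Ω ⥤ D)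
  (hF : ∀ {X Y : Stabilization Ω} (f g : X ⟶ Y), projRel _ f g → F.map f = F.map g)

include hF in
theorem isIso_map_shiftHom (X : Stabilization Ω) : IsIso (F.map (L.shiftHom hC X)) := by
  have := L.isIso_shiftHom hC X
  exact inferInstanceAs (IsIso ((stableLift F hF).map
    ((toStable (Stabilization Ω)).map (L.shiftHom hC X))))

/-- A functor which is compatible with the suspension of the stabilization induces a functor on the
stable category which is compatible with its canonical suspension. -/
noncomputable def stableComm {s : D ⥤ D} (c : suspension Ω ⋙ F ≅ F ⋙ s) :
    hC.stableShift ⋙ stableLift F hF ≅ stableLift F hF ⋙ s :=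
  NatIso.ofComponents
    (fun X =>
      @asIso _ _ _ _ (F.map (L.shiftHom hC X.as)) (L.isIso_map_shiftHom hC F hF X.as) ≪≫ c.app X.as)
    (by
      intro X Y f
      obtain ⟨f, rfl⟩ := (toStable _).map_surjective (X := X.as) (Y := Y.as) f
      obtain ⟨i, hi, hs⟩ := (hC.exists_extend f).choose_spec
      have h₁ := hF _ _ (L.shiftHom_naturality hC f hi hs)
      rw [Functor.map_comp, Functor.map_comp] at h₁
      have h₂ := c.hom.naturality f
      change F.map _ ≫ F.map (L.shiftHom hC Y.as) ≫ c.hom.app Y.as =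
        (F.map (L.shiftHom hC X.as) ≫ c.hom.app X.as) ≫ s.map (F.map f)
      rw [reassoc_of% h₁]
      exact (congrArg (_ ≫ ·) h₂).trans (Category.assoc _ _ _).symm)

end

/-- The third morphism of the triangle attached to a short exact sequence in `A`. -/
def connecting (p : ℤ) {X Z : A} (ω : Ω.obj Z ⟶ X) :
    (incl Ω p).obj Z ⟶ (suspension Ω).obj ((incl Ω p).obj X) :=
  (next Ω p (p + 1) rfl).hom.app Z ≫ (incl Ω (p + 1)).map ω

/-- The connecting morphism is determined, up to sign, by the embedding of `X` into `K X`. -/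
theorem projRel_connecting (p : ℤ) {S : ShortComplex A} (φ : L.G.obj S.X₃ ⟶ S.X₂)
    (ω : Ω.obj S.X₃ ⟶ S.X₁) (hφ : φ ≫ S.g = L.μ.app S.X₃) (hω : L.ι.app S.X₃ ≫ φ = ω ≫ S.f)
    (b : (incl Ω p).obj S.X₂ ⟶ L.K ((incl Ω p).obj S.X₁))
    (τ : (incl Ω p).obj S.X₃ ⟶ (suspension Ω).obj ((incl Ω p).obj S.X₁))
    (hb : (incl Ω p).map S.f ≫ b = L.inclι ((incl Ω p).obj S.X₁))
    (hτ : (incl Ω p).map S.g ≫ τ = b ≫ L.toSuspension ((incl Ω p).obj S.X₁)) :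
    projRel _ τ (-connecting p ω) := by
  -- One degree lower, the connecting morphism `h : (Z, q) ⟶ (X, q + 1)` is a morphism which `τ`
  -- extends, with `φ ≫ b` in the middle, and its suspension is the connecting morphism in degree
  -- `p`. The degrees of its ends differ by `1`, whence the minus sign.
  obtain ⟨q, rfl⟩ : ∃ q, p = q + 1 := ⟨p - 1, by omega⟩
  let h : (incl Ω q).obj S.X₃ ⟶ (incl Ω (q + 1)).obj S.X₁ := connecting q ω
  have e₁ : (incl Ω (q + 1)).map (L.ι.app S.X₃) ≫ (incl Ω (q + 1)).map φ ≫ b =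
      (incl Ω (q + 1)).map ω ≫ L.inclι ((incl Ω (q + 1)).obj S.X₁) := by
    rw [← hb, ← Functor.map_comp_assoc, ← Functor.map_comp_assoc, hω]
  have e₂ : (incl Ω (q + 1)).map (L.μ.app S.X₃) ≫ τ =
      ((incl Ω (q + 1)).map φ ≫ b) ≫ L.toSuspension ((incl Ω (q + 1)).obj S.X₁) := by
    rw [← hφ, Functor.map_comp, Category.assoc, hτ, Category.assoc]
  have hh : L.Extends h τ :=
    ⟨(incl Ω (q + 1)).map φ ≫ b, (Category.assoc _ _ _).trans
      ((congrArg (fun t => (next Ω q (q + 1) rfl).hom.app S.X₃ ≫ t) e₁).trans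
        (Category.assoc _ _ _).symm), e₂⟩
  have := hh.projRel_suspension
  have e : ((((incl Ω (q + 1)).obj S.X₁ : Stabilization Ω).deg -
      ((incl Ω q).obj S.X₃ : Stabilization Ω).deg).negOnePow : ℤ) = -1 := by
    change ((q + 1 - q).negOnePow : ℤ) = -1
    rw [show q + 1 - q = 1 by omega, Int.negOnePow_one, Units.val_neg, Units.val_one]
  rw [e, neg_smul, one_smul] at this
  refine cast (congrArg (fun a => projRel (Stabilization Ω) τ (-a)) ?_) this
  exact (suspension Ω).map_comp _ _

end LoopStructure

/-! ### Standard triangles and short exact sequences. -/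

namespace LoopStructure

open Stabilization

variable {A : Type u} [Category.{v} A] [Abelian A] {Ω : A ⥤ A} (L : LoopStructure Ω)
  [Ω.Additive] [PreservesFiniteLimits Ω] [PreservesFiniteColimits Ω]

/-- A cokernel of a monomorphism is isomorphic to the image of a short exact sequence in `A`. -/
theorem exists_shortExact_of_mono {X Y : Stabilization Ω} (u : X ⟶ Y) [Mono u] :
    ∃ (p : ℤ) (S : ShortComplex A) (_ : S.ShortExact) (α : X ≅ (incl Ω p).obj S.X₁)
      (β : Y ≅ (incl Ω p).obj S.X₂), u ≫ β.hom = α.hom ≫ (incl Ω p).map S.f := by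
  obtain ⟨p, X', Y', α, β, f, _, rfl⟩ := exists_mono_iso u
  exact ⟨p, _, shortExact_cokernel f, α, β, by simp⟩

/-- The pushout is the cokernel of `(u, j) : X ⟶ Y ⊞ I`, with projection `(v, -i)`. If `(u, j)` is
identified with the first map of `S`, then `Z` is identified with its third term. -/
theorem exists_iso_of_isPushout {X Y Z I : Stabilization Ω} {u : X ⟶ Y} {j : X ⟶ I} {i : I ⟶ Z}
    {v : Y ⟶ Z} (h : IsPushout j u i v) {p : ℤ} {S : ShortComplex A} (hS : S.ShortExact)
    (α : X ≅ (incl Ω p).obj S.X₁) (β : Y ⊞ I ≅ (incl Ω p).obj S.X₂)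
    (e : biprod.lift u j ≫ β.hom = α.hom ≫ (incl Ω p).map S.f) :
    ∃ γ : Z ≅ (incl Ω p).obj S.X₃,
      biprod.desc v (-i) ≫ γ.hom = β.hom ≫ (incl Ω p).map S.g := by
  have hz : (incl Ω p).map S.f ≫ (incl Ω p).map S.g = 0 := by
    rw [← Functor.map_comp, S.zero, Functor.map_zero]
  have hm : biprod.lift u j ≫ β.hom ≫ (incl Ω p).map S.g = 0 := by
    rw [reassoc_of% e, hz, comp_zero]
  set m := β.hom ≫ (incl Ω p).map S.g with hm'
  let c : Z ⟶ (incl Ω p).obj S.X₃ := h.desc (-(biprod.inr ≫ m)) (biprod.inl ≫ m) (by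
    rw [biprod.lift_eq, Preadditive.add_comp, Category.assoc, Category.assoc] at hm
    rw [Preadditive.comp_neg]
    exact (eq_neg_of_add_eq_zero_left hm).symm)
  have hc₁ : i ≫ c = -(biprod.inr ≫ m) := h.inl_desc _ _ _
  have hc₂ : v ≫ c = biprod.inl ≫ m := h.inr_desc _ _ _
  have hc : biprod.desc v (-i) ≫ c = m := by
    refine biprod.hom_ext' _ _ ?_ ?_
    · rw [biprod.inl_desc_assoc, hc₂]
    · rw [biprod.inr_desc_assoc, Preadditive.neg_comp, hc₁, neg_neg]
  obtain ⟨d, hd⟩ := exists_desc_of_shortExact hS (n := p) (β.inv ≫ biprod.desc v (-i)) (by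
    rw [← cancel_epi α.hom, ← reassoc_of% e, β.hom_inv_id_assoc, biprod.lift_desc,
      Preadditive.comp_neg, h.w, add_neg_cancel, comp_zero])
  have hmd : m ≫ d = biprod.desc v (-i) := by
    rw [hm', Category.assoc, hd, β.hom_inv_id_assoc]
  have := hS.epi_g
  refine ⟨⟨c, d, ?_, ?_⟩, hc⟩
  · refine h.hom_ext ?_ ?_
    · rw [reassoc_of% hc₁, Preadditive.neg_comp, Category.assoc, hmd, biprod.inr_desc, neg_neg,
        Category.comp_id]
    · rw [reassoc_of% hc₂, hmd, biprod.inl_desc, Category.comp_id]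
  · rw [← cancel_epi ((incl Ω p).map S.g), reassoc_of% hd, hc, hm', β.inv_hom_id_assoc,
      Category.comp_id]

/-- In the stable category, a projective summand can be omitted. -/
noncomputable def stableInl {C : Type u} [Category.{v} C] [Preadditive C] [HasZeroObject C]
    [HasBinaryBiproducts C] (Y : C) {I : C} (hI : Projective I) :
    (toStable C).obj Y ≅ (toStable C).obj (Y ⊞ I) where
  hom := (toStable C).map biprod.inl
  inv := (toStable C).map biprod.fst
  hom_inv_id := by rw [← Functor.map_comp, biprod.inl_fst, CategoryTheory.Functor.map_id]
  inv_hom_id := by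
    rw [← Functor.map_comp, ← CategoryTheory.Functor.map_id, toStable_map_eq_iff]
    refine ⟨I, hI, -biprod.snd, biprod.inr, ?_⟩
    rw [← biprod.total, Preadditive.neg_comp]
    abel

/-- Up to isomorphism in the stable category, a standard triangle is the triangle of a short exact
sequence in `A`. -/
theorem exists_shortExact_triangle (hC : IsFrobeniusAbelian (Stabilization Ω))
    {X Y Z : Stabilization Ω} {u : X ⟶ Y} {i : hC.hull X ⟶ Z} {v : Y ⟶ Z} {w : Z ⟶ hC.cosyzygy X}
    (h : IsPushout (hC.toHull X) u i v) (hi : i ≫ w = hC.fromHull X) (hv : v ≫ w = 0) :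
    ∃ (p : ℤ) (S : ShortComplex A) (φ : L.G.obj S.X₃ ⟶ S.X₂) (ω : Ω.obj S.X₃ ⟶ S.X₁)
      (α : X ≅ (incl Ω p).obj S.X₁)
      (β : (toStable _).obj Y ≅ (toStable _).obj ((incl Ω p).obj S.X₂))
      (γ : (toStable _).obj Z ≅ (toStable _).obj ((incl Ω p).obj S.X₃)),
      S.ShortExact ∧ φ ≫ S.g = L.μ.app S.X₃ ∧ L.ι.app S.X₃ ≫ φ = ω ≫ S.f ∧
      (toStable _).map u ≫ β.hom = (toStable _).map (α.hom ≫ (incl Ω p).map S.f) ∧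
      (toStable _).map v ≫ γ.hom = β.hom ≫ (toStable _).map ((incl Ω p).map S.g) ∧
      (toStable _).map (w ≫ L.shiftHom hC X ≫ (suspension Ω).map α.hom) =
        γ.hom ≫ (toStable _).map (((p + 1).negOnePow : ℤ) • connecting p ω) := by
  have := hC.mono_toHull X
  have hI := projective_hull hC X
  -- The morphism `u` itself need not be monic. Replacing `Y` by `Y ⊞ I X` makes it so and does not
  -- change the object of the stable category.
  have : Mono (biprod.lift u (hC.toHull X)) := by
    have : Mono (biprod.lift u (hC.toHull X) ≫ biprod.snd) := by rwa [biprod.lift_snd]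
    exact mono_of_mono _ biprod.snd
  obtain ⟨p, S, hS, α, β, e⟩ := exists_shortExact_of_mono (biprod.lift u (hC.toHull X))
  obtain ⟨γ, hγ⟩ := exists_iso_of_isPushout h hS α β e
  have := hS.epi_g
  have := hS.mono_f
  have := L.projective S.X₃
  let φ : L.G.obj S.X₃ ⟶ S.X₂ := Projective.factorThru (L.μ.app S.X₃) S.g
  have hφ : φ ≫ S.g = L.μ.app S.X₃ := Projective.factorThru_comp _ _
  have hφ' : (L.ι.app S.X₃ ≫ φ) ≫ S.g = 0 := by rw [Category.assoc, hφ, L.zero]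
  let ω : Ω.obj S.X₃ ⟶ S.X₁ := hS.exact.lift _ hφ'
  have hω : L.ι.app S.X₃ ≫ φ = ω ≫ S.f := (hS.exact.lift_f _ hφ').symm
  refine ⟨p, S, φ, ω, α, stableInl Y hI ≪≫ (toStable _).mapIso β, (toStable _).mapIso γ, hS, hφ, hω,
    ?_, ?_, ?_⟩
  · rw [← e]
    change (toStable _).map u ≫ (toStable _).map biprod.inl ≫ (toStable _).map β.hom = _
    rw [← Functor.map_comp, ← Functor.map_comp, toStable_map_eq_iff]
    refine ⟨_, hI, -hC.toHull X, biprod.inr ≫ β.hom, ?_⟩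
    rw [biprod.lift_eq, ← Category.assoc u, ← Preadditive.sub_comp, sub_add_cancel_left,
      Preadditive.neg_comp, Preadditive.neg_comp, Category.assoc]
  · change (toStable _).map v ≫ (toStable _).map γ.hom =
      ((toStable _).map biprod.inl ≫ (toStable _).map β.hom) ≫ _
    rw [← Functor.map_comp, ← Functor.map_comp, ← Functor.map_comp, Category.assoc, ← hγ,
      biprod.inl_desc_assoc]
  · change _ = (toStable _).map γ.hom ≫ _
    rw [← Functor.map_comp, toStable_map_eq_iff]
    obtain ⟨a, ha, ht⟩ := L.fromCosyzygy_spec hC X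
    obtain ⟨s, hs⟩ := L.exists_extends α.hom
    obtain ⟨b, hb, hb'⟩ := id hs
    -- The cokernel projection contains `-i`, so it is `-w` that corresponds to the projection of `I
    -- X`. This minus cancels the one in `projRel_connecting`.
    have hw : biprod.desc v (-i) ≫ (-w) = biprod.snd ≫ hC.fromHull X := by
      refine biprod.hom_ext' _ _ ?_ ?_
      · rw [biprod.inl_desc_assoc, Preadditive.comp_neg, hv, neg_zero, biprod.inl_snd_assoc,
          zero_comp]
      · rw [biprod.inr_desc_assoc, Preadditive.neg_comp_neg, hi, biprod.inr_snd_assoc]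
    have key := L.projRel_connecting p φ ω hφ hω (β.inv ≫ biprod.snd ≫ a ≫ b)
      (γ.inv ≫ (-w) ≫ L.fromCosyzygy hC X ≫ s)
      (by
        rw [← cancel_epi α.hom, ← reassoc_of% e, β.hom_inv_id_assoc, biprod.lift_snd_assoc,
          reassoc_of% ha, hb])
      (by
        have e' : (incl Ω p).map S.g ≫ γ.inv = β.inv ≫ biprod.desc v (-i) := by
          rw [Iso.comp_inv_eq, Category.assoc, hγ, β.inv_hom_id_assoc]
        rw [reassoc_of% e', reassoc_of% hw, reassoc_of% ht, hb']
        simp only [Category.assoc])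
    have key' := (congruence_projRel.comp_left γ.hom key.neg).zsmul ((p + 1).negOnePow : ℤ)
    rw [neg_neg] at key'
    have h₁ := (congruence_projRel.comp_left (w ≫ L.fromCosyzygy hC X) hs.projRel_suspension).zsmul
      ((p + 1).negOnePow : ℤ)
    have h₂ : ((p + 1).negOnePow : ℤ) • (w ≫ L.fromCosyzygy hC X) ≫
          (((((incl Ω p).obj S.X₁).deg - X.deg).negOnePow : ℤ) • (suspension Ω).map α.hom) =
        w ≫ L.shiftHom hC X ≫ (suspension Ω).map α.hom := by
      unfold shiftHom
      rw [Preadditive.comp_zsmul, smul_smul, ← Units.val_mul, ← Int.negOnePow_add,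
        Preadditive.zsmul_comp, Preadditive.comp_zsmul, Category.assoc]
      congr 2
      change (p + 1 + (p - X.deg)).negOnePow = _
      rw [Int.negOnePow_eq_iff]
      exact ⟨p - X.deg, by ring⟩
    have h₃ : ((p + 1).negOnePow : ℤ) • γ.hom ≫ (-γ.inv ≫ (-w) ≫ L.fromCosyzygy hC X ≫ s) =
        ((p + 1).negOnePow : ℤ) • (w ≫ L.fromCosyzygy hC X) ≫ s := by
      rw [Preadditive.comp_neg, γ.hom_inv_id_assoc, Preadditive.neg_comp, neg_neg, Category.assoc]
    rw [h₂] at h₁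
    rw [h₃] at key'
    rw [Preadditive.comp_zsmul]
    exact congruence_projRel.equivalence.trans (congruence_projRel.equivalence.symm h₁) key'

end LoopStructure

/-! ### Exactness of shifted triangles. -/

section ShiftExact

open Pretriangulated

variable {D : Type*} [Category* D] [HasZeroObject D] [HasShift D ℤ] [Preadditive D]
  [∀ n : ℤ, (shiftFunctor D n).Additive] [Pretriangulated D]

/-- A shifted triangle carries signs and a commutation isomorphism of shifts. They are absorbed into
`l`, so that only the bare exactness is left for later use. -/
theorem exists_desc_shift {T : Triangle D} (hT : T ∈ distTriang D) (n : ℤ) {W : D}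
    (k : T.obj₃⟦n⟧ ⟶ W) (hk : T.mor₂⟦n⟧' ≫ k = 0) :
    ∃ l : T.obj₁⟦(1 : ℤ)⟧⟦n⟧ ⟶ W, k = T.mor₃⟦n⟧' ≫ l := by
  obtain ⟨l, hl⟩ : ∃ l : (T.obj₁⟦n⟧)⟦(1 : ℤ)⟧ ⟶ W,
      k = (n.negOnePow • T.mor₃⟦n⟧' ≫ (shiftFunctorComm D 1 n).hom.app T.obj₁) ≫ l :=
    Triangle.yoneda_exact₃ _ (Triangle.shift_distinguished T hT n) k (by
      change (n.negOnePow • T.mor₂⟦n⟧') ≫ k = 0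
      rw [Linear.units_smul_comp, hk, smul_zero])
  refine ⟨n.negOnePow • (shiftFunctorComm D 1 n).hom.app T.obj₁ ≫ l, hl.trans ?_⟩
  rw [Linear.units_smul_comp, Linear.comp_units_smul]
  exact congrArg (n.negOnePow • ·) (Category.assoc _ _ _)

theorem exists_desc_shift' {T : Triangle D} (hT : T ∈ distTriang D) (n : ℤ) {W : D}
    (k : T.obj₁⟦(1 : ℤ)⟧⟦n⟧ ⟶ W) (hk : T.mor₃⟦n⟧' ≫ k = 0) :
    ∃ l : T.obj₂⟦(1 : ℤ)⟧⟦n⟧ ⟶ W, k = T.mor₁⟦(1 : ℤ)⟧'⟦n⟧' ≫ l := by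
  obtain ⟨l, hl⟩ : ∃ l : T.obj₂⟦(1 : ℤ)⟧⟦n⟧ ⟶ W, k = (-T.mor₁⟦(1 : ℤ)⟧')⟦n⟧' ≫ l :=
    exists_desc_shift (rot_of_distTriang _ hT) n k hk
  refine ⟨-l, hl.trans ?_⟩
  rw [Functor.map_neg, Preadditive.neg_comp, Preadditive.comp_neg]

end ShiftExact

open Pretriangulated in
/-- The properties of the bounded derived category `D` of `A` and of its subcategory `P` of perfect
complexes on which the description of the quotient `D / P` depends. -/
structure StalkFunctor (A : Type u) [Category.{v} A] [Abelian A] {D : Type u'} [Category.{v'} D]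
    [HasZeroObject D] [HasShift D ℤ] [Preadditive D] [∀ n : ℤ, (shiftFunctor D n).Additive]
    [Pretriangulated D] (P : ObjectProperty D) where
  /-- the functor sending an object to the complex concentrated in degree zero -/
  F : A ⥤ D
  full : F.Full
  faithful : F.Faithful
  additive : F.Additive
  /-- the connecting morphism of a short exact sequence -/
  δ : ∀ {S : ShortComplex A}, S.ShortExact → (F.obj S.X₃ ⟶ (F.obj S.X₁)⟦(1 : ℤ)⟧)
  distinguished : ∀ {S : ShortComplex A} (hS : S.ShortExact),
    Triangle.mk (F.map S.f) (F.map S.g) (δ hS) ∈ distTriang D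
  δ_naturality : ∀ {S S' : ShortComplex A} (hS : S.ShortExact) (hS' : S'.ShortExact) (f : S ⟶ S'),
    δ hS ≫ (F.map f.τ₁)⟦(1 : ℤ)⟧' = F.map f.τ₃ ≫ δ hS'
  mem_of_projective : ∀ Q : A, Projective Q → P (F.obj Q)
  hom_eq_zero : ∀ {Q Z : A}, Projective Q → ∀ n : ℤ, 0 < n →
    ∀ f : F.obj Q ⟶ (F.obj Z)⟦n⟧, f = 0
  exists_bound : ∀ K : D, P K → ∃ N : ℤ, ∀ i ≥ N, ∀ (Z : A) (f : K ⟶ (F.obj Z)⟦i⟧), f = 0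
  generates : ∀ Q : ObjectProperty D, (∀ X, Q (F.obj X)) → (∀ W (n : ℤ), Q W → Q (W⟦n⟧)) →
    (∀ W W' : D, (W ≅ W') → Q W → Q W') →
    (∀ T ∈ distTriang D, Q T.obj₁ → Q T.obj₃ → Q T.obj₂) → ∀ W, Q W

/-! ### Dimension shifting for stalk complexes. -/

namespace StalkFunctor

open Stabilization Pretriangulated

variable {A : Type u} [Category.{v} A] [Abelian A] {D : Type u'} [Category.{v'} D]
  [HasZeroObject D] [HasShift D ℤ] [Preadditive D] [∀ n : ℤ, (shiftFunctor D n).Additive]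
  [Pretriangulated D] {P : ObjectProperty D} (M : StalkFunctor A P)

instance : M.F.Full := M.full

instance : M.F.Faithful := M.faithful

instance : M.F.Additive := M.additive

/-- The functor sending an object to the complex concentrated in degree `-n`. -/
abbrev stalk (n : ℤ) : A ⥤ D := M.F ⋙ shiftFunctor D n

/-- After shifting back by `n`, the morphism lies in the extension group of `Q` by `Z` in positive
degree `p - n`. -/
theorem hom_stalk_eq_zero {Q Z : A} (hQ : Projective Q) {n p : ℤ} (h : n < p)
    (f : (M.stalk n).obj Q ⟶ (M.stalk p).obj Z) : f = 0 := by
  obtain ⟨g, hg⟩ := (shiftFunctor D n).map_surjective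
    (f ≫ (shiftFunctorAdd' D (p - n) n p (by omega)).hom.app (M.F.obj Z))
  rw [M.hom_eq_zero hQ (p - n) (by omega) g, Functor.map_zero] at hg
  have := congrArg (· ≫ (shiftFunctorAdd' D (p - n) n p (by omega)).inv.app (M.F.obj Z)) hg
  simpa using this.symm

variable {Ω : A ⥤ A} (L : LoopStructure Ω)

/-- The morphism `X[n] ⟶ (Ω X)[n + 1]`. -/
def step (n m : ℤ) (h : n + 1 = m) : M.stalk n ⟶ Ω ⋙ M.stalk m where
  -- The minus turns the sign `(-1) ^ (p + 1)` in the triangles of the stabilization into the sign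
  -- `(-1) ^ p` of a distinguished triangle shifted by `p`.
  app X := -((M.δ (L.shortExact X))⟦n⟧' ≫
    (shiftFunctorAdd' D 1 n m (by omega)).inv.app (M.F.obj (Ω.obj X)))
  naturality X Y f := by
    have h₁ : M.δ (L.shortExact X) ≫ (M.F.map (Ω.map f))⟦(1 : ℤ)⟧' =
        M.F.map f ≫ M.δ (L.shortExact Y) :=
      M.δ_naturality (L.shortExact X) (L.shortExact Y)
        { τ₁ := Ω.map f
          τ₂ := L.G.map f
          τ₃ := f
          comm₁₂ := L.ι.naturality f
          comm₂₃ := L.μ.naturality f }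
    have h₂ := (shiftFunctorAdd' D 1 n m (by omega)).inv.naturality (M.F.map (Ω.map f))
    have h₃ := congrArg (fun t => (shiftFunctor D n).map t) h₁
    dsimp only at h₃
    rw [Functor.map_comp, Functor.map_comp] at h₃
    change (M.F.map f)⟦n⟧' ≫ (-(_ ≫ _)) = (-(_ ≫ _)) ≫ (M.F.map (Ω.map f))⟦m⟧'
    rw [Preadditive.comp_neg, Preadditive.neg_comp, Category.assoc, ← reassoc_of% h₃]
    exact congrArg (fun t => -((M.δ (L.shortExact X))⟦n⟧' ≫ t)) h₂

theorem exists_eq_step_comp {n m : ℤ} (h : n + 1 = m) (X : A) {W : D} (k : (M.stalk n).obj X ⟶ W)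
    (hk : (M.stalk n).map (L.μ.app X) ≫ k = 0) :
    ∃ l : (M.stalk m).obj (Ω.obj X) ⟶ W, k = (M.step L n m h).app X ≫ l := by
  obtain ⟨l, hl⟩ : ∃ l : (M.F.obj (Ω.obj X))⟦(1 : ℤ)⟧⟦n⟧ ⟶ W,
      k = (M.δ (L.shortExact X))⟦n⟧' ≫ l :=
    exists_desc_shift (M.distinguished (L.shortExact X)) n k hk
  have h₁ : (shiftFunctorAdd' D 1 n m (by omega)).inv.app (M.F.obj (Ω.obj X)) ≫
      (shiftFunctorAdd' D 1 n m (by omega)).hom.app (M.F.obj (Ω.obj X)) ≫ l = l :=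
    Iso.inv_hom_id_app_assoc _ _ _
  have h₂ : (M.δ (L.shortExact X))⟦n⟧' ≫ l =
      (-((M.δ (L.shortExact X))⟦n⟧' ≫
        (shiftFunctorAdd' D 1 n m (by omega)).inv.app (M.F.obj (Ω.obj X)))) ≫
      (-((shiftFunctorAdd' D 1 n m (by omega)).hom.app (M.F.obj (Ω.obj X)) ≫ l)) := by
    rw [Preadditive.neg_comp_neg]
    exact (congrArg ((M.δ (L.shortExact X))⟦n⟧' ≫ ·) h₁.symm).trans (Category.assoc _ _ _).symm
  exact ⟨-((shiftFunctorAdd' D 1 n m (by omega)).hom.app (M.F.obj (Ω.obj X)) ≫ l), hl.trans h₂⟩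

theorem exists_eq_map_ι_comp {n m : ℤ} (h : n + 1 = m) (X : A) {W : D}
    (k : (M.stalk m).obj (Ω.obj X) ⟶ W) (hk : (M.step L n m h).app X ≫ k = 0) :
    ∃ l : (M.stalk m).obj (L.G.obj X) ⟶ W, k = (M.stalk m).map (L.ι.app X) ≫ l := by
  obtain ⟨l, hl⟩ := exists_desc_shift' (M.distinguished (L.shortExact X)) n
    ((shiftFunctorAdd' D 1 n m (by omega)).inv.app (M.F.obj (Ω.obj X)) ≫ k) (by
      change (-(_ ≫ _)) ≫ k = 0 at hk
      rwa [Preadditive.neg_comp, neg_eq_zero, Category.assoc] at hk)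
  refine ⟨(shiftFunctorAdd' D 1 n m (by omega)).hom.app (M.F.obj (L.G.obj X)) ≫ l, ?_⟩
  have h₁ := (shiftFunctorAdd' D 1 n m (by omega)).hom.naturality (M.F.map (L.ι.app X))
  have h₂ : k = (shiftFunctorAdd' D 1 n m (by omega)).hom.app (M.F.obj (Ω.obj X)) ≫
      (shiftFunctorAdd' D 1 n m (by omega)).inv.app (M.F.obj (Ω.obj X)) ≫ k :=
    (Iso.hom_inv_id_app_assoc (shiftFunctorAdd' D 1 n m (by omega)) (M.F.obj (Ω.obj X)) k).symm
  refine h₂.trans ((congrArg (_ ≫ ·) hl).trans ?_)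
  exact (Category.assoc _ _ _).symm.trans ((congrArg (· ≫ l) h₁.symm).trans (Category.assoc _ _ _))

/-- The composites `X[n] ⟶ (Ω ^ a X)[n + a]`. -/
abbrev steps (n : ℤ) (a : ℕ) (p : ℤ) (h : n + a = p) : M.stalk n ⟶ iter Ω a ⋙ M.stalk p :=
  iterHom M.stalk (M.step L) n a p h

/-- The obstruction to passing one step further is a morphism from some `(G Y)[r]` to `Z[p]` with `r
< p`, which vanishes as `G Y` is projective. Hence a morphism can be moved all the way up to the
degree of its target. -/
theorem exists_eq_steps_comp (a : ℕ) {n q p : ℤ} (h : n + a = q) (hq : q ≤ p) {X Z : A}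
    (k : (M.stalk n).obj X ⟶ (M.stalk p).obj Z) :
    ∃ l : (M.stalk q).obj ((iter Ω a).obj X) ⟶ (M.stalk p).obj Z,
      k = (M.steps L n a q h).app X ≫ l := by
  induction a generalizing q with
  | zero =>
    obtain rfl : n = q := by simpa using h
    exact ⟨k, (Category.id_comp k).symm⟩
  | succ a ih =>
    obtain ⟨l, hl⟩ := ih (q := n + a) rfl (by push_cast at h; omega)
    have h' : n + a + 1 = q := by push_cast at h; omega
    have hQ := L.projective ((iter Ω a).obj X)
    obtain ⟨l', hl'⟩ := M.exists_eq_step_comp L h' ((iter Ω a).obj X) l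
      (M.hom_stalk_eq_zero hQ (by omega) _)
    refine ⟨l', ?_⟩
    rw [hl, hl']
    exact (Category.assoc _ _ _).symm.trans (congrArg (· ≫ l')
      (iterHom_succ_app M.stalk (M.step L) n a (n + a) q rfl h' h X).symm)

/-- By exactness the morphism factors through some `(G Y)[q]`, and nothing leads from there to
`Z[p]` because `q < p`. For `q = p` this last group need not vanish, and only the factorisation in
`factors_of_steps_comp` is left. -/
theorem eq_zero_of_steps_comp (a : ℕ) {n q p : ℤ} (h : n + a = q) (hq : q < p) {X Z : A}
    (k : (M.stalk q).obj ((iter Ω a).obj X) ⟶ (M.stalk p).obj Z)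
    (hk : (M.steps L n a q h).app X ≫ k = 0) : k = 0 := by
  induction a generalizing q with
  | zero =>
    obtain rfl : n = q := by simpa using h
    exact (Category.id_comp k).symm.trans hk
  | succ a ih =>
    have h' : n + a + 1 = q := by push_cast at h; omega
    have e := iterHom_succ_app M.stalk (M.step L) n a (n + a) q rfl h' h X
    have hQ := L.projective ((iter Ω a).obj X)
    obtain ⟨l, hl⟩ := M.exists_eq_map_ι_comp L h' ((iter Ω a).obj X) k
      (ih (q := n + a) rfl (by omega) _ (((Category.assoc _ _ _).symm.trans
        (congrArg (· ≫ k) e.symm)).trans hk))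
    rw [M.hom_stalk_eq_zero hQ hq l] at hl
    exact hl.trans comp_zero

theorem exists_stalk_map_eq (p : ℤ) {X Z : A} (k : (M.stalk p).obj X ⟶ (M.stalk p).obj Z) :
    ∃ f : X ⟶ Z, (M.stalk p).map f = k :=
  (M.stalk p).map_surjective k

/-- A morphism which is killed by the iterated connecting morphism factors through a projective
object. -/
theorem factors_of_steps_comp (a : ℕ) {n p : ℤ} (h : n + (a + 1 : ℕ) = p) {X Z : A}
    (f : (iter Ω (a + 1)).obj X ⟶ Z)
    (hf : (M.steps L n (a + 1) p h).app X ≫ (M.stalk p).map f = 0) :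
    ∃ l, f = L.ι.app ((iter Ω a).obj X) ≫ l := by
  have h' : n + a + 1 = p := by push_cast at h; omega
  have e := iterHom_succ_app M.stalk (M.step L) n a (n + a) p rfl h' h X
  obtain ⟨l, hl⟩ := M.exists_eq_map_ι_comp L h' ((iter Ω a).obj X) ((M.stalk p).map f)
    (M.eq_zero_of_steps_comp L a rfl (by omega) _ (((Category.assoc _ _ _).symm.trans
      (congrArg (· ≫ (M.stalk p).map f) e.symm)).trans hf))
  obtain ⟨l, rfl⟩ := M.exists_stalk_map_eq p l
  refine ⟨l, (M.stalk p).map_injective (hl.trans (Functor.map_comp _ _ _).symm)⟩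

/-- A morphism whose cone is perfect becomes a split monomorphism after composing with iterated
connecting morphisms. -/
theorem exists_comp_eq_steps [P.IsStableUnderShift ℤ] {m : ℤ} {Y : A} {W : D}
    (s : (M.stalk m).obj Y ⟶ W) (hs : P.trW s) :
    ∃ N : ℤ, ∀ (l : ℕ) (p : ℤ) (h : m + l = p), N ≤ p →
      ∃ t : W ⟶ (M.stalk p).obj ((iter Ω l).obj Y), s ≫ t = (M.steps L m l p h).app Y := by
  obtain ⟨K, f, g, hT, hK⟩ := (P.trW_iff' s).mp hs
  -- The iterated connecting morphism extends along `s` once its restriction to the perfect object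
  -- `K` vanishes, which is automatic when the target is shifted by at least `N`.
  obtain ⟨N, hN⟩ := M.exists_bound K hK
  refine ⟨N, fun l p h hp => ?_⟩
  obtain ⟨t, ht⟩ := Triangle.yoneda_exact₂ _ hT ((M.steps L m l p h).app Y)
    (hN p hp _ (f ≫ (M.steps L m l p h).app Y))
  exact ⟨t, ht.symm⟩

end StalkFunctor

namespace Stabilization

variable {C : Type u} [Category.{v} C] [Abelian C] {Ω : C ⥤ C} [Ω.Additive]
  {D : Type u'} [Category.{v'} D] [Preadditive D] (F : ℤ → C ⥤ D)
  (σ : ∀ n m : ℤ, n + 1 = m → (F n ⟶ Ω ⋙ F m)) (hσ : ∀ n m h, IsIso (σ n m h))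

theorem lift_additive [∀ n, (F n).Additive] : (lift F σ hσ).Additive where
  map_add {X Y u v} := by
    obtain ⟨p, X', Y', α, β, f, g, rfl, rfl⟩ := exists_stage_pair u v
    have h : (lift F σ hσ).map ((incl Ω p).map f + (incl Ω p).map g) =
        (lift F σ hσ).map ((incl Ω p).map f) + (lift F σ hσ).map ((incl Ω p).map g) :=
      (congrArg (fun t => (lift F σ hσ).map t) (incl Ω p).map_add.symm).trans
        ((lift_map_incl_map F σ hσ p (f + g)).trans ((F p).map_add.trans
          (congrArg₂ (· + ·) (lift_map_incl_map F σ hσ p f) (lift_map_incl_map F σ hσ p g)).symm))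
    rw [← Preadditive.comp_add, ← Preadditive.add_comp]
    simp only [Functor.map_comp, h]
    rw [Preadditive.add_comp, Preadditive.comp_add]

end Stabilization

/-! ### The functor from the stabilization to the Verdier quotient. -/

namespace StalkFunctor

open Stabilization Pretriangulated

variable {A : Type u} [Category.{v} A] [Abelian A] {D : Type u'} [Category.{v'} D]
  [HasZeroObject D] [HasShift D ℤ] [Preadditive D] [∀ n : ℤ, (shiftFunctor D n).Additive]
  [Pretriangulated D] {P : ObjectProperty D} (M : StalkFunctor A P)
  {Ω : A ⥤ A} (L : LoopStructure Ω) [P.IsTriangulated]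

/-- Rotating the triangle of the presentation twice shows that the cone of the connecting morphism
is `(G X)[1]`. -/
theorem trW_δ (X : A) : P.trW (M.δ (L.shortExact X)) := by
  have h := rot_of_distTriang _ (rot_of_distTriang _ (M.distinguished (L.shortExact X)))
  exact ObjectProperty.trW.mk P h (P.le_shift (1 : ℤ) _ (M.mem_of_projective _ (L.projective X)))

theorem trW_step (n m : ℤ) (h : n + 1 = m) (X : A) : P.trW ((M.step L n m h).app X) := by
  have h₁ := (M.trW_δ L X).shift (P := P) n
  have h₂ : P.trW ((M.δ (L.shortExact X))⟦n⟧' ≫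
      (shiftFunctorAdd' D 1 n m (by omega)).inv.app (M.F.obj (Ω.obj X))) :=
    (MorphismProperty.cancel_right_of_respectsIso _ _ _).mpr h₁
  have h₃ := (ObjectProperty.smul_mem_trW_iff P _ (-1)).mpr h₂
  rw [Units.neg_smul, one_smul] at h₃
  exact h₃

variable {T : Type*} [Category* T] (Loc : D ⥤ T) [Loc.IsLocalization P.trW]

/-- The functor from the stabilization to the quotient category which sends `(X, n)` to `X[n]`. -/
noncomputable def quotientFunctor : Stabilization Ω ⥤ T :=
  lift (fun n => M.stalk n ⋙ Loc) (fun n m h => Functor.whiskerRight (M.step L n m h) Loc)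
    (fun n m h => by
      have (X : A) : IsIso ((Functor.whiskerRight (M.step L n m h) Loc).app X) :=
        Localization.inverts Loc P.trW _ (M.trW_step L n m h X)
      exact NatIso.isIso_of_isIso_app _)

theorem quotientFunctor_map_incl_map (n : ℤ) {X Y : A} (f : X ⟶ Y) :
    (M.quotientFunctor L Loc).map ((incl Ω n).map f) = Loc.map ((M.stalk n).map f) :=
  lift_map_incl_map _ _ _ n f

theorem iterHom_whiskerRight (n : ℤ) (a : ℕ) (p : ℤ) (h : n + a = p) (X : A) :
    (iterHom (fun n => M.stalk n ⋙ Loc) (fun n m h => Functor.whiskerRight (M.step L n m h) Loc)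
      n a p h).app X = Loc.map ((M.steps L n a p h).app X) := by
  induction a generalizing p with
  | zero =>
    obtain rfl : n = p := by simpa using h
    exact (CategoryTheory.Functor.map_id Loc _).symm
  | succ a ih =>
    have h' : n + a + 1 = p := by push_cast at h; omega
    have e := iterHom_succ_app M.stalk (M.step L) n a (n + a) p rfl h' h X
    refine (iterHom_succ_app _ _ n a (n + a) p rfl h' h X).trans ?_
    rw [ih (n + a) rfl]
    exact (Loc.map_comp _ _).symm.trans (congrArg (fun t => Loc.map t) e.symm)

theorem quotientFunctor_map_nextIter (a : ℕ) (n p : ℤ) (h : n + a = p) (X : A) :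
    (M.quotientFunctor L Loc).map ((nextIter Ω a n p h).hom.app X) =
      Loc.map ((M.steps L n a p h).app X) :=
  (lift_map_nextIter _ _ _ a n p h X).trans (M.iterHom_whiskerRight L Loc n a p h X)

theorem quotientFunctor_map_next (n m : ℤ) (h : n + 1 = m) (X : A) :
    (M.quotientFunctor L Loc).map ((next Ω n m h).hom.app X) = Loc.map ((M.step L n m h).app X) :=
  lift_map_next _ _ _ n m h X

section Triangulated

variable [Ω.Additive] [PreservesFiniteLimits Ω] [PreservesFiniteColimits Ω]
  [IsTriangulated D]

/-- At a common stage, equality in the quotient means equality in `D` after some `s` with perfect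
cone. As `s` divides an iterated connecting morphism, naturality shows that `Ω ^ k f - Ω ^ k g` is
killed by the iterated connecting morphism of its source, hence factors through a projective object.
-/
theorem projRel_of_quotientFunctor_map_eq {X Y : Stabilization Ω} (u v : X ⟶ Y)
    (h : (M.quotientFunctor L Loc).map u = (M.quotientFunctor L Loc).map v) :
    projRel (Stabilization Ω) u v := by
  obtain ⟨p, X', Y', α, β, f, g, rfl, rfl⟩ := exists_stage_pair u v
  rw [map_iso_conj_eq_iff] at h
  replace h : Loc.map ((M.stalk p).map f) = Loc.map ((M.stalk p).map g) :=
    (M.quotientFunctor_map_incl_map L Loc p f).symm.trans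
      (h.trans (M.quotientFunctor_map_incl_map L Loc p g))
  rw [MorphismProperty.map_eq_iff_postcomp Loc P.trW] at h
  rw [projRel_iso_conj, L.projRel_incl_map_iff]
  obtain ⟨W, s, hs, h⟩ := h
  obtain ⟨N, hN⟩ := M.exists_comp_eq_steps L s hs
  -- The additional step makes the number of steps positive, as `factors_of_steps_comp` requires.
  obtain ⟨t, ht⟩ := hN ((N - p).toNat + 1) _ rfl (by push_cast; omega)
  refine ⟨(N - p).toNat + 1, ?_⟩
  set S := M.steps L p ((N - p).toNat + 1) _ rfl
  have e : (M.stalk p).map f ≫ S.app Y' = (M.stalk p).map g ≫ S.app Y' := by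
    rw [← ht, ← Category.assoc, h, Category.assoc]
  have e' : S.app X' ≫ (M.stalk _).map ((iter Ω ((N - p).toNat + 1)).map f) =
      S.app X' ≫ (M.stalk _).map ((iter Ω ((N - p).toNat + 1)).map g) :=
    (S.naturality f).symm.trans (e.trans (S.naturality g))
  obtain ⟨l, hl⟩ := M.factors_of_steps_comp L _ rfl ((iter Ω ((N - p).toNat + 1)).map f -
    (iter Ω ((N - p).toNat + 1)).map g) (by
      rw [Functor.map_sub]
      exact (Preadditive.comp_sub _ _ _).trans (sub_eq_zero.mpr e'))
  exact ⟨_, L.projective _, _, l, hl⟩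

/-- Write the morphism as a left fraction. The denominator becomes an iterated connecting morphism
after composition with some `t`, so the target moves to degree `p`; dimension shifting moves the
source to degree `p` as well. Between stalks of equal degree every morphism comes from `A`. -/
instance quotientFunctor_full : (M.quotientFunctor L Loc).Full where
  map_surjective {X Y} φ := by
    obtain ⟨X, n⟩ := X
    obtain ⟨Y, m⟩ := Y
    obtain ⟨φ, rfl⟩ : ∃ ψ : Loc.obj ((M.stalk n).obj X) ⟶ Loc.obj ((M.stalk m).obj Y), ψ = φ :=
      ⟨φ, rfl⟩
    obtain ⟨z, hz⟩ := Localization.exists_leftFraction Loc P.trW φ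
    have := Localization.inverts Loc P.trW z.s z.hs
    obtain ⟨N, hN⟩ := M.exists_comp_eq_steps L z.s z.hs
    -- The stage must lie beyond the bound of the denominator and beyond both degrees.
    set p := max N (max n m)
    have hn : n + ((p - n).toNat : ℤ) = p := by omega
    have hm : m + ((p - m).toNat : ℤ) = p := by omega
    obtain ⟨t, ht⟩ := hN _ p hm (by omega)
    obtain ⟨l, hl⟩ := M.exists_eq_steps_comp L (p - n).toNat hn le_rfl (z.f ≫ t)
    obtain ⟨f, rfl⟩ := M.exists_stalk_map_eq p l
    refine ⟨(nextIter Ω (p - n).toNat n p hn).hom.app X ≫ (incl Ω p).map f ≫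
      (nextIter Ω (p - m).toNat m p hm).inv.app Y, ?_⟩
    have h₁ : φ ≫ Loc.map z.s = Loc.map z.f := by
      rw [hz]
      exact z.map_comp_map_s _ _
    have h₂ : φ ≫ Loc.map ((M.steps L m (p - m).toNat p hm).app Y) =
        Loc.map ((M.steps L n (p - n).toNat p hn).app X) ≫ Loc.map ((M.stalk p).map f) := by
      rw [← ht, Functor.map_comp, reassoc_of% h₁, ← Functor.map_comp, ← Functor.map_comp, hl]
    obtain ⟨c, hc⟩ : ∃ c : Loc.obj ((M.stalk p).obj ((iter Ω (p - m).toNat).obj Y)) ⟶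
        Loc.obj ((M.stalk m).obj Y),
        c = (M.quotientFunctor L Loc).map ((nextIter Ω (p - m).toNat m p hm).inv.app Y) := ⟨_, rfl⟩
    have h₃ : Loc.map ((M.steps L m (p - m).toNat p hm).app Y) ≫ c = 𝟙 _ := by
      rw [hc]
      refine (congrArg (· ≫ _) (M.quotientFunctor_map_nextIter L Loc _ _ _ hm Y)).symm.trans ?_
      exact ((M.quotientFunctor L Loc).mapIso
        ((nextIter Ω (p - m).toNat m p hm).app Y)).hom_inv_id
    have h₄ : Loc.map ((M.steps L n (p - n).toNat p hn).app X) ≫ Loc.map ((M.stalk p).map f) ≫ c =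
        φ := by
      rw [← Category.assoc, ← h₂, Category.assoc, h₃, Category.comp_id]
    refine ((Functor.map_comp _ _ _).trans (congrArg₂ (· ≫ ·)
      (M.quotientFunctor_map_nextIter L Loc _ _ _ hn X) ((Functor.map_comp _ _ _).trans
        (congrArg₂ (· ≫ ·) (M.quotientFunctor_map_incl_map L Loc p f) hc.symm)))).trans h₄

variable [HasZeroObject T] [HasShift T ℤ] [Preadditive T]
  [∀ n : ℤ, (shiftFunctor T n).Additive] [Pretriangulated T] [Loc.CommShift ℤ] [Loc.IsTriangulated]

instance quotientFunctor_additive : (M.quotientFunctor L Loc).Additive :=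
  lift_additive _ _ _

omit L in
theorem isZero_of_projective {Q : A} (hQ : Projective Q) (n : ℤ) :
    IsZero (Loc.obj ((M.stalk n).obj Q)) := by
  have h := ObjectProperty.trW.mk' P (contractible_distinguished ((M.stalk n).obj Q))
    (P.le_shift n _ (M.mem_of_projective Q hQ))
  have := Localization.inverts Loc P.trW _ h
  exact (Loc.map_isZero (isZero_zero D)).of_iso (@asIso _ _ _ _ _ this)

/-- At a late stage the difference factors through a projective object of `A`, whose stalks are
perfect and so vanish in the quotient. -/
theorem quotientFunctor_map_eq {X Y : Stabilization Ω} (u v : X ⟶ Y)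
    (h : projRel (Stabilization Ω) u v) :
    (M.quotientFunctor L Loc).map u = (M.quotientFunctor L Loc).map v := by
  obtain ⟨p, X', Y', α, β, f, g, rfl, rfl⟩ := exists_stage_pair u v
  rw [projRel_iso_conj, L.projRel_incl_map_iff] at h
  rw [map_iso_conj_eq_iff]
  obtain ⟨k, Q, hQ, a, b, h⟩ := h
  have e := nextIter_conj (Ω := Ω) k p _ rfl f
  have e' := nextIter_conj (Ω := Ω) k p _ rfl g
  have h₁ : (M.quotientFunctor L Loc).map ((incl Ω (p + k)).map ((iter Ω k).map f)) =
      (M.quotientFunctor L Loc).map ((incl Ω (p + k)).map ((iter Ω k).map g)) := by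
    rw [← sub_eq_zero, ← Functor.map_sub, ← Functor.map_sub, h]
    refine (M.quotientFunctor_map_incl_map L Loc _ _).trans ?_
    rw [Functor.map_comp, Functor.map_comp,
      (M.isZero_of_projective Loc hQ _).eq_of_tgt (Loc.map ((M.stalk (p + k)).map a)) 0, zero_comp]
    rfl
  rw [e, e']
  simp only [Functor.map_comp]
  exact congrArg (fun t => _ ≫ t ≫ _) h₁

end Triangulated

end StalkFunctor

/-! ### Isomorphisms of triangles and their transport along functors. -/

section TriangleIso

variable {T : Type u} [Category.{v} T] {F : T ⥤ T} {X Y Z X₂ Y₂ Z₂ X₃ Y₃ Z₃ : T}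
  {f : X ⟶ Y} {g : Y ⟶ Z} {h : Z ⟶ F.obj X} {f₂ : X₂ ⟶ Y₂} {g₂ : Y₂ ⟶ Z₂} {h₂ : Z₂ ⟶ F.obj X₂}
  {f₃ : X₃ ⟶ Y₃} {g₃ : Y₃ ⟶ Z₃} {h₃ : Z₃ ⟶ F.obj X₃}

theorem TriangleIso.refl (f : X ⟶ Y) (g : Y ⟶ Z) (h : Z ⟶ F.obj X) : TriangleIso F f g h f g h :=
  ⟨Iso.refl _, Iso.refl _, Iso.refl _, by simp, by simp, by simp⟩

theorem TriangleIso.trans (t : TriangleIso F f g h f₂ g₂ h₂)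
    (t' : TriangleIso F f₂ g₂ h₂ f₃ g₃ h₃) : TriangleIso F f g h f₃ g₃ h₃ := by
  obtain ⟨a, b, c, e₁, e₂, e₃⟩ := t
  obtain ⟨a', b', c', e₁', e₂', e₃'⟩ := t'
  refine ⟨a ≪≫ a', b ≪≫ b', c ≪≫ c', ?_, ?_, ?_⟩
  · rw [Iso.trans_hom, Iso.trans_hom, reassoc_of% e₁, e₁', Category.assoc]
  · rw [Iso.trans_hom, Iso.trans_hom, reassoc_of% e₂, e₂', Category.assoc]
  · rw [Iso.trans_hom, Iso.trans_hom, F.map_comp, reassoc_of% e₃, e₃', Category.assoc]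

variable {T₂ : Type u'} [Category.{v'} T₂] {G : T ⥤ T₂} {F₂ : T₂ ⥤ T₂} (K : F ⋙ G ≅ G ⋙ F₂)

theorem TriangleIso.map (t : TriangleIso F f g h f₂ g₂ h₂) :
    TriangleIso F₂ (G.map f) (G.map g) (G.map h ≫ K.hom.app X)
      (G.map f₂) (G.map g₂) (G.map h₂ ≫ K.hom.app X₂) := by
  obtain ⟨a, b, c, e₁, e₂, e₃⟩ := t
  refine ⟨G.mapIso a, G.mapIso b, G.mapIso c, ?_, ?_, ?_⟩
  · rw [Functor.mapIso_hom, Functor.mapIso_hom, ← G.map_comp, e₁, G.map_comp]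
  · rw [Functor.mapIso_hom, Functor.mapIso_hom, ← G.map_comp, e₂, G.map_comp]
  · have := K.hom.naturality a.hom
    rw [Functor.mapIso_hom, Functor.mapIso_hom, Category.assoc, ← Functor.comp_map, ← this,
      Functor.comp_map, ← Category.assoc, ← G.map_comp, e₃, G.map_comp, Category.assoc]

theorem TriangleIso.of_map [G.Full] [G.Faithful]
    (t : TriangleIso F₂ (G.map f) (G.map g) (G.map h ≫ K.hom.app X)
      (G.map f₂) (G.map g₂) (G.map h₂ ≫ K.hom.app X₂)) : TriangleIso F f g h f₂ g₂ h₂ := by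
  obtain ⟨a, b, c, e₁, e₂, e₃⟩ := t
  refine ⟨G.preimageIso a, G.preimageIso b, G.preimageIso c, ?_, ?_, ?_⟩
  · apply G.map_injective
    simpa using e₁
  · apply G.map_injective
    simpa using e₂
  · apply G.map_injective
    have := K.hom.naturality (G.preimageIso a).hom
    rw [← cancel_mono (K.hom.app X₂), G.map_comp, Category.assoc, ← Functor.comp_map, this,
      Functor.comp_map, ← Category.assoc]
    simpa using e₃

end TriangleIso

namespace IsFrobeniusAbelian

variable {C : Type u} [Category.{v} C] [Preadditive C] [HasZeroObject C] [HasBinaryBiproducts C]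
  (hC : IsFrobeniusAbelian C)

theorem triangles_dist_of_iso {X Y Z X₂ Y₂ Z₂ : StableCategory C} {f : X ⟶ Y} {g : Y ⟶ Z}
    {h : Z ⟶ hC.stableShift.obj X} {f₂ : X₂ ⟶ Y₂} {g₂ : Y₂ ⟶ Z₂}
    {h₂ : Z₂ ⟶ hC.stableShift.obj X₂} (t : TriangleIso hC.stableShift f g h f₂ g₂ h₂)
    (d : hC.triangles.dist f₂ g₂ h₂) : hC.triangles.dist f g h := by
  obtain ⟨X', Y', Z', u, v, i, w, h₁, h₂, h₃, e⟩ := d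
  exact ⟨X', Y', Z', u, v, i, w, h₁, h₂, h₃, t.trans e⟩

theorem exists_triangle [HasPushouts C] {X Y : StableCategory C} (f : X ⟶ Y) :
    ∃ (Z : StableCategory C) (g : Y ⟶ Z) (h : Z ⟶ hC.stableShift.obj X),
      hC.triangles.dist f g h := by
  obtain ⟨u, rfl⟩ : ∃ u : X.as ⟶ Y.as, (toStable C).map u = f := (toStable C).map_surjective f
  have hp := IsPushout.of_hasPushout (hC.toHull X.as) u
  refine ⟨_, (toStable C).map (pushout.inr (hC.toHull X.as) u), (toStable C).map
    (pushout.desc (hC.fromHull X.as) 0 (by rw [hC.toHull_fromHull, comp_zero])),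
    X.as, Y.as, _, u, _, _, _, hp, ?_, ?_, TriangleIso.refl _ _ _⟩
  · exact pushout.inl_desc _ _ _
  · exact pushout.inr_desc _ _ _

end IsFrobeniusAbelian

namespace LoopStructure

open Stabilization

variable {A : Type u} [Category.{v} A] [Abelian A] {Ω : A ⥤ A} (L : LoopStructure Ω)
  [Ω.Additive] [PreservesFiniteLimits Ω] [PreservesFiniteColimits Ω]
  (hC : IsFrobeniusAbelian (Stabilization Ω)) {D : Type u'} [Category.{v'} D]
  (F : Stabilization Ω ⥤ D)
  (hF : ∀ {X Y : Stabilization Ω} (f g : X ⟶ Y), projRel _ f g → F.map f = F.map g)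
  {s : D ⥤ D} (c : suspension Ω ⋙ F ≅ F ⋙ s)

/-- The third morphism of the standard triangle given by a short exact sequence in `A`. -/
abbrev thirdHom (p : ℤ) {X Z : A} (ω : Ω.obj Z ⟶ X) :
    (incl Ω p).obj Z ⟶ (suspension Ω).obj ((incl Ω p).obj X) :=
  ((p + 1).negOnePow : ℤ) • connecting p ω

/-- The target of `F` is arbitrary, since the result serves both the Verdier quotient and the
stabilization of the stable category. In each case only the images of triangles of short exact
sequences remain to be recognised. -/
theorem exists_triangleIso_of_dist {X Y Z : StableCategory (Stabilization Ω)} {f : X ⟶ Y}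
    {g : Y ⟶ Z} {h : Z ⟶ hC.stableShift.obj X} (d : hC.triangles.dist f g h) :
    ∃ (p : ℤ) (S : ShortComplex A) (φ : L.G.obj S.X₃ ⟶ S.X₂) (ω : Ω.obj S.X₃ ⟶ S.X₁),
      S.ShortExact ∧ φ ≫ S.g = L.μ.app S.X₃ ∧ L.ι.app S.X₃ ≫ φ = ω ≫ S.f ∧
      TriangleIso s ((stableLift F hF).map f) ((stableLift F hF).map g)
        ((stableLift F hF).map h ≫ (L.stableComm hC F hF c).hom.app X)
        (F.map ((incl Ω p).map S.f)) (F.map ((incl Ω p).map S.g))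
        (F.map (thirdHom p ω) ≫ c.hom.app ((incl Ω p).obj S.X₁)) := by
  obtain ⟨X', Y', Z', u, v, i, w, h₁, h₂, h₃, e⟩ := d
  obtain ⟨p, S, φ, ω, α, β, γ, hS, hφ, hω, hα, hβ, hγ⟩ := L.exists_shortExact_triangle hC h₁ h₂ h₃
  refine ⟨p, S, φ, ω, hS, hφ, hω, (e.map (L.stableComm hC F hF c)).trans
    ⟨F.mapIso α, (stableLift F hF).mapIso β, (stableLift F hF).mapIso γ, ?_, ?_, ?_⟩⟩
  · exact (Functor.map_comp _ _ _).symm.trans ((congrArg (fun t => (stableLift F hF).map t)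
      hα).trans (F.map_comp _ _))
  · exact (Functor.map_comp _ _ _).symm.trans ((congrArg (fun t => (stableLift F hF).map t)
      hβ).trans (Functor.map_comp _ _ _))
  · obtain ⟨k, hk⟩ : ∃ k : F.obj Z' ⟶ F.obj ((incl Ω p).obj S.X₃),
        k = (stableLift F hF).map γ.hom := ⟨_, rfl⟩
    have h₄ : F.map (w ≫ L.shiftHom hC X' ≫ (suspension Ω).map α.hom) =
        k ≫ F.map (thirdHom p ω) :=
      (congrArg (fun t => (stableLift F hF).map t) hγ).trans ((Functor.map_comp _ _ _).trans
        (congrArg (· ≫ F.map (thirdHom p ω)) hk.symm))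
    have h₅ : F.map ((suspension Ω).map α.hom) ≫ c.hom.app ((incl Ω p).obj S.X₁) =
        c.hom.app X' ≫ s.map (F.map α.hom) := c.hom.naturality α.hom
    have h₆ : (F.map w ≫ F.map (L.shiftHom hC X') ≫ c.hom.app X') ≫ s.map (F.map α.hom) =
        k ≫ F.map (thirdHom p ω) ≫ c.hom.app ((incl Ω p).obj S.X₁) := by
      rw [← Category.assoc k, ← h₄, Category.assoc, Category.assoc, Functor.map_comp,
        Functor.map_comp, Category.assoc, Category.assoc, h₅]
    exact h₆.trans (congrArg (· ≫ _) hk)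

end LoopStructure

theorem inv_naturality_of_hom {C : Type*} [Category* C] {D : Type*} [Category* D] (F G : C ⥤ D)
    {X Y : C} (α : X ≅ Y) (i : F.obj X ⟶ G.obj X) (j : F.obj Y ⟶ G.obj Y)
    (h : F.map α.hom ≫ j = i ≫ G.map α.hom) : F.map α.inv ≫ i = j ≫ G.map α.inv := by
  rw [← cancel_epi (F.map α.hom), ← Category.assoc, ← F.map_comp, reassoc_of% h, ← G.map_comp]
  simp

theorem comp_naturality {C : Type*} [Category* C] {D : Type*} [Category* D] (F G : C ⥤ D)
    {X Y Z : C} (f : X ⟶ Y) (g : Y ⟶ Z) (i : F.obj X ⟶ G.obj X) (j : F.obj Y ⟶ G.obj Y)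
    (k : F.obj Z ⟶ G.obj Z) (hf : F.map f ≫ j = i ≫ G.map f) (hg : F.map g ≫ k = j ≫ G.map g) :
    F.map (f ≫ g) ≫ k = i ≫ G.map (f ≫ g) := by
  rw [F.map_comp, G.map_comp, Category.assoc, hg, reassoc_of% hf]

theorem map_comp_commShiftIso_hom {C : Type*} [Category* C] {D : Type*} [Category* D] [HasShift C ℤ]
    [HasShift D ℤ] (F : C ⥤ D) [F.CommShift ℤ] {n : ℤ} {X Y X' Y' : C} {a : X ⟶ Y} {a' : X' ⟶ Y'}
    {i : X' ⟶ X⟦n⟧} {j : Y' ⟶ Y⟦n⟧} (h : a' ≫ j = i ≫ a⟦n⟧') :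
    F.map a' ≫ F.map j ≫ (F.commShiftIso n).hom.app Y =
      (F.map i ≫ (F.commShiftIso n).hom.app X) ≫ (F.map a)⟦n⟧' := by
  have e : F.map (a⟦n⟧') ≫ (F.commShiftIso n).hom.app Y =
      (F.commShiftIso n).hom.app X ≫ (F.map a)⟦n⟧' := (F.commShiftIso n).hom.naturality a
  rw [Category.assoc, ← e, ← Category.assoc, ← Category.assoc, ← F.map_comp, ← F.map_comp, h]

/-! ### Compatibility of `(X, n) ↦ X[n]` with the suspensions. -/

namespace StalkFunctor

open Stabilization Pretriangulated

variable {A : Type u} [Category.{v} A] [Abelian A] {D : Type u'} [Category.{v'} D]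
  [HasZeroObject D] [HasShift D ℤ] [Preadditive D] [∀ n : ℤ, (shiftFunctor D n).Additive]
  [Pretriangulated D] {P : ObjectProperty D} (M : StalkFunctor A P)
  {Ω : A ⥤ A} (L : LoopStructure Ω) [P.IsTriangulated]
  {T : Type*} [Category* T] (Loc : D ⥤ T) [Loc.IsLocalization P.trW]
  [HasShift T ℤ] [Loc.CommShift ℤ]

/-- The shift is additive in an associative way, so raising the degree by one on the outside or on
the inside gives the same morphism, without a sign. -/
theorem step_shift (n m : ℤ) (h : n + 1 = m) (X : A) :
    (M.step L (n + 1) (m + 1) (by omega)).app X ≫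
        (shiftFunctorAdd' D m 1 (m + 1) rfl).hom.app (M.F.obj (Ω.obj X)) =
      (shiftFunctorAdd' D n 1 (n + 1) rfl).hom.app (M.F.obj X) ≫
        ((M.step L n m h).app X)⟦(1 : ℤ)⟧' := by
  have e₁ := shiftFunctorAdd'_assoc_hom_app 1 n 1 m (n + 1) (m + 1) (by omega) rfl (by omega)
    (M.F.obj (Ω.obj X))
  have e₂ : (shiftFunctorAdd' D n 1 (n + 1) rfl).hom.app (M.F.obj X) ≫
      (M.δ (L.shortExact X))⟦n⟧'⟦(1 : ℤ)⟧' = (M.δ (L.shortExact X))⟦n + 1⟧' ≫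
        (shiftFunctorAdd' D n 1 (n + 1) rfl).hom.app ((M.F.obj (Ω.obj X))⟦(1 : ℤ)⟧) :=
    ((shiftFunctorAdd' D n 1 (n + 1) rfl).hom.naturality (M.δ (L.shortExact X))).symm
  have e₃ : (shiftFunctorAdd' D 1 (n + 1) (m + 1) (by omega)).inv.app (M.F.obj (Ω.obj X)) ≫
      (shiftFunctorAdd' D m 1 (m + 1) rfl).hom.app (M.F.obj (Ω.obj X)) =
      (shiftFunctorAdd' D n 1 (n + 1) rfl).hom.app ((M.F.obj (Ω.obj X))⟦(1 : ℤ)⟧) ≫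
      ((shiftFunctorAdd' D 1 n m (by omega)).inv.app (M.F.obj (Ω.obj X)))⟦(1 : ℤ)⟧' := by
    have e₄ : ((shiftFunctorAdd' D 1 n m (by omega)).hom.app (M.F.obj (Ω.obj X)))⟦(1 : ℤ)⟧' ≫
        ((shiftFunctorAdd' D 1 n m (by omega)).inv.app (M.F.obj (Ω.obj X)))⟦(1 : ℤ)⟧' = 𝟙 _ :=
      (((shiftFunctor D (1 : ℤ)).mapIso
        ((shiftFunctorAdd' D 1 n m (by omega)).app (M.F.obj (Ω.obj X))))).hom_inv_id
    rw [← cancel_epi ((shiftFunctorAdd' D 1 (n + 1) (m + 1) (by omega)).hom.app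
      (M.F.obj (Ω.obj X))), Iso.hom_inv_id_app_assoc, ← reassoc_of% e₁]
    exact (Category.comp_id _).symm.trans (congrArg (_ ≫ ·) e₄.symm)
  have e₅ : (-((M.δ (L.shortExact X))⟦n + 1⟧' ≫
      (shiftFunctorAdd' D 1 (n + 1) (m + 1) (by omega)).inv.app (M.F.obj (Ω.obj X)))) ≫
        (shiftFunctorAdd' D m 1 (m + 1) rfl).hom.app (M.F.obj (Ω.obj X)) =
      (shiftFunctorAdd' D n 1 (n + 1) rfl).hom.app (M.F.obj X) ≫
        (-((M.δ (L.shortExact X))⟦n⟧' ≫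
          (shiftFunctorAdd' D 1 n m (by omega)).inv.app (M.F.obj (Ω.obj X))))⟦(1 : ℤ)⟧' := by
    rw [Functor.map_neg, Functor.map_comp, Preadditive.neg_comp, Preadditive.comp_neg,
      Category.assoc, e₃, reassoc_of% e₂]
  exact e₅

/-- The compatibility of the functor `(X, n) ↦ X[n]` with the suspensions, on objects. -/
noncomputable def shiftIso (X : Stabilization Ω) :
    Loc.obj ((M.stalk (X.deg + 1)).obj X.obj) ≅ (Loc.obj ((M.stalk X.deg).obj X.obj))⟦(1 : ℤ)⟧ :=
  Loc.mapIso ((shiftFunctorAdd' D X.deg 1 (X.deg + 1) rfl).app (M.F.obj X.obj)) ≪≫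
    (Loc.commShiftIso (1 : ℤ)).app _

/-- Naturality is inherited by composites and inverses, so it suffices to check the generators:
morphisms of `A`, and the connecting morphisms, for which it is `step_shift`. -/
theorem shiftIso_naturality {X Y : Stabilization Ω} (u : X ⟶ Y) :
    (M.quotientFunctor L Loc).map ((suspension Ω).map u) ≫ (M.shiftIso Loc Y).hom =
      (M.shiftIso Loc X).hom ≫ ((M.quotientFunctor L Loc).map u)⟦(1 : ℤ)⟧' := by
  have hn (n m : ℤ) (h : n + 1 = m) (X : A) :
      (M.quotientFunctor L Loc).map ((suspension Ω).map ((next Ω n m h).hom.app X)) ≫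
        (M.shiftIso Loc ((incl Ω m).obj (Ω.obj X))).hom =
      (M.shiftIso Loc ((incl Ω n).obj X)).hom ≫
        ((M.quotientFunctor L Loc).map ((next Ω n m h).hom.app X))⟦(1 : ℤ)⟧' := by
    have e₁ : Loc.map ((M.step L (n + 1) (m + 1) (by omega)).app X) ≫
        (M.shiftIso Loc ((incl Ω m).obj (Ω.obj X))).hom =
        (M.shiftIso Loc ((incl Ω n).obj X)).hom ≫
          (Loc.map ((M.step L n m h).app X))⟦(1 : ℤ)⟧' :=
      map_comp_commShiftIso_hom Loc (M.step_shift L n m h X)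
    exact (congrArg (· ≫ (M.shiftIso Loc ((incl Ω m).obj (Ω.obj X))).hom)
      (M.quotientFunctor_map_next L Loc (n + 1) (m + 1) (by omega) X)).trans (e₁.trans
        (congrArg (fun t => (M.shiftIso Loc ((incl Ω n).obj X)).hom ≫ t⟦(1 : ℤ)⟧')
          (M.quotientFunctor_map_next L Loc n m h X).symm))
  refine hom_induction (Ω := Ω) (P := fun {X Y} u =>
    (M.quotientFunctor L Loc).map ((suspension Ω).map u) ≫ (M.shiftIso Loc Y).hom =
      (M.shiftIso Loc X).hom ≫ ((M.quotientFunctor L Loc).map u)⟦(1 : ℤ)⟧') ?_ hn ?_ ?_ u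
  · intro n X Y f
    have e₁ : Loc.map ((M.stalk (n + 1)).map f) ≫ (M.shiftIso Loc ((incl Ω n).obj Y)).hom =
        (M.shiftIso Loc ((incl Ω n).obj X)).hom ≫ (Loc.map ((M.stalk n).map f))⟦(1 : ℤ)⟧' := 
      map_comp_commShiftIso_hom Loc
        ((shiftFunctorAdd' D n 1 (n + 1) rfl).hom.naturality (M.F.map f))
    exact (congrArg (· ≫ (M.shiftIso Loc ((incl Ω n).obj Y)).hom)
      (M.quotientFunctor_map_incl_map L Loc (n + 1) f)).trans (e₁.trans
        (congrArg (fun t => (M.shiftIso Loc ((incl Ω n).obj X)).hom ≫ t⟦(1 : ℤ)⟧')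
          (M.quotientFunctor_map_incl_map L Loc n f).symm))
  · intro n m h X
    exact inv_naturality_of_hom (suspension Ω ⋙ M.quotientFunctor L Loc)
      (M.quotientFunctor L Loc ⋙ shiftFunctor T (1 : ℤ)) ((next Ω n m h).app X) _ _ (hn n m h X)
  · intro X Y Z f g hf hg
    exact comp_naturality (suspension Ω ⋙ M.quotientFunctor L Loc)
      (M.quotientFunctor L Loc ⋙ shiftFunctor T (1 : ℤ)) f g _ _ _ hf hg

/-- The functor `(X, n) ↦ X[n]` commutes with the suspensions. -/
noncomputable def quotientFunctorComm :
    suspension Ω ⋙ M.quotientFunctor L Loc ≅ M.quotientFunctor L Loc ⋙ shiftFunctor T (1 : ℤ) :=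
  NatIso.ofComponents (fun X => M.shiftIso Loc X) (fun u => M.shiftIso_naturality L Loc u)

end StalkFunctor

section

open Pretriangulated

variable {D : Type*} [Category* D] [HasZeroObject D] [HasShift D ℤ] [Preadditive D]
  [∀ n : ℤ, (shiftFunctor D n).Additive] [Pretriangulated D]

/-- The shift of a distinguished triangle, with the signs collected in the third morphism. -/
theorem shift_distinguished_signs {X Y Z : D} {f : X ⟶ Y} {g : Y ⟶ Z} {h : Z ⟶ X⟦(1 : ℤ)⟧}
    (hT : Triangle.mk f g h ∈ distTriang D) (p : ℤ) :
    Triangle.mk (f⟦p⟧') (g⟦p⟧') ((p.negOnePow • h⟦p⟧') ≫ (shiftFunctorComm D 1 p).hom.app X) ∈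
      distTriang D := by
  refine isomorphic_distinguished _ (Triangle.shift_distinguished _ hT p) _ ?_
  -- Scaling the middle object by `(-1) ^ p` removes the signs of the first two morphisms and leaves
  -- the third untouched.
  refine Triangle.isoMk _ _ (Iso.refl _) (p.negOnePow • Iso.refl _) (Iso.refl _) ?_ ?_ ?_
  · change f⟦p⟧' ≫ (p.negOnePow • 𝟙 (Y⟦p⟧)) = 𝟙 _ ≫ (p.negOnePow • f⟦p⟧')
    rw [Linear.comp_units_smul, Category.comp_id, Category.id_comp]
  · change g⟦p⟧' ≫ 𝟙 _ = (p.negOnePow • 𝟙 (Y⟦p⟧)) ≫ (p.negOnePow • g⟦p⟧')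
    rw [Linear.comp_units_smul, Linear.units_smul_comp, smul_smul, Int.units_mul_self, one_smul,
      Category.comp_id, Category.id_comp]
  · change ((p.negOnePow • h⟦p⟧') ≫ (shiftFunctorComm D 1 p).hom.app X) ≫
      (𝟙 (X⟦p⟧))⟦(1 : ℤ)⟧' = 𝟙 _ ≫ (p.negOnePow • h⟦p⟧' ≫ (shiftFunctorComm D 1 p).hom.app X)
    have e : (p.negOnePow • h⟦p⟧') ≫ (shiftFunctorComm D 1 p).hom.app X =
        p.negOnePow • h⟦p⟧' ≫ (shiftFunctorComm D 1 p).hom.app X := by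
      rw [Linear.units_smul_comp]
    rw [CategoryTheory.Functor.map_id]
    exact (Category.comp_id _).trans (e.trans (Category.id_comp _).symm)

end

/-! ### Images of the triangles of short exact sequences. -/

namespace StalkFunctor

open Stabilization Pretriangulated LoopStructure

variable {A : Type u} [Category.{v} A] [Abelian A] {D : Type u'} [Category.{v'} D]
  [HasZeroObject D] [HasShift D ℤ] [Preadditive D] [∀ n : ℤ, (shiftFunctor D n).Additive]
  [Pretriangulated D] {P : ObjectProperty D} (M : StalkFunctor A P)
  {Ω : A ⥤ A} (L : LoopStructure Ω)

/-- Naturality of the connecting morphism for `(ω, φ, 𝟙)` shows that the one of `S` is obtained from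
the one of the presentation of `S.X₃` by composing with `ω[1]`. The sign is that of `step`. -/
theorem step_comp_shift (p : ℤ) {S : ShortComplex A} (hS : S.ShortExact)
    (φ : L.G.obj S.X₃ ⟶ S.X₂) (ω : Ω.obj S.X₃ ⟶ S.X₁) (hφ : φ ≫ S.g = L.μ.app S.X₃)
    (hω : L.ι.app S.X₃ ≫ φ = ω ≫ S.f) :
    ((M.step L p (p + 1) rfl).app S.X₃ ≫ (M.stalk (p + 1)).map ω) ≫
        (shiftFunctorAdd' D p 1 (p + 1) rfl).hom.app (M.F.obj S.X₁) =
      -((M.δ hS)⟦p⟧' ≫ (shiftFunctorComm D 1 p).hom.app (M.F.obj S.X₁)) := by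
  have e₁ : M.δ (L.shortExact S.X₃) ≫ (M.F.map ω)⟦(1 : ℤ)⟧' = M.δ hS := by
    have := M.δ_naturality (L.shortExact S.X₃) hS
      { τ₁ := ω
        τ₂ := φ
        τ₃ := 𝟙 S.X₃
        comm₁₂ := hω.symm
        comm₂₃ := hφ.trans (Category.comp_id _).symm }
    exact this.trans ((congrArg (· ≫ M.δ hS) (CategoryTheory.Functor.map_id M.F S.X₃)).trans
      (Category.id_comp _))
  have e₂ : (shiftFunctorAdd' D 1 p (p + 1) (by omega)).inv.app (M.F.obj (Ω.obj S.X₃)) ≫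
      (M.F.map ω)⟦p + 1⟧' = (M.F.map ω)⟦(1 : ℤ)⟧'⟦p⟧' ≫
        (shiftFunctorAdd' D 1 p (p + 1) (by omega)).inv.app (M.F.obj S.X₁) :=
    ((shiftFunctorAdd' D 1 p (p + 1) (by omega)).inv.naturality (M.F.map ω)).symm
  have e₃ : ((-((M.δ (L.shortExact S.X₃))⟦p⟧' ≫
      (shiftFunctorAdd' D 1 p (p + 1) (by omega)).inv.app (M.F.obj (Ω.obj S.X₃)))) ≫
        (M.F.map ω)⟦p + 1⟧') ≫ (shiftFunctorAdd' D p 1 (p + 1) rfl).hom.app (M.F.obj S.X₁) =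
      -((M.δ hS)⟦p⟧' ≫ (shiftFunctorComm D 1 p).hom.app (M.F.obj S.X₁)) := by
    rw [Preadditive.neg_comp, Preadditive.neg_comp, Category.assoc, Category.assoc,
      reassoc_of% e₂, ← Functor.map_comp_assoc, e₁, shiftFunctorComm_eq D 1 p (p + 1) (by omega)]
    rfl
  exact e₃

variable [P.IsTriangulated] [IsTriangulated D]
  {T : Type*} [Category* T] (Loc : D ⥤ T) [Loc.IsLocalization P.trW]
  [HasShift T ℤ] [Loc.CommShift ℤ] [HasZeroObject T] [Preadditive T]
  [∀ n : ℤ, (shiftFunctor T n).Additive] [Pretriangulated T] [Loc.IsTriangulated]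
  [Ω.Additive] [PreservesFiniteLimits Ω] [PreservesFiniteColimits Ω]

theorem quotientFunctor_map_thirdHom (p : ℤ) {S : ShortComplex A} (hS : S.ShortExact)
    (φ : L.G.obj S.X₃ ⟶ S.X₂) (ω : Ω.obj S.X₃ ⟶ S.X₁) (hφ : φ ≫ S.g = L.μ.app S.X₃)
    (hω : L.ι.app S.X₃ ≫ φ = ω ≫ S.f) :
    (M.quotientFunctor L Loc).map (thirdHom p ω) ≫
        (M.quotientFunctorComm L Loc).hom.app ((incl Ω p).obj S.X₁) =
      Loc.map ((p.negOnePow • (M.δ hS)⟦p⟧') ≫ (shiftFunctorComm D 1 p).hom.app (M.F.obj S.X₁)) ≫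
        (Loc.commShiftIso (1 : ℤ)).hom.app ((M.stalk p).obj S.X₁) := by
  have e₁ : (M.quotientFunctor L Loc).map (thirdHom p ω) = ((p + 1).negOnePow : ℤ) •
      Loc.map ((M.step L p (p + 1) rfl).app S.X₃ ≫ (M.stalk (p + 1)).map ω) := by
    refine (Functor.map_zsmul _).trans (congrArg (((p + 1).negOnePow : ℤ) • ·) ?_)
    refine (Functor.map_comp _ _ _).trans ((congrArg₂ (· ≫ ·)
      (M.quotientFunctor_map_next L Loc p (p + 1) rfl S.X₃)
      (M.quotientFunctor_map_incl_map L Loc (p + 1) ω)).trans (Loc.map_comp _ _).symm)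
  have e₂ : (((p + 1).negOnePow : ℤ) •
      Loc.map ((M.step L p (p + 1) rfl).app S.X₃ ≫ (M.stalk (p + 1)).map ω)) ≫
        Loc.map ((shiftFunctorAdd' D p 1 (p + 1) rfl).hom.app (M.F.obj S.X₁)) ≫
        (Loc.commShiftIso (1 : ℤ)).hom.app ((M.stalk p).obj S.X₁) =
      Loc.map ((p.negOnePow • (M.δ hS)⟦p⟧') ≫ (shiftFunctorComm D 1 p).hom.app (M.F.obj S.X₁)) ≫
        (Loc.commShiftIso (1 : ℤ)).hom.app ((M.stalk p).obj S.X₁) := by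
    have e₃ := M.step_comp_shift L p hS φ ω hφ hω
    rw [Preadditive.zsmul_comp, ← Category.assoc, ← Functor.map_comp]
    refine (congrArg (fun t => ((p + 1).negOnePow : ℤ) • (Loc.map t ≫ _)) e₃).trans ?_
    -- The minus of `step_comp_shift` and the factor `(-1) ^ (p + 1)` combine to `(-1) ^ p`.
    rw [Functor.map_neg, Preadditive.neg_comp, Int.negOnePow_succ, Units.val_neg, neg_smul,
      smul_neg, neg_neg, Linear.units_smul_comp, ← Preadditive.zsmul_comp, ← Functor.map_zsmul]
    rfl
  exact (congrArg (· ≫ (M.quotientFunctorComm L Loc).hom.app ((incl Ω p).obj S.X₁)) e₁).trans e₂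

/-- The image of the standard triangle given by a short exact sequence is distinguished. -/
theorem quotientFunctor_distinguished (p : ℤ) {S : ShortComplex A} (hS : S.ShortExact)
    (φ : L.G.obj S.X₃ ⟶ S.X₂) (ω : Ω.obj S.X₃ ⟶ S.X₁) (hφ : φ ≫ S.g = L.μ.app S.X₃)
    (hω : L.ι.app S.X₃ ≫ φ = ω ≫ S.f) :
    Triangle.mk ((M.quotientFunctor L Loc).map ((incl Ω p).map S.f))
      ((M.quotientFunctor L Loc).map ((incl Ω p).map S.g))
      ((M.quotientFunctor L Loc).map (thirdHom p ω) ≫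
        (M.quotientFunctorComm L Loc).hom.app ((incl Ω p).obj S.X₁)) ∈ distTriang T := by
  rw [M.quotientFunctor_map_thirdHom L Loc p hS φ ω hφ hω]
  have e₁ := M.quotientFunctor_map_incl_map L Loc p S.f
  have e₂ := M.quotientFunctor_map_incl_map L Loc p S.g
  have h := Loc.map_distinguished _ (shift_distinguished_signs (M.distinguished hS) p)
  refine cast (congrArg₂ (fun a b => Triangle.mk (C := T) a b
    (Loc.map ((p.negOnePow • (M.δ hS)⟦p⟧') ≫ (shiftFunctorComm D 1 p).hom.app (M.F.obj S.X₁)) ≫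
        (Loc.commShiftIso (1 : ℤ)).hom.app ((M.stalk p).obj S.X₁)) ∈ distTriang T)
      e₁.symm e₂.symm) h

end StalkFunctor

/-! ### Triangle equivalence with the Verdier quotient. -/

namespace StalkFunctor

open Stabilization Pretriangulated LoopStructure

variable {A : Type u} [Category.{v} A] [Abelian A] {D : Type u'} [Category.{v'} D]
  [HasZeroObject D] [HasShift D ℤ] [Preadditive D] [∀ n : ℤ, (shiftFunctor D n).Additive]
  [Pretriangulated D] {P : ObjectProperty D} (M : StalkFunctor A P)
  {Ω : A ⥤ A} (L : LoopStructure Ω) [P.IsTriangulated] [IsTriangulated D]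
  {T : Type*} [Category* T] (Loc : D ⥤ T) [Loc.IsLocalization P.trW]
  [HasShift T ℤ] [Loc.CommShift ℤ] [HasZeroObject T] [Preadditive T]
  [∀ n : ℤ, (shiftFunctor T n).Additive] [Pretriangulated T] [Loc.IsTriangulated]
  [Ω.Additive] [PreservesFiniteLimits Ω] [PreservesFiniteColimits Ω]
  (hC : IsFrobeniusAbelian (Stabilization Ω))

/-- The functor from the stable category of the stabilization to the quotient category. -/
noncomputable abbrev stableQuotient : StableCategory (Stabilization Ω) ⥤ T :=
  stableLift (M.quotientFunctor L Loc) fun u v h => M.quotientFunctor_map_eq L Loc u v h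

instance stableQuotient_faithful : (M.stableQuotient L Loc).Faithful :=
  stableLift_faithful _ _ fun u v h => M.projRel_of_quotientFunctor_map_eq L Loc u v h

/-- The compatibility of the functor from the stable category with the suspensions. -/
noncomputable abbrev stableQuotientComm :
    hC.stableShift ⋙ M.stableQuotient L Loc ≅ M.stableQuotient L Loc ⋙ shiftFunctor T (1 : ℤ) :=
  L.stableComm hC (M.quotientFunctor L Loc) (fun u v h => M.quotientFunctor_map_eq L Loc u v h)
    (M.quotientFunctorComm L Loc)

theorem distinguished_of_triangleIso {X Y Z X₂ Y₂ Z₂ : T} {f : X ⟶ Y} {g : Y ⟶ Z}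
    {h : Z ⟶ X⟦(1 : ℤ)⟧} {f₂ : X₂ ⟶ Y₂} {g₂ : Y₂ ⟶ Z₂} {h₂ : Z₂ ⟶ X₂⟦(1 : ℤ)⟧}
    (t : TriangleIso (shiftFunctor T (1 : ℤ)) f g h f₂ g₂ h₂)
    (d : Triangle.mk f₂ g₂ h₂ ∈ distTriang T) : Triangle.mk f g h ∈ distTriang T := by
  obtain ⟨a, b, c, e₁, e₂, e₃⟩ := t
  exact isomorphic_distinguished _ d _ (Triangle.isoMk _ _ a b c e₁ e₂ e₃)

theorem triangleIso_of_distinguished {X Y Z Z₂ : T} {f : X ⟶ Y} {g : Y ⟶ Z}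
    {h : Z ⟶ X⟦(1 : ℤ)⟧} {g₂ : Y ⟶ Z₂} {h₂ : Z₂ ⟶ X⟦(1 : ℤ)⟧}
    (d : Triangle.mk f g h ∈ distTriang T) (d₂ : Triangle.mk f g₂ h₂ ∈ distTriang T) :
    TriangleIso (shiftFunctor T (1 : ℤ)) f g h f g₂ h₂ := by
  let e := isoTriangleOfIso₁₂ _ _ d d₂ (Iso.refl _) (Iso.refl _)
    ((Category.comp_id _).trans (Category.id_comp _).symm)
  exact ⟨Iso.refl X, Iso.refl Y, Triangle.π₃.mapIso e,
    (Category.comp_id _).trans (Category.id_comp _).symm, e.hom.comm₂, e.hom.comm₃⟩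

theorem distinguished_of_dist {X Y Z : StableCategory (Stabilization Ω)} {f : X ⟶ Y}
    {g : Y ⟶ Z} {h : Z ⟶ hC.stableShift.obj X} (d : hC.triangles.dist f g h) :
    Triangle.mk ((M.stableQuotient L Loc).map f) ((M.stableQuotient L Loc).map g)
      ((M.stableQuotient L Loc).map h ≫ (M.stableQuotientComm L Loc hC).hom.app X) ∈
        distTriang T := by
  obtain ⟨p, S, φ, ω, hS, hφ, hω, e⟩ := L.exists_triangleIso_of_dist hC (M.quotientFunctor L Loc)
    (fun u v h => M.quotientFunctor_map_eq L Loc u v h) (M.quotientFunctorComm L Loc) d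
  exact distinguished_of_triangleIso e (M.quotientFunctor_distinguished L Loc p hS φ ω hφ hω)

/-- The morphism `f` is the first morphism of some standard triangle. Its image and the given image
are distinguished triangles over the same morphism, hence isomorphic, and full faithfulness lifts
the isomorphism to the stable category. -/
theorem dist_of_distinguished {X Y Z : StableCategory (Stabilization Ω)} {f : X ⟶ Y}
    {g : Y ⟶ Z} {h : Z ⟶ hC.stableShift.obj X}
    (d : Triangle.mk ((M.stableQuotient L Loc).map f) ((M.stableQuotient L Loc).map g)
      ((M.stableQuotient L Loc).map h ≫ (M.stableQuotientComm L Loc hC).hom.app X) ∈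
        distTriang T) : hC.triangles.dist f g h := by
  obtain ⟨Z', g', h', d'⟩ := hC.exists_triangle f
  exact hC.triangles_dist_of_iso (TriangleIso.of_map (M.stableQuotientComm L Loc hC)
    (triangleIso_of_distinguished d (M.distinguished_of_dist L Loc hC d'))) d'

/-- The first morphism of `t` lifts by fullness, and a standard triangle over the lift maps to a
triangle isomorphic to `t`. -/
theorem essImage_of_distinguished (t : Triangle T) (ht : t ∈ distTriang T)
    (h₁ : (M.stableQuotient L Loc).essImage t.obj₁) (h₂ : (M.stableQuotient L Loc).essImage t.obj₂) :
    (M.stableQuotient L Loc).essImage t.obj₃ := by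
  obtain ⟨X, ⟨a⟩⟩ := h₁
  obtain ⟨Y, ⟨b⟩⟩ := h₂
  obtain ⟨f, hf⟩ := (M.stableQuotient L Loc).map_surjective (a.hom ≫ t.mor₁ ≫ b.inv)
  obtain ⟨Z, g, h, d⟩ := L.isFrobeniusAbelian.exists_triangle f
  have d' := M.distinguished_of_dist L Loc L.isFrobeniusAbelian d
  exact ⟨Z, ⟨Triangle.π₃.mapIso (isoTriangleOfIso₁₂ _ _ d' ht a b (by
    change (M.stableQuotient L Loc).map f ≫ b.hom = a.hom ≫ t.mor₁
    rw [hf, Category.assoc, Category.assoc, Iso.inv_hom_id, Category.comp_id]))⟩⟩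

theorem essImage_stalk (X : A) (n : ℤ) :
    (M.stableQuotient L Loc).essImage (Loc.obj ((M.stalk n).obj X)) :=
  ⟨(toStable _).obj ((incl Ω n).obj X), ⟨Iso.refl _⟩⟩

theorem essImage_shift (n : ℤ) (W : D) (hW : (M.stableQuotient L Loc).essImage (Loc.obj W)) :
    (M.stableQuotient L Loc).essImage (Loc.obj (W⟦n⟧)) := by
  obtain ⟨X, ⟨e⟩⟩ := hW
  obtain ⟨e⟩ : Nonempty (Loc.obj ((M.stalk X.as.deg).obj X.as.obj) ≅ Loc.obj W) := ⟨e⟩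
  exact Functor.essImage.ofIso (Loc.mapIso ((shiftFunctorAdd D X.as.deg n).app
    (M.F.obj X.as.obj)) ≪≫ (Loc.commShiftIso n).app _ ≪≫ (shiftFunctor T n).mapIso e ≪≫
      ((Loc.commShiftIso n).app W).symm) (M.essImage_stalk L Loc X.as.obj (X.as.deg + n))

/-- The objects of `D` whose images are attained contain the stalks and are closed under shifts,
isomorphisms and extensions; stalks generate `D`. -/
theorem stableQuotient_essSurj : (M.stableQuotient L Loc).EssSurj := by
  have h (W : D) : (M.stableQuotient L Loc).essImage (Loc.obj W) := by
    refine M.generates (fun W => (M.stableQuotient L Loc).essImage (Loc.obj W)) (fun X => ?_)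
      (fun W n h => M.essImage_shift L Loc n W h)
      (fun W W' e h => Functor.essImage.ofIso (Loc.mapIso e) h) (fun t ht h₁ h₃ => ?_) W
    · exact Functor.essImage.ofIso (Loc.mapIso ((shiftFunctorZero D ℤ).app (M.F.obj X)))
        (M.essImage_stalk L Loc X 0)
    · exact M.essImage_of_distinguished L Loc _
        (Loc.map_distinguished _ (inv_rot_of_distTriang _ ht)) (M.essImage_shift L Loc (-1) _ h₃) h₁
  have := Localization.essSurj Loc P.trW
  exact ⟨fun Y => Functor.essImage.ofIso (Loc.objObjPreimageIso Y) (h _)⟩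

/-- The stable category of the stabilization is triangle equivalent to the quotient category. -/
noncomputable def triangleEquivalence :
    TriangleEquivalence hC.triangles (TriangleData.ofPretriangulated T) :=
  haveI := M.stableQuotient_essSurj L Loc
  haveI : (M.stableQuotient L Loc).IsEquivalence := { }
  { equiv := (M.stableQuotient L Loc).asEquivalence
    comm := M.stableQuotientComm L Loc hC
    dist_iff := fun _ _ _ =>
      ⟨fun d => M.distinguished_of_dist L Loc hC d, fun d => M.dist_of_distinguished L Loc hC d⟩ }

include M Loc in
/-- A short exact sequence in `A` gives a distinguished triangle of the stable category. -/
theorem exists_dist_of_shortExact (p : ℤ) {S : ShortComplex A} (hS : S.ShortExact)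
    (φ : L.G.obj S.X₃ ⟶ S.X₂) (ω : Ω.obj S.X₃ ⟶ S.X₁) (hφ : φ ≫ S.g = L.μ.app S.X₃)
    (hω : L.ι.app S.X₃ ≫ φ = ω ≫ S.f) :
    ∃ h : (toStable _).obj ((incl Ω p).obj S.X₃) ⟶
        hC.stableShift.obj ((toStable _).obj ((incl Ω p).obj S.X₁)),
      hC.triangles.dist ((toStable _).map ((incl Ω p).map S.f))
        ((toStable _).map ((incl Ω p).map S.g)) h ∧
      h ≫ (toStable _).map (L.shiftHom hC ((incl Ω p).obj S.X₁)) =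
        (toStable _).map (thirdHom p ω) := by
  have hi := L.isIso_shiftHom hC ((incl Ω p).obj S.X₁)
  obtain ⟨h, hh⟩ : ∃ h : (toStable _).obj ((incl Ω p).obj S.X₃) ⟶
        (toStable _).obj (hC.cosyzygy ((incl Ω p).obj S.X₁)),
      h ≫ (toStable _).map (L.shiftHom hC ((incl Ω p).obj S.X₁)) =
        (toStable _).map (thirdHom p ω) :=
    ⟨(toStable _).map (thirdHom p ω) ≫ inv ((toStable _).map (L.shiftHom hC _)), by
      rw [Category.assoc, IsIso.inv_hom_id, Category.comp_id]⟩
  -- The third morphism is forced by the required equation, and that the triangle is standard is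
  -- checked after applying the functor to the quotient, which reflects triangles.
  refine ⟨h, M.dist_of_distinguished L Loc hC ?_, hh⟩
  have e : (M.stableQuotient L Loc).map h ≫
      (M.quotientFunctor L Loc).map (L.shiftHom hC ((incl Ω p).obj S.X₁)) =
      (M.quotientFunctor L Loc).map (thirdHom p ω) :=
    (Functor.map_comp _ _ _).symm.trans (congrArg (fun t => (M.stableQuotient L Loc).map t) hh)
  refine cast (congrArg (fun t => Triangle.mk (C := T)
    ((M.quotientFunctor L Loc).map ((incl Ω p).map S.f))
    ((M.quotientFunctor L Loc).map ((incl Ω p).map S.g)) t ∈ distTriang T) ?_)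
      (M.quotientFunctor_distinguished L Loc p hS φ ω hφ hω)
  exact (congrArg (· ≫ (M.quotientFunctorComm L Loc).hom.app ((incl Ω p).obj S.X₁)) e.symm).trans
    (Category.assoc _ _ _)

end StalkFunctor

/-! ### Triangle equivalence with the stabilization of the stable category. -/

namespace LoopStructure

open Stabilization

variable {A : Type u} [Category.{v} A] [Abelian A] {Ω : A ⥤ A} (L : LoopStructure Ω)
  [Ω.Additive] [PreservesFiniteLimits Ω] [PreservesFiniteColimits Ω]
  (hC : IsFrobeniusAbelian (Stabilization Ω))
  (hΩ : ∀ P : A, Projective P → Projective (Ω.obj P))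

/-- The distinguished triangles of the stabilization of the stable category. -/
def stableTriangles : TriangleData (Stabilization (stableMap Ω hΩ)) where
  shift := suspension (stableMap Ω hΩ)
  dist u v w := ∃ (n : ℤ) (S : ShortComplex A) (φ : L.G.obj S.X₃ ⟶ S.X₂) (ω : Ω.obj S.X₃ ⟶ S.X₁),
    S.ShortExact ∧ φ ≫ S.g = L.μ.app S.X₃ ∧ L.ι.app S.X₃ ≫ φ = ω ≫ S.f ∧
      TriangleIso (suspension (stableMap Ω hΩ)) u v w
        (X₂ := ⟨(toStable _).obj S.X₁, n⟩) (Y₂ := ⟨(toStable _).obj S.X₂, n⟩)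
        (Z₂ := ⟨(toStable _).obj S.X₃, n⟩)
        (homMk 0 0 rfl ((toStable _).map S.f)) (homMk 0 0 rfl ((toStable _).map S.g))
        (homMk 1 0 (add_zero (n + 1)).symm ((toStable _).map (((n + 1).negOnePow : ℤ) • ω)))

/-- Both functors agree on objects, so the natural isomorphism has identity components. The
identities are kept in the statement to give it the shape of a naturality square, which passes to
inverses and composites. -/
theorem toStableStab_suspension_map {X Y : Stabilization Ω} (u : X ⟶ Y) :
    (suspension Ω ⋙ toStableStab hΩ).map u ≫ 𝟙 ((suspension Ω ⋙ toStableStab hΩ).obj Y) =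
      𝟙 ((suspension Ω ⋙ toStableStab hΩ).obj X) ≫
        (toStableStab hΩ ⋙ suspension (stableMap Ω hΩ)).map u := by
  have hn (n m : ℤ) (h : n + 1 = m) (X : A) :
      (suspension Ω ⋙ toStableStab hΩ).map ((next Ω n m h).hom.app X) ≫
        𝟙 ((suspension Ω ⋙ toStableStab hΩ).obj ((incl Ω m).obj (Ω.obj X))) =
      𝟙 ((suspension Ω ⋙ toStableStab hΩ).obj ((incl Ω n).obj X)) ≫
        (toStableStab hΩ ⋙ suspension (stableMap Ω hΩ)).map ((next Ω n m h).hom.app X) := by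
    refine (Category.comp_id _).trans (Eq.trans ?_ (Category.id_comp _).symm)
    exact (toStableStab_map_next hΩ (n + 1) (m + 1) (by omega) X).trans
      (congrArg (fun t => (suspension (stableMap Ω hΩ)).map t)
        (toStableStab_map_next hΩ n m h X).symm)
  refine hom_induction (Ω := Ω) (P := fun {X Y} u =>
    (suspension Ω ⋙ toStableStab hΩ).map u ≫ 𝟙 ((suspension Ω ⋙ toStableStab hΩ).obj Y) =
      𝟙 ((suspension Ω ⋙ toStableStab hΩ).obj X) ≫
        (toStableStab hΩ ⋙ suspension (stableMap Ω hΩ)).map u) ?_ hn ?_ ?_ u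
  · intro n X Y f
    refine (Category.comp_id _).trans (Eq.trans ?_ (Category.id_comp _).symm)
    exact (toStableStab_map_incl_map hΩ (n + 1) f).trans
      (congrArg (fun t => (suspension (stableMap Ω hΩ)).map t)
        (toStableStab_map_incl_map hΩ n f).symm)
  · intro n m h X
    exact inv_naturality_of_hom (suspension Ω ⋙ toStableStab hΩ)
      (toStableStab hΩ ⋙ suspension (stableMap Ω hΩ)) ((next Ω n m h).app X) _ _ (hn n m h X)
  · intro X Y Z f g hf hg
    exact comp_naturality (suspension Ω ⋙ toStableStab hΩ)
      (toStableStab hΩ ⋙ suspension (stableMap Ω hΩ)) f g _ _ _ hf hg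

/-- The functor between stabilizations commutes with the suspensions. -/
noncomputable def toStableStabComm :
    suspension Ω ⋙ toStableStab hΩ ≅ toStableStab hΩ ⋙ suspension (stableMap Ω hΩ) :=
  NatIso.ofComponents (fun X => Iso.refl ((suspension Ω ⋙ toStableStab hΩ).obj X))
    (fun u => toStableStab_suspension_map hΩ u)

theorem toStableStab_map_thirdHom (p : ℤ) {X Z : A} (ω : Ω.obj Z ⟶ X) :
    (toStableStab hΩ).map (thirdHom p ω) ≫
        (toStableStabComm hΩ).hom.app ((incl Ω p).obj X) =
      homMk (X := ⟨(toStable A).obj Z, p⟩) (Y := ⟨(toStable A).obj X, p + 1⟩) 1 0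
        (add_zero (p + 1)).symm ((toStable _).map (((p + 1).negOnePow : ℤ) • ω)) := by
  have e : (thirdHom p ω : (incl Ω p).obj Z ⟶ _) = (next Ω p (p + 1) rfl).hom.app Z ≫
      (incl Ω (p + 1)).map (((p + 1).negOnePow : ℤ) • ω) := by
    rw [Functor.map_zsmul, Preadditive.comp_zsmul]
    rfl
  refine (Category.comp_id _).trans ?_
  rw [e]
  refine (Functor.map_comp _ _ _).trans ((congrArg₂ (· ≫ ·)
    (toStableStab_map_next hΩ p (p + 1) rfl Z) (toStableStab_map_incl_map hΩ (p + 1) _)).trans ?_)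
  refine (cls_comp_cls (X := ⟨(toStable A).obj Z, p⟩)
    (Y := ⟨(stableMap Ω hΩ).obj ((toStable A).obj Z), p + 1⟩)
    (Z := ⟨(toStable A).obj X, p + 1⟩) (a := 1) (b := 0) (c := 0) _ _ _ _).trans ?_
  exact congrArg (homMk 1 0 _) (Category.id_comp _)

variable (hstd : ∀ (p : ℤ) {S : ShortComplex A} (_ : S.ShortExact)
    (φ : L.G.obj S.X₃ ⟶ S.X₂) (ω : Ω.obj S.X₃ ⟶ S.X₁), φ ≫ S.g = L.μ.app S.X₃ →
    L.ι.app S.X₃ ≫ φ = ω ≫ S.f →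
    ∃ h : (toStable _).obj ((incl Ω p).obj S.X₃) ⟶
        hC.stableShift.obj ((toStable _).obj ((incl Ω p).obj S.X₁)),
      hC.triangles.dist ((toStable _).map ((incl Ω p).map S.f))
        ((toStable _).map ((incl Ω p).map S.g)) h ∧
      h ≫ (toStable _).map (L.shiftHom hC ((incl Ω p).obj S.X₁)) =
        (toStable _).map (thirdHom p ω))

/-- The compatibility of the comparison functor with the suspensions. -/
noncomputable abbrev compareComm :
    hC.stableShift ⋙ L.compare hΩ ≅ L.compare hΩ ⋙ suspension (stableMap Ω hΩ) :=
  L.stableComm hC (toStableStab hΩ) (fun u v h => (L.toStableStab_map_eq_iff hΩ u v).mpr h)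
    (toStableStabComm hΩ)

theorem stableTriangles_dist_of_dist {X Y Z : StableCategory (Stabilization Ω)} {f : X ⟶ Y}
    {g : Y ⟶ Z} {h : Z ⟶ hC.stableShift.obj X} (d : hC.triangles.dist f g h) :
    (L.stableTriangles hΩ).dist ((L.compare hΩ).map f) ((L.compare hΩ).map g)
      ((L.compare hΩ).map h ≫ (L.compareComm hC hΩ).hom.app X) := by
  obtain ⟨p, S, φ, ω, hS, hφ, hω, e⟩ := L.exists_triangleIso_of_dist hC (toStableStab hΩ)
    (fun u v h => (L.toStableStab_map_eq_iff hΩ u v).mpr h) (toStableStabComm hΩ) d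
  refine ⟨p, S, φ, ω, hS, hφ, hω, ?_⟩
  rw [toStableStab_map_thirdHom, toStableStab_map_incl_map, toStableStab_map_incl_map] at e
  exact e

include hstd in
-- By `hstd` the short exact sequence also gives a standard triangle in the source, whose image is
-- the triangle attached to that sequence in the target. The isomorphism in the target lifts because
-- the comparison functor is fully faithful.
theorem dist_of_stableTriangles_dist {X Y Z : StableCategory (Stabilization Ω)} {f : X ⟶ Y}
    {g : Y ⟶ Z} {h : Z ⟶ hC.stableShift.obj X}
    (d : (L.stableTriangles hΩ).dist ((L.compare hΩ).map f) ((L.compare hΩ).map g)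
      ((L.compare hΩ).map h ≫ (L.compareComm hC hΩ).hom.app X)) : hC.triangles.dist f g h := by
  obtain ⟨p, S, φ, ω, hS, hφ, hω, e⟩ := d
  obtain ⟨k, d, hk⟩ := hstd p hS φ ω hφ hω
  have := L.compare_isEquivalence hΩ
  refine hC.triangles_dist_of_iso (TriangleIso.of_map (L.compareComm hC hΩ) (e.trans ?_)) d
  have e₁ : (L.compare hΩ).map k ≫
      (toStableStab hΩ).map (L.shiftHom hC ((incl Ω p).obj S.X₁)) =
      (toStableStab hΩ).map (thirdHom p ω) :=
    (Functor.map_comp _ _ _).symm.trans (congrArg (fun t => (L.compare hΩ).map t) hk)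
  have e₂ := toStableStab_map_thirdHom hΩ p ω
  have e₃ := (congrArg (· ≫ (toStableStabComm hΩ).hom.app ((incl Ω p).obj S.X₁)) e₁).trans e₂
  have e₄ := toStableStab_map_incl_map hΩ p S.f
  have e₅ := toStableStab_map_incl_map hΩ p S.g
  have e₆ := (Category.assoc _ _ _).symm.trans e₃
  refine cast ?_ (TriangleIso.refl (F := suspension (stableMap Ω hΩ))
    (X := ⟨(toStable _).obj S.X₁, p⟩) (Y := ⟨(toStable _).obj S.X₂, p⟩)
    (Z := ⟨(toStable _).obj S.X₃, p⟩)
    (homMk 0 0 rfl ((toStable _).map S.f)) (homMk 0 0 rfl ((toStable _).map S.g))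
    (homMk 1 0 (add_zero (p + 1)).symm ((toStable _).map (((p + 1).negOnePow : ℤ) • ω))))
  refine (congrArg (fun t => TriangleIso (suspension (stableMap Ω hΩ))
    (X := ⟨(toStable _).obj S.X₁, p⟩) (Y := ⟨(toStable _).obj S.X₂, p⟩)
    (Z := ⟨(toStable _).obj S.X₃, p⟩) (X₂ := ⟨(toStable _).obj S.X₁, p⟩)
    (Y₂ := ⟨(toStable _).obj S.X₂, p⟩) (Z₂ := ⟨(toStable _).obj S.X₃, p⟩) _ _ _
    (homMk 0 0 rfl ((toStable _).map S.f)) (homMk 0 0 rfl ((toStable _).map S.g)) t) e₆.symm).trans ?_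
  exact congrArg₂ (fun s t => TriangleIso (suspension (stableMap Ω hΩ))
    (X := ⟨(toStable _).obj S.X₁, p⟩) (Y := ⟨(toStable _).obj S.X₂, p⟩)
    (Z := ⟨(toStable _).obj S.X₃, p⟩) (X₂ := ⟨(toStable _).obj S.X₁, p⟩)
    (Y₂ := ⟨(toStable _).obj S.X₂, p⟩) (Z₂ := ⟨(toStable _).obj S.X₃, p⟩) _ _ _
    s t _) e₄.symm e₅.symm

include hstd in
/-- The stable category of the stabilization is triangle equivalent to the stabilization of the
stable category. -/
theorem nonempty_triangleEquivalence :
    Nonempty (TriangleEquivalence hC.triangles (L.stableTriangles hΩ)) :=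
  haveI := L.compare_isEquivalence hΩ
  ⟨{  equiv := (L.compare hΩ).asEquivalence
      comm := L.compareComm hC hΩ
      dist_iff := fun _ _ _ => ⟨fun d => L.stableTriangles_dist_of_dist hC hΩ d,
        fun d => L.dist_of_stableTriangles_dist hC hΩ hstd d⟩ }⟩

end LoopStructure

/-! ### Stalk complexes and perfect complexes in the bounded derived category. -/

section Derived

open Pretriangulated DerivedCategory DerivedCategory.TStructure

variable {A : Type u} [Category.{v} A] [Abelian A] [HasDerivedCategory.{w} A]

/-- There is no morphism from a complex of projective objects in degrees `≥ a` to an object with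
cohomology in degrees `< a`. -/
theorem Qh_hom_eq_zero (K : CochainComplex A ℤ) [K.IsKProjective] {a b : ℤ} (h : b < a)
    [K.IsStrictlyGE a] (L : DerivedCategory A) [L.IsLE b]
    (f : DerivedCategory.Qh.obj ((HomotopyCategory.quotient A (ComplexShape.up ℤ)).obj K) ⟶ L) :
    f = 0 := by
  obtain ⟨M, hM, ⟨e⟩⟩ := L.exists_iso_Q_obj_of_isLE b
  obtain ⟨g, hg⟩ := (CochainComplex.IsKProjective.Qh_map_bijective K
    ((HomotopyCategory.quotient A (ComplexShape.up ℤ)).obj M)).surjective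
      (f ≫ e.hom ≫ ((DerivedCategory.quotientCompQhIso A).app M).inv)
  obtain ⟨k, rfl⟩ := (HomotopyCategory.quotient A (ComplexShape.up ℤ)).map_surjective g
  -- K-projectivity has replaced the morphism by an actual map of complexes from `K`, which starts
  -- in degree `a`, to `M`, which ends in degree `b < a`.
  have hk : k = 0 := by
    ext i
    by_cases hi : i < a
    · exact (CochainComplex.isZero_of_isStrictlyGE K a i hi).eq_of_src _ _
    · exact (CochainComplex.isZero_of_isStrictlyLE M b i (by omega)).eq_of_tgt _ _
  rw [hk, Functor.map_zero, Functor.map_zero] at hg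
  rw [← cancel_mono (e.hom ≫ ((DerivedCategory.quotientCompQhIso A).app M).inv), ← hg, zero_comp]

theorem single_mem_bddProj (Q : A) (hQ : Projective Q) :
    bddProj A ((HomotopyCategory.quotient A (ComplexShape.up ℤ)).obj
      ((CochainComplex.singleFunctor A 0).obj Q)) := by
  refine (bddProj_quotient_iff _).mpr ⟨⟨0, inferInstance⟩, ⟨0, inferInstance⟩, fun i => ?_⟩
  by_cases h : i = 0
  · subst h
    exact Projective.of_iso (HomologicalComplex.singleObjXSelf (ComplexShape.up ℤ) 0 Q).symm hQ
  · exact (HomologicalComplex.isZero_single_obj_X (ComplexShape.up ℤ) 0 Q i h).projective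

variable (A)

/-- The inclusion of the bounded derived category. -/
noncomputable abbrev boundedι : DerivedCategory.Bounded A ⥤ DerivedCategory A :=
  DerivedCategory.Bounded.ι

/-- The functor sending an object to the complex concentrated in degree zero. -/
noncomputable def boundedSingle : A ⥤ DerivedCategory.Bounded A :=
  ObjectProperty.lift _ (DerivedCategory.singleFunctor A 0)
    (fun _ => ⟨⟨0, inferInstance⟩, ⟨0, inferInstance⟩⟩)

instance : (boundedSingle A).Full :=
  Functor.Full.of_comp_faithful_iso (F := boundedSingle A) (ObjectProperty.liftCompιIso _ _ _)

instance : (boundedSingle A).Faithful :=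
  Functor.Faithful.of_comp_iso (F := boundedSingle A) (ObjectProperty.liftCompιIso _ _ _)

instance : (boundedSingle A).Additive where
  map_add {_ _ f g} := (boundedι A).map_injective
    ((DerivedCategory.singleFunctor A 0).map_add (f := f) (g := g))

variable {A}

/-- The connecting morphism of a short exact sequence. -/
noncomputable def boundedδ {S : ShortComplex A} (hS : S.ShortExact) :
    (boundedSingle A).obj S.X₃ ⟶ ((boundedSingle A).obj S.X₁)⟦(1 : ℤ)⟧ :=
  (boundedι A).preimage (hS.singleδ ≫
    ((boundedι A).commShiftIso (1 : ℤ)).inv.app ((boundedSingle A).obj S.X₁))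

theorem ι_map_boundedδ {S : ShortComplex A} (hS : S.ShortExact) :
    (boundedι A).map (boundedδ hS) ≫
      ((boundedι A).commShiftIso (1 : ℤ)).hom.app
        ((boundedSingle A).obj S.X₁) = hS.singleδ := by
  refine (congrArg (· ≫ ((boundedι A).commShiftIso (1 : ℤ)).hom.app
    ((boundedSingle A).obj S.X₁)) ((boundedι A).map_preimage _)).trans ?_
  refine (Category.assoc _ _ _).trans ((congrArg (hS.singleδ ≫ ·)
    (Iso.inv_hom_id_app ((boundedι A).commShiftIso (1 : ℤ)) ((boundedSingle A).obj S.X₁))).trans ?_)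
  exact Category.comp_id _

theorem boundedδ_distinguished {S : ShortComplex A} (hS : S.ShortExact) :
    Triangle.mk ((boundedSingle A).map S.f) ((boundedSingle A).map S.g) (boundedδ hS) ∈
      distTriang (DerivedCategory.Bounded A) := by
  change Triangle.mk ((singleFunctor A 0).map S.f) ((singleFunctor A 0).map S.g)
    ((boundedι A).map (boundedδ hS) ≫
      ((boundedι A).commShiftIso (1 : ℤ)).hom.app
        ((boundedSingle A).obj S.X₁)) ∈ distTriang (DerivedCategory A)
  exact cast (congrArg (fun t => Triangle.mk ((singleFunctor A 0).map S.f)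
    ((singleFunctor A 0).map S.g) t ∈ distTriang (DerivedCategory A)) (ι_map_boundedδ hS).symm)
    hS.singleTriangle_distinguished

theorem boundedδ_naturality {S S' : ShortComplex A} (hS : S.ShortExact) (hS' : S'.ShortExact)
    (f : S ⟶ S') : boundedδ hS ≫ ((boundedSingle A).map f.τ₁)⟦(1 : ℤ)⟧' =
      (boundedSingle A).map f.τ₃ ≫ boundedδ hS' := by
  apply (boundedι A).map_injective
  rw [← cancel_mono (((boundedι A).commShiftIso (1 : ℤ)).hom.app
    ((boundedSingle A).obj S'.X₁)), Functor.map_comp, Functor.map_comp, Category.assoc,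
    Category.assoc, ι_map_boundedδ]
  have e := ((boundedι A).commShiftIso (1 : ℤ)).hom.naturality
    ((boundedSingle A).map f.τ₁)
  refine (congrArg (_ ≫ ·) e).trans ((Category.assoc _ _ _).symm.trans ?_)
  rw [ι_map_boundedδ]
  exact (ShortComplex.ShortExact.singleTriangle.map hS hS' f).comm₃

theorem ι_shift_isLE (Z : A) (n b : ℤ) (h : n + b = 0) :
    ((boundedι A).obj (((boundedSingle A).obj Z)⟦n⟧)).IsLE b :=
  have : DerivedCategory.IsLE ((boundedι A ⋙ shiftFunctor (DerivedCategory A) n).obj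
      ((boundedSingle A).obj Z)) b :=
    DerivedCategory.TStructure.t.isLE_shift ((singleFunctor A 0).obj Z) 0 n b h
  DerivedCategory.TStructure.t.isLE_of_iso
    (((boundedι A).commShiftIso n).app ((boundedSingle A).obj Z)).symm b

theorem boundedSingle_mem_perfect (Q : A) (hQ : Projective Q) :
    perfect A ((boundedSingle A).obj Q) :=
  ⟨⟨_, single_mem_bddProj Q hQ⟩, ⟨(boundedι A).preimageIso
    ((DerivedCategory.quotientCompQhIso A).app ((CochainComplex.singleFunctor A 0).obj Q))⟩⟩

theorem boundedSingle_hom_eq_zero {Q Z : A} (hQ : Projective Q) (n : ℤ) (hn : 0 < n)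
    (f : (boundedSingle A).obj Q ⟶ ((boundedSingle A).obj Z)⟦n⟧) : f = 0 := by
  have h := (bddProj_quotient_iff _).mp (single_mem_bddProj Q hQ)
  have := h.2.2
  have : ((CochainComplex.singleFunctor A 0).obj Q).IsKProjective :=
    CochainComplex.isKProjective_of_projective _ 0
  have := ι_shift_isLE Z n (-n) (by omega)
  apply (boundedι A).map_injective
  rw [Functor.map_zero]
  have e {L : DerivedCategory A} [L.IsLE (-n)]
      (g : DerivedCategory.Q.obj ((CochainComplex.singleFunctor A 0).obj Q) ⟶ L) : g = 0 := by
    have e := Qh_hom_eq_zero ((CochainComplex.singleFunctor A 0).obj Q) (a := 0) (b := -n)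
      (by omega) L ((DerivedCategory.quotientCompQhIso A).hom.app _ ≫ g)
    exact (cancel_epi _).mp (e.trans comp_zero.symm)
  exact e _

/-- A perfect object is a bounded complex of projectives, hence K-projective; if it starts in degree
`a`, it has no morphism to an object with cohomology only in degrees below `a`. -/
theorem perfect_exists_bound (K : DerivedCategory.Bounded A) (hK : perfect A K) :
    ∃ N : ℤ, ∀ i ≥ N, ∀ (Z : A) (f : K ⟶ ((boundedSingle A).obj Z)⟦i⟧), f = 0 := by
  obtain ⟨⟨K₀, hK₀⟩, ⟨e⟩⟩ := hK
  obtain ⟨K₀ : CochainComplex A ℤ, rfl⟩ := K₀.quotient_obj_surjective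
  obtain ⟨⟨a, _⟩, ⟨b, _⟩, h⟩ := (bddProj_quotient_iff K₀).mp hK₀
  have : K₀.IsKProjective := CochainComplex.isKProjective_of_projective _ b
  -- The complex `Z[i]` sits in degree `-i`, which is below `a` exactly when `i ≥ 1 - a`.
  refine ⟨1 - a, fun i hi Z f => ?_⟩
  have := ι_shift_isLE Z i (-i) (by omega)
  have e' : (boundedι A).map (e.hom ≫ f) = 0 := Qh_hom_eq_zero K₀ (a := a) (b := -i) (by omega)
    ((boundedι A).obj (((boundedSingle A).obj Z)⟦i⟧))
    ((boundedι A).map (e.hom ≫ f))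
  rw [← cancel_epi e.hom, comp_zero]
  exact (boundedι A).map_injective (e'.trans ((boundedι A).map_zero _ _).symm)

/-- Induction on the length of the interval supporting the cohomology: a truncation triangle splits
off the top degree, and an object with cohomology in a single degree is a shifted stalk. -/
theorem bounded_generated (Q : ObjectProperty (DerivedCategory.Bounded A))
    (hF : ∀ X, Q ((boundedSingle A).obj X)) (hs : ∀ W (n : ℤ), Q W → Q (W⟦n⟧))
    (hi : ∀ W W' : DerivedCategory.Bounded A, (W ≅ W') → Q W → Q W')
    (ht : ∀ T ∈ distTriang (DerivedCategory.Bounded A), Q T.obj₁ → Q T.obj₃ → Q T.obj₂)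
    (W : DerivedCategory.Bounded A) : Q W := by
  let τ : Triangulated.TStructure (DerivedCategory.Bounded A) :=
    (t : Triangulated.TStructure (DerivedCategory A)).onBounded
  have base (a : ℤ) (W : DerivedCategory.Bounded A) (h₁ : τ.IsGE W a) (h₂ : τ.IsLE W a) : Q W := by
    have : W.obj.IsGE a := (ObjectProperty.tStructure_isGE_iff t.bounded t W a).mp h₁
    have : W.obj.IsLE a := (ObjectProperty.tStructure_isLE_iff t.bounded t W a).mp h₂
    obtain ⟨Y, ⟨e⟩⟩ := W.obj.exists_iso_singleFunctor_obj_of_isGE_of_isLE a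
    refine hi _ _ ?_ (hs _ (-a) (hF Y))
    exact (boundedι A).preimageIso
      (((boundedι A).commShiftIso (-a)).app ((boundedSingle A).obj Y) ≪≫
        ((singleFunctors A).shiftIso (-a) a 0 (by omega)).app Y ≪≫ e.symm)
  have key (n : ℕ) : ∀ (a b : ℤ) (W : DerivedCategory.Bounded A), a + n = b → τ.IsGE W a →
      τ.IsLE W b → Q W := by
    induction n with
    | zero =>
      intro a b W h h₁ h₂
      obtain rfl : a = b := by simpa using h
      exact base a W h₁ h₂
    | succ n ih =>
      intro a b W h h₁ h₂
      refine ht _ (τ.triangleLEGE_distinguished (b - 1) b (by omega) W) ?_ ?_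
      · exact ih a (b - 1) _ (by push_cast at h; omega)
          (inferInstanceAs (τ.IsGE ((τ.truncLE (b - 1)).obj W) a))
          (inferInstanceAs (τ.IsLE ((τ.truncLE (b - 1)).obj W) (b - 1)))
      · exact base b _
          (inferInstanceAs (τ.IsGE ((τ.truncGE b).obj W) b))
          (inferInstanceAs (τ.IsLE ((τ.truncGE b).obj W) b))
  obtain ⟨⟨a, ha⟩, ⟨b, hb⟩⟩ := W.property
  have := (ObjectProperty.tStructure_isLE_iff t.bounded t W b).mpr hb
  -- The upper bound may lie below the lower one, so it is first raised to `max a b`.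
  exact key (max a b - a).toNat a (max a b) W (by omega)
    ((ObjectProperty.tStructure_isGE_iff t.bounded t W a).mpr ha)
    (τ.isLE_of_le W b (max a b) (le_max_right _ _))

variable (A) in
/-- The bounded derived category satisfies the axioms of `StalkFunctor`. -/
noncomputable def stalkFunctor : StalkFunctor A (perfect A) where
  F := boundedSingle A
  full := inferInstance
  faithful := inferInstance
  additive := inferInstance
  δ := boundedδ
  distinguished := boundedδ_distinguished
  δ_naturality := boundedδ_naturality
  mem_of_projective := boundedSingle_mem_perfect
  hom_eq_zero := boundedSingle_hom_eq_zero
  exists_bound := perfect_exists_bound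
  generates := bounded_generated

end Derived

/-! ### The presentation `0 ⟶ Ω_nc ⊗_Λ X ⟶ Λ ⊗_E X ⟶ X ⟶ 0` over a semisimple subring. -/

section ModuleAlgebra

variable {Λ : Type u} [Ring Λ] (E : Subring Λ)

theorem exists_leftInverse_of_injective [IsSemisimpleRing E] {X Y : Type u} [AddCommGroup X]
    [Module Λ X] [AddCommGroup Y] [Module Λ Y] (f : X →ₗ[Λ] Y) (hf : Function.Injective f) :
    ∃ r : Y →ₗ[E] X, ∀ x, r (f x) = x := by
  let f' : X →ₗ[E] Y := { toFun := f, map_add' := map_add f, map_smul' := fun e x => map_smul f (e : Λ) x }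
  obtain ⟨r, hr⟩ := IsSemisimpleModule.extension_property f' hf LinearMap.id
  exact ⟨r, fun x => LinearMap.congr_fun hr x⟩

theorem exists_rightInverse_of_surjective [IsSemisimpleRing E] {X Y : Type u} [AddCommGroup X]
    [Module Λ X] [AddCommGroup Y] [Module Λ Y] (f : X →ₗ[Λ] Y) (hf : Function.Surjective f) :
    ∃ s : Y →ₗ[E] X, ∀ y, f (s y) = y := by
  let f' : X →ₗ[E] Y := { toFun := f, map_add' := map_add f, map_smul' := fun e x => map_smul f (e : Λ) x }
  have := Module.projective_of_isSemisimpleRing E Y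
  obtain ⟨s, hs⟩ := Module.projective_lifting_property f' LinearMap.id hf
  exact ⟨s, fun y => LinearMap.congr_fun hs y⟩

section

variable {X Y Z : Type u} [AddCommGroup X] [Module Λ X] [AddCommGroup Y] [Module Λ Y]
  [AddCommGroup Z] [Module Λ Z]

/-- A `Λ`-linear map, as a map of modules over a subring. -/
def restrictLinear (f : X →ₗ[Λ] Y) : X →ₗ[E] Y where
  toFun := f
  map_add' := map_add f
  map_smul' e x := map_smul f (e : Λ) x

/-- The map `Λ ⊗_E f`. -/
def inducedMap (f : X →ₗ[Λ] Y) : Induced E X →ₗ[Λ] Induced E Y :=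
  BTensor.mapRight E Λ (restrictLinear E f)

/-- The map `Ω_nc ⊗_Λ f`. -/
def formsMap (f : X →ₗ[Λ] Y) : FormsTensor E X →ₗ[Λ] FormsTensor E Y :=
  BTensor.mapRight Λ Λ f

theorem inducedMap_tmul (f : X →ₗ[Λ] Y) (a : Λ) (x : X) :
    inducedMap E f (BTensor.tmul E a x) = BTensor.tmul E a (f x) :=
  BTensor.mapRight_tmul E Λ _ a x

theorem formsMap_tmul (f : X →ₗ[Λ] Y) (t : Forms E) (x : X) :
    formsMap E f (BTensor.tmul Λ t x) = BTensor.tmul Λ t (f x) :=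
  BTensor.mapRight_tmul Λ Λ f t x

theorem iotaMap_formsMap (f : X →ₗ[Λ] Y) (t : FormsTensor E X) :
    iotaMap E Y (formsMap E f t) = inducedMap E f (iotaMap E X t) := by
  induction t using formsTensor_induction with
  | h a x =>
    rw [formsMap_tmul, iotaMap_tmul, iotaMap_tmul, map_sub, inducedMap_tmul, inducedMap_tmul,
      map_smul, map_smul]
  | h0 => simp only [map_zero]
  | ha s t hs ht => simp only [map_add, hs, ht]

theorem muMap_inducedMap (f : X →ₗ[Λ] Y) (t : Induced E X) :
    muMap E Y (inducedMap E f t) = f (muMap E X t) := by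
  induction t using BTensor.induction with
  | h a x => rw [inducedMap_tmul, muMap_tmul, muMap_tmul, map_smul]
  | h0 => simp only [map_zero]
  | ha s t hs ht => simp only [map_add, hs, ht]

theorem iotaMap_injective : Function.Injective (iotaMap E X) :=
  Function.LeftInverse.injective (rhoHom_iotaMap E X)

theorem muMap_surjective : Function.Surjective (muMap E X) := fun x =>
  ⟨BTensor.tmul E 1 x, by rw [muMap_tmul, one_smul]⟩

/-- With `rhoHom_iotaMap` this makes `ρ` and `x ↦ 1 ⊗ x` a contracting homotopy of the presentation.
Exactness follows, with no need for linearity over `Λ`. -/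
theorem iotaMap_rhoHom (t : Induced E X) :
    iotaMap E X (rhoHom E X t) = t - BTensor.tmul E 1 (muMap E X t) := by
  induction t using BTensor.induction with
  | h a x => rw [rhoHom_tmul, iotaMap_tmul, muMap_tmul, one_smul, mul_one]
  | h0 =>
    rw [map_zero, map_zero, map_zero, zero_sub]
    exact (neg_eq_zero.mpr (map_zero (BTensor.tmulHom E (N := X) (1 : Λ)))).symm
  | ha s t hs ht =>
    rw [map_add, map_add, hs, ht, map_add, BTensor.tmul_add]
    abel

theorem exact_iotaMap_muMap : Function.Exact (iotaMap E X) (muMap E X) := fun t =>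
  ⟨fun h => ⟨rhoHom E X t, by
    rw [iotaMap_rhoHom, h]
    exact (congrArg (t - ·) (map_zero (BTensor.tmulHom E (N := X) (1 : Λ)))).trans (sub_zero t)⟩,
    by rintro ⟨s, rfl⟩; exact muMap_iotaMap E X s⟩

/-- A monomorphism of `Λ`-modules splits over `E`, and induction turns the `E`-linear retraction
into a `Λ`-linear one. -/
theorem exists_leftInverse_inducedMap [IsSemisimpleRing E] (f : X →ₗ[Λ] Y)
    (hf : Function.Injective f) :
    ∃ r : Induced E Y →ₗ[Λ] Induced E X, ∀ t, r (inducedMap E f t) = t := by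
  obtain ⟨r, hr⟩ := exists_leftInverse_of_injective E f hf
  refine ⟨BTensor.mapRight E Λ r, fun t => ?_⟩
  induction t using BTensor.induction with
  | h a x => rw [inducedMap_tmul, BTensor.mapRight_tmul, hr]
  | h0 => simp only [map_zero]
  | ha s t hs ht => simp only [map_add, hs, ht]

/-- Over `E` the sequence splits: `y = f (q y) + s (g y)` for `E`-linear maps `q` and `s`. The
identity persists after `Λ ⊗_E -`, and its second term dies on the kernel. -/
theorem exists_inducedMap_eq [IsSemisimpleRing E] (f : X →ₗ[Λ] Y) (g : Y →ₗ[Λ] Z)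
    (hf : Function.Injective f) (hfg : Function.Exact f g) (hg : Function.Surjective g)
    (t : Induced E Y) (ht : inducedMap E g t = 0) : ∃ s, inducedMap E f s = t := by
  obtain ⟨r, hr⟩ := exists_leftInverse_of_injective E f hf
  obtain ⟨s, hs⟩ := exists_rightInverse_of_surjective E g hg
  have key (y : Y) : f (r (y - s (g y))) = y - s (g y) := by
    obtain ⟨x, hx⟩ := (hfg (y - s (g y))).mp (by rw [map_sub, hs, sub_self])
    rw [← hx, hr]
  let q : Y →ₗ[E] X := r.comp (LinearMap.id - s.comp (restrictLinear E g))
  have h : inducedMap E f (BTensor.mapRight E Λ q t) + BTensor.mapRight E Λ s (inducedMap E g t) = t := by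
    clear ht
    induction t using BTensor.induction with
    | h a y =>
      rw [BTensor.mapRight_tmul, inducedMap_tmul, inducedMap_tmul, BTensor.mapRight_tmul,
        ← BTensor.tmul_add]
      congr 1
      exact (congrArg (· + s (g y)) (key y)).trans (sub_add_cancel _ _)
    | h0 => simp only [map_zero, add_zero]
    | ha x y hx hy =>
      simp only [map_add]
      rw [add_add_add_comm, hx, hy]
  rw [ht, map_zero, add_zero] at h
  exact ⟨_, h⟩

theorem formsMap_injective [IsSemisimpleRing E] (f : X →ₗ[Λ] Y) (hf : Function.Injective f) :
    Function.Injective (formsMap E f) := by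
  obtain ⟨r, hr⟩ := exists_leftInverse_inducedMap E f hf
  intro s t h
  apply iotaMap_injective E
  rw [← hr (iotaMap E X s), ← hr (iotaMap E X t), ← iotaMap_formsMap, h, iotaMap_formsMap]

theorem formsMap_surjective (f : X →ₗ[Λ] Y) (hf : Function.Surjective f) :
    Function.Surjective (formsMap E f) := by
  intro t
  induction t using BTensor.induction with
  | h m y =>
    obtain ⟨x, rfl⟩ := hf y
    exact ⟨BTensor.tmul Λ m x, formsMap_tmul E f m x⟩
  | h0 => exact ⟨0, map_zero _⟩
  | ha s t hs ht =>
    obtain ⟨s, rfl⟩ := hs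
    obtain ⟨t, rfl⟩ := ht
    exact ⟨s + t, map_add _ _ _⟩

/-- A chase in the diagram of presentations of `X`, `Y` and `Z`, whose middle terms form an exact
sequence. -/
theorem formsMap_exact [IsSemisimpleRing E] (f : X →ₗ[Λ] Y) (g : Y →ₗ[Λ] Z)
    (hf : Function.Injective f) (hfg : Function.Exact f g) (hg : Function.Surjective g) :
    Function.Exact (formsMap E f) (formsMap E g) := by
  intro t
  constructor
  · intro ht
    obtain ⟨s, hs⟩ := exists_inducedMap_eq E f g hf hfg hg (iotaMap E Y t) (by
      rw [← iotaMap_formsMap, ht, map_zero])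
    -- The image of `μ s` under the injective map `f` is `μ (ι t) = 0`, so `s` comes from the forms.
    obtain ⟨r, rfl⟩ := (exact_iotaMap_muMap E s).mp (hf (by
      rw [← muMap_inducedMap, hs, muMap_iotaMap, map_zero]))
    exact ⟨r, iotaMap_injective E (by rw [iotaMap_formsMap, hs])⟩
  · rintro ⟨s, rfl⟩
    induction s using formsTensor_induction with
    | h a x =>
      rw [formsMap_tmul, formsMap_tmul, hfg.apply_apply_eq_zero]
      exact map_zero (BTensor.tmulHom Λ (N := Z) (Forms.mk a 1 : Forms E))
    | h0 => simp only [map_zero]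
    | ha s t hs ht => rw [map_add, map_add, hs, ht, add_zero]

variable (X)

/-- The map `X ⟶ Λ ⊗_E X`, `x ↦ 1 ⊗ x`. -/
def oneTensor : X →+ Induced E X := BTensor.tmulHom E (1 : Λ)

variable {X} in
theorem oneTensor_smul (e : E) (x : X) :
    oneTensor E X ((e : Λ) • x) = (e : Λ) • oneTensor E X x := by
  refine Eq.trans ?_ (BTensor.smul_tmul' E (e : Λ) (1 : Λ) x).symm
  refine (BTensor.smul_tmul E e (1 : Λ) x).symm.trans ?_
  congr 1
  exact (one_mul (e : Λ)).trans (mul_one (e : Λ)).symm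

variable {X} in
theorem smul_oneTensor (a : Λ) (x : X) : a • oneTensor E X x = BTensor.tmul E a x :=
  (BTensor.smul_tmul' E a (1 : Λ) x).trans (by rw [smul_eq_mul, mul_one])

variable {X} in
theorem muMap_oneTensor (x : X) : muMap E X (oneTensor E X x) = x :=
  (muMap_tmul E X 1 x).trans (one_smul Λ x)

variable {X} in
theorem rhoHom_oneTensor (x : X) : rhoHom E X (oneTensor E X x) = 0 := by
  refine (rhoHom_tmul E X 1 x).trans ?_
  rw [Forms.mk_mem E.one_mem]
  exact map_zero ((BTensor.tmulHom Λ (M := Forms E) (N := X)).flip _)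

variable {X} in
/-- The `Λ`-linear map `a ⊗ x ↦ a f(x)` given by an `E`-linear map `f`. -/
def extend (f : X →+ Y) (hf : ∀ (e : E) (x : X), f ((e : Λ) • x) = (e : Λ) • f x) :
    Induced E X →ₗ[Λ] Y :=
  (muMap E Y).comp (BTensor.mapRight E Λ { toFun := f, map_add' := map_add f, map_smul' := hf })

variable {X} in
theorem extend_tmul (f : X →+ Y) (hf : ∀ (e : E) (x : X), f ((e : Λ) • x) = (e : Λ) • f x)
    (a : Λ) (x : X) : extend E f hf (BTensor.tmul E a x) = a • f x := by
  refine (congrArg (muMap E Y) (BTensor.mapRight_tmul E Λ _ a x)).trans ?_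
  exact muMap_tmul E _ a _

/-- The map `Λ ⊗_E X ⟶ Λ ⊗_E Λ ⊗_E X`, `a ⊗ x ↦ a ⊗ 1 ⊗ x`. -/
def insertOne : Induced E X →ₗ[Λ] Induced E (Induced E X) :=
  extend E ((oneTensor E (Induced E X)).comp (oneTensor E X)) fun e x =>
    (congrArg (oneTensor E (Induced E X)) (oneTensor_smul E e x)).trans (oneTensor_smul E e _)

theorem insertOne_tmul (a : Λ) (x : X) : insertOne E X (BTensor.tmul E a x) =
    a • oneTensor E (Induced E X) (oneTensor E X x) :=
  extend_tmul E _ _ a x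

theorem muMap_insertOne (t : Induced E X) : muMap E (Induced E X) (insertOne E X t) = t := by
  induction t using BTensor.induction with
  | h a x => rw [insertOne_tmul, map_smul, muMap_oneTensor, smul_oneTensor]
  | h0 => simp only [map_zero]
  | ha s t hs ht => simp only [map_add, hs, ht]

/-- The additive map `Ω_nc ⊗_Λ X ⟶ Ω_nc ⊗_Λ Λ ⊗_E X`, `(ā ⊗ 1) ⊗ x ↦ (ā ⊗ 1) ⊗ (1 ⊗ x)`. -/
def formsInsertHom : FormsTensor E X →+ FormsTensor E (Induced E X) :=
  (rhoHom E (Induced E X)).comp ((insertOne E X).comp (iotaMap E X)).toAddMonoidHom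

theorem formsInsertHom_apply (t : FormsTensor E X) :
    formsInsertHom E X t = rhoHom E (Induced E X) (insertOne E X (iotaMap E X t)) := rfl

/-- The map fails to be `Λ`-linear by the term `(ā ⊗ 1) ⊗ ι t`. This vanishes for `a` in `E`, so the
map extends from `E` to `Λ`; in `exchange_iotaMap` the same term produces the sign. -/
theorem formsInsertHom_smul (a : Λ) (t : FormsTensor E X) :
    formsInsertHom E X (a • t) =
      a • formsInsertHom E X t + BTensor.tmul Λ (Forms.mk a 1) (iotaMap E X t) := by
  rw [formsInsertHom_apply, map_smul, map_smul, rhoHom_smul, muMap_insertOne]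
  rfl

/-- The map `Λ ⊗_E Ω_nc ⊗_Λ X ⟶ Ω_nc ⊗_Λ Λ ⊗_E X`. -/
def exchange : Induced E (FormsTensor E X) →ₗ[Λ] FormsTensor E (Induced E X) :=
  extend E (formsInsertHom E X) fun e t => by
    rw [formsInsertHom_smul, Forms.mk_mem e.2]
    exact (congrArg ((e : Λ) • formsInsertHom E X t + ·)
      (map_zero ((BTensor.tmulHom Λ (M := Forms E) (N := Induced E X)).flip _))).trans (add_zero _)

theorem exchange_tmul (a : Λ) (t : FormsTensor E X) :
    exchange E X (BTensor.tmul E a t) = a • formsInsertHom E X t :=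
  extend_tmul E _ _ a t

/-- For `j = formsInsertHom`, the element `a ⊗ t - 1 ⊗ at` goes to `a • j t - j (a • t)`, which is
minus the defect of linearity of `j`. -/
theorem exchange_iotaMap (t : FormsTensor E (FormsTensor E X)) :
    exchange E X (iotaMap E (FormsTensor E X) t) = - formsMap E (iotaMap E X) t := by
  induction t using formsTensor_induction with
  | h a t =>
    rw [iotaMap_tmul, map_sub, exchange_tmul, exchange_tmul, one_smul, one_smul, mul_one,
      formsInsertHom_smul, formsMap_tmul]
    abel
  | h0 => simp only [map_zero, neg_zero]
  | ha s t hs ht => simp only [map_add, hs, ht, neg_add]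

theorem formsMap_muMap_formsInsertHom (t : FormsTensor E X) :
    formsMap E (muMap E X) (formsInsertHom E X t) = t := by
  induction t using formsTensor_induction with
  | h a x =>
    rw [formsInsertHom_apply, iotaMap_tmul, map_sub, insertOne_tmul, insertOne_tmul, map_sub,
      rhoHom_smul, one_smul, one_smul, rhoHom_oneTensor, rhoHom_oneTensor, smul_zero, zero_add,
      sub_zero, muMap_oneTensor, formsMap_tmul, muMap_oneTensor]
  | h0 => simp only [map_zero]
  | ha s t hs ht => simp only [map_add, hs, ht]

theorem formsMap_muMap_exchange (t : Induced E (FormsTensor E X)) :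
    formsMap E (muMap E X) (exchange E X t) = muMap E (FormsTensor E X) t := by
  induction t using BTensor.induction with
  | h a t => rw [exchange_tmul, map_smul, formsMap_muMap_formsInsertHom, muMap_tmul]
  | h0 => simp only [map_zero]
  | ha s t hs ht => simp only [map_add, hs, ht]

end

end ModuleAlgebra

/-! ### The syzygy presentation of finitely generated modules. -/

section

variable {Λ : Type u} [Ring Λ]

theorem shortExact_iff [IsNoetherianRing Λ] (S : ShortComplex (FGModuleCat.{u} Λ)) :
    S.ShortExact ↔ Function.Injective S.f.hom.hom ∧ Function.Exact S.f.hom.hom S.g.hom.hom ∧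
      Function.Surjective S.g.hom.hom := by
  let F := forget₂ (FGModuleCat.{u} Λ) (ModuleCat.{u} Λ)
  have : F.Additive := { }
  constructor
  · intro h
    have h' := h.map_of_exact F
    exact ⟨h'.moduleCat_injective_f,
      (ShortComplex.ShortExact.moduleCat_exact_iff_function_exact _).mp h'.exact,
      h'.moduleCat_surjective_g⟩
  · rintro ⟨h₁, h₂, h₃⟩
    have h' : (S.map F).ShortExact := ModuleCat.shortComplex_shortExact _ h₂ h₁ h₃
    exact
      { exact := (S.exact_map_iff_of_faithful F).mp h'.exact
        mono_f := F.mono_of_mono_map h'.mono_f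
        epi_g := F.epi_of_epi_map h'.epi_g }

variable [IsArtinianRing Λ] (E : Subring Λ) [IsSemisimpleRing E] [Module.Finite E Λ]

theorem tensorFunctor_shortExact (S : ShortComplex (FGModuleCat.{u} Λ)) (hS : S.ShortExact) :
    (S.map (tensorFunctor E)).ShortExact := by
  obtain ⟨h₁, h₂, h₃⟩ := (shortExact_iff S).mp hS
  exact (shortExact_iff _).mpr ⟨formsMap_injective E _ h₁, formsMap_exact E _ _ h₁ h₂ h₃,
    formsMap_surjective E _ h₃⟩

theorem tensorFunctor_exact :
    PreservesFiniteLimits (tensorFunctor E) ∧ PreservesFiniteColimits (tensorFunctor E) :=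
  ((tensorFunctor E).exact_tfae.out 0 3 rfl rfl).mp (tensorFunctor_shortExact E)

instance : PreservesFiniteLimits (tensorFunctor E) :=
  (tensorFunctor_exact E).1

instance : PreservesFiniteColimits (tensorFunctor E) :=
  (tensorFunctor_exact E).2

/-- The functor `Λ ⊗_E -`. -/
def inducedFunctor : FGModuleCat.{u} Λ ⥤ FGModuleCat.{u} Λ where
  obj X := induced E X
  map f := FGModuleCat.ofHom (inducedMap E f.hom.hom)
  map_id _ := FGModuleCat.hom_ext (BTensor.linear_ext E fun a x => inducedMap_tmul E _ a x)
  map_comp f g := FGModuleCat.hom_ext (BTensor.linear_ext E fun a x =>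
    (inducedMap_tmul E _ a x).trans
      ((congrArg (inducedMap E g.hom.hom) (inducedMap_tmul E f.hom.hom a x)).trans
        (inducedMap_tmul E g.hom.hom a _)).symm)

/-- The presentation `0 ⟶ Ω_nc ⊗_Λ X ⟶ Λ ⊗_E X ⟶ X ⟶ 0`, which makes `Ω_nc ⊗_Λ -` a
syzygy functor. -/
def loopStructure : LoopStructure (tensorFunctor E) where
  G := inducedFunctor E
  ι :=
    { app := iota E
      naturality := fun _ _ f => FGModuleCat.hom_ext
        (LinearMap.ext fun t => iotaMap_formsMap E f.hom.hom t) }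
  μ :=
    { app := mu E
      naturality := fun _ _ f => FGModuleCat.hom_ext
        (LinearMap.ext fun t => muMap_inducedMap E f.hom.hom t) }
  zero X := FGModuleCat.hom_ext (LinearMap.ext fun t => muMap_iotaMap E X t)
  shortExact X := (shortExact_iff _).mpr
    ⟨iotaMap_injective E, exact_iotaMap_muMap E, muMap_surjective E⟩
  projective X :=
    have : Module.Projective Λ (induced E X) := induced_projective E X
    projective_of_module (induced E X)
  exists_retraction {X Y} i _ := by
    have hi : Function.Injective i.hom.hom :=
      (ModuleCat.mono_iff_injective _).mp
        (inferInstanceAs (Mono ((forget₂ (FGModuleCat.{u} Λ) (ModuleCat.{u} Λ)).map i)))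
    obtain ⟨r, hr⟩ := exists_leftInverse_inducedMap E i.hom.hom hi
    exact ⟨FGModuleCat.ofHom r, FGModuleCat.hom_ext (LinearMap.ext hr)⟩
  ψ X := FGModuleCat.ofHom (exchange E X)
  ι_ψ X := FGModuleCat.hom_ext (LinearMap.ext fun t => exchange_iotaMap E X t)
  ψ_μ X := FGModuleCat.hom_ext (LinearMap.ext fun t => formsMap_muMap_exchange E X t)

end

/-! ### Projective objects as summands of sums of the `(Λ, n)`. -/

section Retracts

variable {C : Type u} [Category.{v} C]

/-- In an abelian category a retract is a direct summand, with the cokernel of the section as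
complement. -/
theorem inAdd_of_retract [Abelian C] {J : Type*} {U : J → C} {X P : C} (r : Retract X P) (k : ℕ)
    (j : Fin k → J) (b : Bicone fun i => U (j i)) (hb : b.IsBilimit) (e : Retract P b.pt) :
    InAdd U X := by
  let q : Retract X b.pt := r.trans e
  let S : ShortComplex C := ShortComplex.mk q.i (cokernel.π q.i) (cokernel.condition _)
  have hS : S.Exact := ShortComplex.exact_cokernel q.i
  let s : S.Splitting := ShortComplex.Splitting.ofExactOfRetraction S hS q.r q.retract
    (inferInstanceAs (Epi (cokernel.π q.i)))
  exact ⟨k, j, b, cokernel q.i, BinaryBiproduct.bicone X (cokernel q.i), ⟨hb⟩,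
    ⟨BinaryBiproduct.isBilimit _ _⟩, ⟨s.isoBinaryBiproduct.symm⟩⟩

theorem InAdd.projective [Preadditive C] {J : Type*} {U : J → C}
    (hU : ∀ j, Projective (U j)) {X : C} (h : InAdd U X) : Projective X := by
  obtain ⟨k, j, b, Y, c, ⟨hb⟩, -, ⟨e⟩⟩ := h
  have : Projective b.pt :=
    { factors := fun f g _ =>
        ⟨∑ i, b.π i ≫ ((hU (j i)).factors (b.ι i ≫ f) g).choose, by
          rw [Preadditive.sum_comp]
          refine (Finset.sum_congr rfl fun i _ => ?_).trans ((Preadditive.sum_comp _ _ _).symm.trans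
            ((congrArg (· ≫ f) (IsBilimit.total hb)).trans (Category.id_comp f)))
          rw [Category.assoc, ((hU (j i)).factors (b.ι i ≫ f) g).choose_spec, Category.assoc]⟩ }
  exact Retract.projective (Y := b.pt)
    ⟨c.inl ≫ e.hom, e.inv ≫ c.fst, by
      rw [Category.assoc, e.hom_inv_id_assoc, c.inl_fst]⟩

end Retracts

section

variable {Λ : Type u} [Ring Λ]

/-- The free module `Λ ^ k`, as a direct sum. -/
def freeBicone (k : ℕ) : Bicone fun _ : Fin k => FGModuleCat.of Λ Λ where
  pt := FGModuleCat.of Λ (Fin k → Λ)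
  π i := FGModuleCat.ofHom (LinearMap.proj i)
  ι i := FGModuleCat.ofHom (LinearMap.single Λ (fun _ => Λ) i)
  ι_π i j := by
    split_ifs with h
    · subst h
      exact FGModuleCat.hom_ext (LinearMap.proj_comp_single_same Λ (fun _ : Fin k => Λ) i)
    · exact FGModuleCat.hom_ext
        (LinearMap.proj_comp_single_ne Λ (fun _ : Fin k => Λ) j i (Ne.symm h))

/-- `Λ ^ k` is the direct sum of `k` copies of `Λ`. -/
noncomputable def freeBiconeIsBilimit (k : ℕ) : (freeBicone (Λ := Λ) k).IsBilimit :=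
  isBilimitOfTotal _ (by
    refine FGModuleCat.hom_ext (LinearMap.ext fun x => ?_)
    have h : ∀ (s : Finset (Fin k)),
        (∑ i ∈ s, (freeBicone (Λ := Λ) k).π i ≫ (freeBicone (Λ := Λ) k).ι i).hom.hom x =
          ∑ i ∈ s, Pi.single i (x i) := by
      intro s
      classical
      induction s using Finset.induction_on with
      | empty => rfl
      | insert i s hi ih =>
        rw [Finset.sum_insert hi, Finset.sum_insert hi, ← ih]
        rfl
    exact (h Finset.univ).trans (Finset.univ_sum_single x))

theorem exists_retract_free (P : FGModuleCat.{u} Λ) [Projective P] :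
    ∃ k, Nonempty (Retract P (freeBicone (Λ := Λ) k).pt) := by
  obtain ⟨k, f, hf⟩ := Module.Finite.exists_fin' Λ P
  let p : FGModuleCat.of Λ (Fin k → Λ) ⟶ P := FGModuleCat.ofHom f
  have : Epi p := ConcreteCategory.epi_of_surjective p hf
  obtain ⟨s, hs⟩ := Projective.factors (𝟙 P) p
  exact ⟨k, ⟨⟨s, p, hs⟩⟩⟩

open Stabilization

variable [IsArtinianRing Λ] (E : Subring Λ) [IsSemisimpleRing E] [Module.Finite E Λ]

/-- A projective `(X, n)` is a retract of `(Λ ⊗_E X, n)`, and `Λ ⊗_E X`, being finitely generated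
projective, is a retract of some `Λ ^ k`; the additive functor `incl` preserves this direct sum. -/
theorem projective_iff_inAdd (X : Stabilization (tensorFunctor E)) :
    Projective X ↔ InAdd (fun n : ℤ =>
      (⟨FGModuleCat.of Λ Λ, n⟩ : Stabilization (tensorFunctor E))) X := by
  constructor
  · intro hX
    obtain ⟨r⟩ := ((loopStructure E).projective_iff_retract X).mp hX
    have := (loopStructure E).projective X.obj
    obtain ⟨k, ⟨q⟩⟩ := exists_retract_free ((loopStructure E).G.obj X.obj)
    let F := incl (tensorFunctor E) X.deg
    exact inAdd_of_retract r k (fun _ => X.deg) (F.mapBicone (freeBicone k))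
      (isBilimitOfPreserves F (freeBiconeIsBilimit k)) (q.map F)
  · refine InAdd.projective fun n => ?_
    have : Projective (FGModuleCat.of Λ Λ) :=
      have : Module.Projective Λ (FGModuleCat.of Λ Λ) := inferInstanceAs (Module.Projective Λ Λ)
      projective_of_module _
    exact (loopStructure E).projective_incl (FGModuleCat.of Λ Λ) n

theorem stableTriangles_eq (hΩ : ∀ P : FGModuleCat.{u} Λ, Projective P →
    Projective ((tensorFunctor E).obj P)) :
    (loopStructure E).stableTriangles hΩ = moduleTriangles E := by
  unfold moduleTriangles LoopStructure.stableTriangles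
  congr 1
  funext X Y Z u v w
  refine propext ⟨?_, ?_⟩
  · rintro ⟨n, S, φ, ω, hS, hφ, hω, h⟩
    obtain ⟨h₁, h₂, h₃⟩ := (shortExact_iff S).mp hS
    exact ⟨n, S.X₁, S.X₂, S.X₃, S.f, S.g, φ, ω, h₁, h₂, h₃, hφ, hω, h⟩
  · rintro ⟨n, X, Y, Z, f, g, φ, ω, h₁, h₂, h₃, hφ, hω, h⟩
    have hfg : f ≫ g = 0 := FGModuleCat.hom_ext h₂.linearMap_comp_eq_zero
    exact ⟨n, ShortComplex.mk f g hfg, φ, ω, (shortExact_iff _).mpr ⟨h₁, h₂, h₃⟩, hφ, hω, h⟩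

end

end Looped

theorem propositionA {Λ : Type u} [Ring Λ] [IsArtinianRing Λ] (E : Subring Λ) [IsSemisimpleRing E]
    [Module.Finite E Λ] [HasDerivedCategory.{w} (FGModuleCat.{u} Λ)] :
    ∃ hS : Looped.IsFrobeniusAbelian (Looped.Stabilization (Looped.tensorFunctor E)),
      (∀ X : Looped.Stabilization (Looped.tensorFunctor E),
        Projective X ↔ Looped.InAdd (fun n : ℤ =>
          (⟨FGModuleCat.of Λ Λ, n⟩ : Looped.Stabilization (Looped.tensorFunctor E))) X) ∧
      Nonempty (Looped.TriangleEquivalence hS.triangles (Looped.moduleTriangles E)) ∧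
      Nonempty (Looped.TriangleEquivalence hS.triangles
        (Looped.TriangleData.ofPretriangulated
          (Looped.SingularityCategory (FGModuleCat.{u} Λ)))) := by
  have hS := (Looped.loopStructure E).isFrobeniusAbelian
  have hΩ (P : FGModuleCat.{u} Λ) (_ : Projective P) :
      Projective ((Looped.tensorFunctor E).obj P) := (Looped.loopStructure E).projective_obj P
  let Loc := (Looped.perfect (FGModuleCat.{u} Λ)).trW.Q
  refine ⟨hS, Looped.projective_iff_inAdd E, ?_,
    ⟨(Looped.stalkFunctor (FGModuleCat.{u} Λ)).triangleEquivalence (Looped.loopStructure E) Loc hS⟩⟩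
  rw [← Looped.stableTriangles_eq E hΩ]
  -- That short exact sequences of modules give standard triangles is taken from the singularity
  -- category, so this equivalence too rests on the functor to the Verdier quotient.
  exact (Looped.loopStructure E).nonempty_triangleEquivalence hS hΩ fun p S h φ ω hφ hω =>
    (Looped.stalkFunctor (FGModuleCat.{u} Λ)).exists_dist_of_shortExact (Looped.loopStructure E)
      Loc hS p h φ ω hφ hω
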